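/- **Setting.** Let $D\subset\mathbb R^2$ be a non-empty bounded simply connected domain whose boundary has finitely many connected components, each of positive diameter. All distances are Euclidean. For real $n>0$ let $D_n=\{x\in\mathbb Z^2: d(e^{-n}x,D^c)>e^{-n}\}$, and let $D_n^\circ=\{x\in\mathbb Z^2:\log d(x,\mathbb Z^2\setminus D_n)>n-2\log n\}$ be its bulk. Let $\widehat D_n$ be the graph obtained from $D_n$ and its outer boundary in $\mathbb Z^2$ by contracting the outer boundary to one vertex $\partial$ (keeping parallel edges). Let $\mathbf X=(\mathbf X_u)_{u\ge 0}$ be the continuous-time random walk on $\widehat D_n$ that starts at $\partial$ and crosses each edge at rate $1/(2\pi)$. Put $\mathbf L_u(x)=\int_0^u 1_{\{\mathbf X_v=x\}}\,dv$, $\mathbf T_{n,t}=\inf\{u\ge 0:\mathbf L_u(\partial)>t\}$ and $L_t(x)=\mathbf L_{\mathbf T_{n,t}}(x)$. For a set $A\subseteq D_n$ let $\check T_A=\inf\{t\ge 0: L_t(x)>0\ \ \forall x\in A\}$ be its cover $\partial$-time and, if $A\neq\emptyset$, let $\check X_A$ be the vertex of $A$ that is visited for the first time last, i.e. the position of $\mathbf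 X$ at the first real time by which all of $A$ has been visited. Fix $\eta_0\in(0,1/2)$ and put $r_n=n^{1/2-\eta_0}$, $t_n^B=\frac12 n\log n$ and $B(z;r)=\{x\in\mathbb Z^2:\|x-z\|\le\lfloor e^r\rfloor\}$. A set $A$ is $(r,R)$-clustered if $\log\|x-y\|\notin(r,R)$ for all $x,y\in A$. A minimal $r$-cover of $A$ is a set $\mathbf A\subset\mathbb Z^2$ of smallest cardinality with $A\subseteq\bigcup_{z\in\mathbf A}B(z;r)$. Given a minimal $r_n$-cover $\mathbf A$ of $A$, let $\Xi_A=\sum_{z\in\mathbf A}\delta_{e^{-n}z}$, let $\|\Xi_A\|$ be its total mass and $\Xi_A^\circ=\Xi_A/\|\Xi_A\|$, and for $s\in\mathbb R$ let $$G_n(s,A)=\exp\Big(-e^{-\left(s-\log(\|\Xi_A\|/\sqrt n)\right)}\Big).$$ For $W\subseteq D$ let $S_{A,W}$ be the set of the points $e^{-n}z$, $z\in\mathbf A$, for which $W$ separates the centre $z$ from some point of its cluster: there is $x\in A\cap B(z;r_n)$ such that exactly one of $e^{-n}x$ and $e^{-n}z$ lies in $W$. **Theorem.** 1. For every compact $K\subset\mathbb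 R$ and every $\varepsilon>0$ there is $n_0$ such that for all real $n\ge n_0$, all $s\in K$, all non-empty $(r_n,n-r_n)$-clustered sets $A\subseteq D_n^\circ$, all minimal $r_n$-covers $\mathbf A$ of $A$ and all subsets $W\subseteq D$, $$\Big|\mathbb P\big(\check T_A\le t_n^B+sn,\ \check X_A\in e^nW\big)-G_n(s,A)\,\Xi_A^\circ(W)\Big|\ \le\ \varepsilon+G_n(s,A)\,\Xi_A^\circ(S_{A,W}).$$ In particular the left-hand side tends to $0$ uniformly in $s\in K$, in $A$, in $\mathbf A$, and in all $W\subseteq D$ that separate no centre from a point of its cluster (for instance $W=D$). 2. For every $s\in\mathbb R$ there is $n_0$ such that for all real $n\ge n_0$ and all sets $A\subseteq D_n$, $$\mathbb P\big(\check T_A>t_n^B+sn\big)\le 2e^{-s}\,\frac{|A|}{\sqrt n}.$$ 3. For every $s\in\mathbb R$, $$\frac{\mathbf T_{n,t_n^B+sn}/|D_n|-(t_n^B+sn)}{n}\longrightarrow 0\quad\text{in probability as }n\to\infty.$$ -/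

import Mathlib

open MeasureTheory ProbabilityTheory Filter Topology

noncomputable section

namespace PhaseB

/-! ### The planar domain and its lattice versions -/

/-- The Euclidean plane. -/
abbrev Plane : Type := EuclideanSpace ℝ (Fin 2)

/-- A vertex of `ℤ²` seen as a point of the plane. -/
def toPlane (x : ℤ × ℤ) : Plane := !₂[(x.1 : ℝ), (x.2 : ℝ)]

/-- The Euclidean distance between two vertices of `ℤ²`. -/
def eDist (x y : ℤ × ℤ) : ℝ := ‖toPlane x - toPlane y‖

/-- A bounded simply connected domain of the plane (simply connected sets are non-empty and path
connected) whose boundary has finitely many connected components, each of positive diameter. -/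
structure PlanarDomain where
  carrier : Set Plane
  isOpen : IsOpen carrier
  isBounded : Bornology.IsBounded carrier
  isSimplyConnected : IsSimplyConnected carrier
  finite_boundary_components :
    {C : Set Plane | ∃ x ∈ frontier carrier, C = connectedComponentIn (frontier carrier) x}.Finite
  diam_boundary_pos :
    ∀ x ∈ frontier carrier, 0 < Metric.diam (connectedComponentIn (frontier carrier) x)

/-- The vertices `x ∈ ℤ²` with `d(e⁻ⁿ x, Dᶜ) > e⁻ⁿ`, as a set. -/
def latticeSet (D : PlanarDomain) (n : ℝ) : Set (ℤ × ℤ) :=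
  {x | Real.exp (-n) < Metric.infDist (Real.exp (-n) • toPlane x) D.carrierᶜ}

theorem latticeSet_finite (D : PlanarDomain) (n : ℝ) : (latticeSet D n).Finite := by
  obtain ⟨R, hR⟩ := D.isBounded.exists_norm_le
  set M : ℤ := ⌈R * Real.exp n⌉
  refine (Set.finite_Icc ((-M, -M) : ℤ × ℤ) (M, M)).subset ?_
  intro x hx
  have hmem : Real.exp (-n) • toPlane x ∈ D.carrier := by
    by_contra hc
    have h0 : Metric.infDist (Real.exp (-n) • toPlane x) D.carrierᶜ = 0 :=
      Metric.infDist_zero_of_mem hc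
    have h1 : Real.exp (-n) < Metric.infDist (Real.exp (-n) • toPlane x) D.carrierᶜ := hx
    rw [h0] at h1
    exact absurd h1 (not_lt.mpr (Real.exp_pos _).le)
  have hn := hR _ hmem
  have key : ∀ i : Fin 2, |toPlane x i| ≤ M := by
    intro i
    have h1 : ‖toPlane x i‖ ≤ ‖toPlane x‖ := PiLp.norm_apply_le _ i
    rw [norm_smul, Real.norm_eq_abs, abs_of_pos (Real.exp_pos _), Real.exp_neg] at hn
    have h2 : ‖toPlane x‖ ≤ R * Real.exp n := by
      have := (inv_mul_le_iff₀ (Real.exp_pos n)).mp hn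
      linarith [mul_comm R (Real.exp n)]
    have h3 : R * Real.exp n ≤ (M : ℝ) := Int.le_ceil _
    rw [Real.norm_eq_abs] at h1
    linarith
  have k0 : |(x.1 : ℝ)| ≤ M := by simpa [toPlane] using key 0
  have k1 : |(x.2 : ℝ)| ≤ M := by simpa [toPlane] using key 1
  rw [abs_le] at k0 k1
  refine ⟨⟨?_, ?_⟩, ⟨?_, ?_⟩⟩ <;> simp only
  · exact_mod_cast k0.1
  · exact_mod_cast k1.1
  · exact_mod_cast k0.2
  · exact_mod_cast k1.2

/-- The lattice domain `D_n`, at scale `N = eⁿ`. -/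
def latticeDomain (D : PlanarDomain) (n : ℝ) : Finset (ℤ × ℤ) :=
  (latticeSet_finite D n).toFinset

/-- The bulk `D_n°`: the vertices `x` with `log d(x, D_nᶜ) > n - 2 log n`, the complement being
taken in `ℤ²`. -/
def bulk (D : PlanarDomain) (n : ℝ) : Set (ℤ × ℤ) :=
  {x | Real.exp (n - 2 * Real.log n) <
    Metric.infDist (toPlane x) (toPlane '' {y : ℤ × ℤ | y ∉ latticeDomain D n})}

/-! ### The wired graph -/

/-- The vertices of the wired graph: those of `D_n`, and `none`, which stands for the vertex `∂`
obtained by contracting the outer boundary of `D_n`. -/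
abbrev Vertex (D : PlanarDomain) (n : ℝ) : Type := Option {x : ℤ × ℤ // x ∈ latticeDomain D n}

instance (D : PlanarDomain) (n : ℝ) : MeasurableSpace (Vertex D n) := ⊤

instance (D : PlanarDomain) (n : ℝ) : DiscreteMeasurableSpace (Vertex D n) := ⟨fun _ => trivial⟩

/-- The four neighbours of a vertex of `ℤ²`. -/
def neighbors (x : ℤ × ℤ) : Finset (ℤ × ℤ) :=
  {(x.1 + 1, x.2), (x.1 - 1, x.2), (x.1, x.2 + 1), (x.1, x.2 - 1)}

/-- The number of edges of the wired graph between two vertices. Contraction keeps parallel edges;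
loops at `∂` are dropped, as they do not affect the walk. -/
def edgeCount {D : PlanarDomain} {n : ℝ} : Vertex D n → Vertex D n → ℕ
  | some x, some y => if y.1 ∈ neighbors x.1 then 1 else 0
  | some x, none => ((neighbors x.1).filter fun y => y ∉ latticeDomain D n).card
  | none, some x => ((neighbors x.1).filter fun y => y ∉ latticeDomain D n).card
  | none, none => 0

/-- The degree of a vertex in the wired graph. -/
def degree {D : PlanarDomain} {n : ℝ} (v : Vertex D n) : ℕ := ∑ w, edgeCount v w

/-! ### The continuous-time walk with edge transition rate `1 / (2π)`, started from `∂` -/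

/-- The one-step law of the discrete skeleton: from `v`, jump to `w` with probability
`edgeCount v w / degree v`. All degrees are positive as soon as `D_n` is non-empty; otherwise the
only vertex is `∂` and the walk stays there. -/
def stepPMF {D : PlanarDomain} {n : ℝ} (v : Vertex D n) : PMF (Vertex D n) :=
  if h : ∑' w, (edgeCount v w : ENNReal) ≠ 0 then
    PMF.normalize (fun w => (edgeCount v w : ENNReal)) h
      (by rw [tsum_fintype]; exact ENNReal.sum_ne_top.2 fun w _ => ENNReal.natCast_ne_top _)
  else PMF.pure v

/-- The transition kernel of the discrete skeleton. -/
def stepKernel (D : PlanarDomain) (n : ℝ) : Kernel (Vertex D n) (Vertex D n) where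
  toFun v := (stepPMF v).toMeasure
  measurable' := Measurable.of_discrete

instance (D : PlanarDomain) (n : ℝ) : IsMarkovKernel (stepKernel D n) :=
  ⟨fun v => inferInstanceAs (IsProbabilityMeasure (stepPMF v).toMeasure)⟩

/-- The law of the discrete skeleton: the Markov chain with kernel `stepKernel` started at `∂`. -/
def skeletonLaw (D : PlanarDomain) (n : ℝ) : Measure (ℕ → Vertex D n) :=
  Kernel.trajMeasure (X := fun _ => Vertex D n) (Measure.dirac none) fun k =>
    (stepKernel D n).comap (fun h => h ⟨k, Finset.mem_Iic.2 le_rfl⟩) (measurable_pi_apply _)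

/-- The sample space of the walk: a skeleton path and a sequence of clocks. -/
abbrev Sample (D : PlanarDomain) (n : ℝ) : Type := (ℕ → Vertex D n) × (ℕ → ℝ)

/-- The law of the walk: the clocks are i.i.d. exponential with mean one, independent of the
skeleton. -/
def walkLaw (D : PlanarDomain) (n : ℝ) : Measure (Sample D n) :=
  (skeletonLaw D n).prod (Measure.infinitePi fun _ => expMeasure 1)

variable {D : PlanarDomain} {n : ℝ}

/-- The real time of the `k`-th jump. The holding time at `v` is a unit exponential clock divided
by the total jump rate `degree v / (2π)`. -/
def jumpTime (ω : Sample D n) (k : ℕ) : ℝ :=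
  ∑ i ∈ Finset.range k, ω.2 i / ((degree (ω.1 i) : ℝ) / (2 * Real.pi))

/-- The position of the walk at real time `u`. -/
def walk (ω : Sample D n) (u : ℝ) : Vertex D n := ω.1 (sSup {k : ℕ | jumpTime ω k ≤ u})

open Classical in
/-- The local time at `v` by real time `u`. -/
def realLocalTime (ω : Sample D n) (u : ℝ) (v : Vertex D n) : ℝ :=
  ∫ r in (0 : ℝ)..u, if walk ω r = v then 1 else 0

/-- The real time by which the local time at `∂` is `t` (generalized inverse). -/
def realTime (ω : Sample D n) (t : ℝ) : ℝ := sInf {u : ℝ | 0 ≤ u ∧ t < realLocalTime ω u none}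

/-- The local time at `v` by `∂`-time `t`. -/
def localTime (ω : Sample D n) (t : ℝ) (v : Vertex D n) : ℝ := realLocalTime ω (realTime ω t) v

/-- The cover `∂`-time of a set `A ⊆ D_n`. -/
def coverTime (A : Finset (ℤ × ℤ)) (ω : Sample D n) : ℝ :=
  sInf {t : ℝ | 0 ≤ t ∧ ∀ v : {x // x ∈ latticeDomain D n}, v.1 ∈ A → 0 < localTime ω t (some v)}

/-- The cover real time of a set `A ⊆ D_n`. -/
def realCoverTime (A : Finset (ℤ × ℤ)) (ω : Sample D n) : ℝ :=
  sInf {u : ℝ | 0 ≤ u ∧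
    ∀ v : {x // x ∈ latticeDomain D n}, v.1 ∈ A → ∃ r ∈ Set.Icc 0 u, walk ω r = some v}

/-- The last visited vertex of `A`: the position of the walk when the cover of `A` is complete. -/
def lastVertex (A : Finset (ℤ × ℤ)) (ω : Sample D n) : Vertex D n := walk ω (realCoverTime A ω)

/-! ### Clustered sets and cluster processes -/

/-- `A` is `(r, R)`-clustered: `log ‖x - y‖ ∉ (r, R)` for all `x, y ∈ A`. -/
def IsClustered (r R : ℝ) (A : Finset (ℤ × ℤ)) : Prop :=
  ∀ x ∈ A, ∀ y ∈ A, ¬ (Real.exp r < eDist x y ∧ eDist x y < Real.exp R)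

/-- The discrete ball `B(z; r)`, of radius `⌊eʳ⌋`. -/
def ball (z : ℤ × ℤ) (r : ℝ) : Set (ℤ × ℤ) := {x | eDist z x ≤ (⌊Real.exp r⌋ : ℝ)}

/-- `C` is a (finite) set of centres of `r`-balls that cover `A`. -/
def IsCover (r : ℝ) (A C : Finset (ℤ × ℤ)) : Prop := ∀ x ∈ A, ∃ z ∈ C, x ∈ ball z r

/-- `C` is a minimal `r`-cover of `A`: one of smallest cardinality. -/
def IsMinimalCover (r : ℝ) (A C : Finset (ℤ × ℤ)) : Prop :=
  IsCover r A C ∧ ∀ C' : Finset (ℤ × ℤ), IsCover r A C' → C.card ≤ C'.card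

/-- The cluster process of a cover `C` at scale `eⁿ`: the sum of the unit masses at `e⁻ⁿ z`,
for `z ∈ C`. -/
def clusterProcess (n : ℝ) (C : Finset (ℤ × ℤ)) : Measure Plane :=
  ∑ z ∈ C, Measure.dirac (Real.exp (-n) • toPlane z)

/-- The total mass `‖μ‖` of a measure. -/
def totalMass (μ : Measure Plane) : ℝ := μ.real Set.univ

/-- The normalized measure `μ° = μ / ‖μ‖`. -/
def normalized (μ : Measure Plane) : Measure Plane := (μ Set.univ)⁻¹ • μ

/-- The rescaled centres `e⁻ⁿ z`, `z ∈ C`, of those balls on which the set `W` separates a point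
of `A` from the centre: for some `x ∈ A ∩ B(z; r)`, exactly one of `e⁻ⁿ x` and `e⁻ⁿ z` is
in `W`. -/
def splitCenters (n r : ℝ) (A C : Finset (ℤ × ℤ)) (W : Set Plane) : Set Plane :=
  {p | ∃ z ∈ C, p = Real.exp (-n) • toPlane z ∧
    ∃ x ∈ A, x ∈ ball z r ∧ ¬ (Real.exp (-n) • toPlane x ∈ W ↔ Real.exp (-n) • toPlane z ∈ W)}

/-! ### Scales and probabilities -/

/-- The clustering scale `r_n = n^(1/2 - η₀)`. -/
def clusterScale (η₀ n : ℝ) : ℝ := n ^ (1 / 2 - η₀)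

/-- The length `t_n^B = (n log n) / 2` of Phase B, in `∂`-time. -/
def phaseTime (n : ℝ) : ℝ := 1 / 2 * n * Real.log n

/-- The probability that the cover `∂`-time of `A` is at most `t` and the last visited vertex of
`A` lies in `eⁿ W`. -/
def coverProb (D : PlanarDomain) (n t : ℝ) (A : Finset (ℤ × ℤ)) (W : Set Plane) : ℝ :=
  (walkLaw D n).real {ω | coverTime A ω ≤ t ∧
    ∃ x : {x // x ∈ latticeDomain D n}, lastVertex A ω = some x ∧
      Real.exp (-n) • toPlane x.1 ∈ W}

/-- The Gumbel weight `exp (-e^{-(s - log (‖Ξ‖ / √n))})`. -/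
def gumbelWeight (n s : ℝ) (Ξ : Measure Plane) : ℝ :=
  Real.exp (-Real.exp (-(s - Real.log (1 / Real.sqrt n * totalMass Ξ))))

end PhaseB

end

/-!
The expectation of a product of weights collected at the vertices, one for each holding time of the
walk up to `∂`-time `t`, satisfies a first-step equation, a discrete Feynman–Kac formula. Comparison
with super- and subsolutions (`lintegral_stoppedWeight_le_of_supersolution`,
`le_lintegral_stoppedWeight_of_subsolution`) turns every question about the walk into the choice of
a test function. Test functions built from the Green function of the walk killed at `∂`, and from
its expected exit time, which is the sum of the Green function over the domain, give exponential
bounds for the probability of avoiding a set (`measure_avoid_le`, `le_measure_avoid`), for leaving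
part of a visited cluster uncovered (`measure_visited_not_covered_le`), and for the real time spent
(`measure_le_realTime`, `measure_realTime_le`).

In the bulk the Green function is `n - log ‖x - y‖ + O(log n)` (`exists_green_bounds`,
`exists_green_latticeDomain_bounds`). Hence a vertex, and also a whole cluster of log-diameter at
most `r_n`, is missed up to `∂`-time `t` with probability about `exp (-t / n)`. Centres of different
clusters are at distance at least `e^(n - r_n)`, so their Green function is negligible against `n`
and missing several clusters has nearly the product probability. Truncated inclusion–exclusion
(`abs_measure_iInter_compl_sub_prod_le`) converts this into a product law for covering, and a
cluster that is visited at all by the times in question is covered soon after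
(`eventually_abs_measure_covered_sub_le`). At `t_n^B + s n` each cluster is missed with probability
about `e^(-s) / √n`, which yields the Gumbel limit.

For the last visited vertex, the `∂`-time is cut by a fine grid. In each step of the grid the
probability that the last cluster is found there and has its centre in a given set is, by the
product law at two times, at least proportional to the share of the centres in that set
(`eventually_exists_lastVertex_event`). This lower bound, applied to the complementary set and
subtracted from the probability of covering everything, is also the upper bound. A set `W` that
splits clusters is squeezed between the centres whose cluster lies in `W` and those whose cluster
meets `W`; the difference is the mass of the split centres (`eventually_coverProb_bounds`,
`eventually_abs_coverProb_sub_le`).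

The tail estimate is a union bound over single vertices (`eventually_measure_lt_coverTime_le`), and
the statement on the real time is a Chernoff bound from both sides (`tendsto_measure_realTime`).
-/

noncomputable section

namespace PhaseB

variable {D : PlanarDomain} {n : ℝ}

/-! ### The Markov property of the walk -/

instance : IsProbabilityMeasure (skeletonLaw D n) := by
  unfold skeletonLaw; infer_instance

instance : IsProbabilityMeasure (expMeasure 1) := isProbabilityMeasure_expMeasure one_pos

instance : IsProbabilityMeasure (walkLaw D n) := by
  unfold walkLaw; infer_instance

/-- The skeleton stopped at step `k`. -/
def skeletonPast (k : ℕ) (z : ℕ → Vertex D n) : ℕ → Vertex D n := fun i => z (min i k)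

/-- The clocks that ring before step `k`; the others are set to zero. -/
def clockPast (k : ℕ) (e : ℕ → ℝ) : ℕ → ℝ := fun i => if i < k then e i else 0

/-- The part of a sample that determines the walk up to its arrival at the `k`-th vertex. -/
def past (k : ℕ) (ω : Sample D n) : Sample D n := (skeletonPast k ω.1, clockPast k ω.2)

theorem measurable_skeletonPast (k : ℕ) : Measurable (skeletonPast (D := D) (n := n) k) :=
  measurable_pi_lambda _ fun _ => measurable_pi_apply _

theorem measurable_clockPast (k : ℕ) : Measurable (clockPast k) := by
  refine measurable_pi_lambda _ fun i => ?_
  unfold clockPast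
  split_ifs
  · exact measurable_pi_apply _
  · exact measurable_const

/-- Given its first `k + 1` vertices, the skeleton moves to the next one by the step kernel. -/
theorem lintegral_skeleton_step (k : ℕ) {g : (ℕ → Vertex D n) → Vertex D n → ENNReal}
    (hg : Measurable (Function.uncurry g)) :
    ∫⁻ z, g (skeletonPast k z) (z (k + 1)) ∂skeletonLaw D n =
      ∫⁻ z, ∫⁻ w, g (skeletonPast k z) w ∂stepKernel D n (z k) ∂skeletonLaw D n := by
  let ext : ((i : Finset.Iic k) → Vertex D n) → (ℕ → Vertex D n) :=
    fun h i => h ⟨min i k, Finset.mem_Iic.2 (min_le_right _ _)⟩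
  have hext : Measurable ext := measurable_pi_lambda _ fun _ => measurable_pi_apply _
  have hG : Measurable fun p : ((i : Finset.Iic k) → Vertex D n) × Vertex D n =>
      g (ext p.1) p.2 := hg.comp ((hext.comp measurable_fst).prodMk measurable_snd)
  have key := Kernel.map_frestrictLe_trajMeasure_compProd_eq_map_trajMeasure
    (X := fun _ => Vertex D n) (μ₀ := Measure.dirac none) (a := k)
    (κ := fun k => (stepKernel D n).comap (fun h => h ⟨k, Finset.mem_Iic.2 le_rfl⟩)
      (measurable_pi_apply _))
  have e1 := lintegral_map (μ := skeletonLaw D n) hG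
    (g := fun x : ℕ → Vertex D n =>
      (Preorder.frestrictLe (π := fun _ => Vertex D n) k x, x (k + 1)))
    (by fun_prop)
  have e2 : ∫⁻ z, g (skeletonPast k z) (z (k + 1)) ∂skeletonLaw D n = _ := e1.symm
  rw [e2]
  unfold skeletonLaw at *
  rw [← key, Measure.lintegral_compProd hG, lintegral_map]
  · rfl
  · exact hG.lintegral_kernel_prod_right
  · fun_prop

/-- The clock of step `k` is exponential and independent of the earlier ones. -/
theorem lintegral_clock_step (k : ℕ) {g : (ℕ → ℝ) → ℝ → ENNReal}
    (hg : Measurable (Function.uncurry g)) :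
    ∫⁻ e, g (clockPast k e) (e k) ∂(Measure.infinitePi fun _ => expMeasure 1) =
      ∫⁻ e, ∫⁻ x, g (clockPast k e) x ∂expMeasure 1
        ∂(Measure.infinitePi fun _ => expMeasure 1) := by
  set ν : Measure (ℕ → ℝ) := Measure.infinitePi fun _ => expMeasure 1
  have hind : iIndepFun (fun (i : ℕ) (e : ℕ → ℝ) => e i) ν :=
    iIndepFun_infinitePi (P := fun _ : ℕ => expMeasure 1) (X := fun _ x => x)
      (fun _ => measurable_id)
  have h2 := hind.indepFun_finset (Finset.range k) {k} (by simp)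
    (fun i => measurable_pi_apply i)
  let ext : ((i : Finset.range k) → ℝ) → (ℕ → ℝ) :=
    fun h i => if hi : i < k then h ⟨i, Finset.mem_range.2 hi⟩ else 0
  have hext : Measurable ext := by
    refine measurable_pi_lambda _ fun i => ?_
    by_cases hi : i < k
    · simp only [ext, hi, dif_pos]; exact measurable_pi_apply _
    · simp only [ext, hi, dif_neg, not_false_iff]; exact measurable_const
  have h3 : IndepFun (clockPast k) (fun e : ℕ → ℝ => e k) ν := by
    have := h2.comp hext (measurable_pi_apply (⟨k, by simp⟩ : ({k} : Finset ℕ)))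
    have h1 : clockPast k = ext ∘ fun (a : ℕ → ℝ) (i : Finset.range k) => a i := by
      funext e i
      simp only [ext, clockPast, Function.comp]
      split_ifs <;> rfl
    rw [h1]
    exact this
  have h4 := (indepFun_iff_map_prod_eq_prod_map_map (measurable_clockPast k).aemeasurable
    (measurable_pi_apply k).aemeasurable).1 h3
  have h5 : ν.map (fun e : ℕ → ℝ => e k) = expMeasure 1 :=
    Measure.infinitePi_map_eval (μ := fun _ : ℕ => expMeasure 1) k
  rw [h5] at h4
  have e1 := lintegral_map (μ := ν) hg (g := fun e : ℕ → ℝ => (clockPast k e, e k))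
    ((measurable_clockPast k).prodMk (measurable_pi_apply k))
  have e2 : ∫⁻ e, g (clockPast k e) (e k) ∂ν = _ := e1.symm
  rw [e2, h4, lintegral_prod _ hg.aemeasurable, lintegral_map _ (measurable_clockPast k)]
  · rfl
  · exact hg.lintegral_prod_right'

/-- If `zS'` is a Markov step from `zS` given `pS` and `eT` is independent of `pT`, then on the
product space the pair `(eT, zS')` is independent of the past `(pS, pT)` given `zS`. -/
theorem lintegral_prod_step {S T V : Type*} [MeasurableSpace S] [MeasurableSpace T]
    [MeasurableSpace V] {μ : Measure S} {ν : Measure T} {ξ : Measure ℝ} [SFinite μ] [SFinite ν]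
    [SFinite ξ] {κ : Kernel V V} [IsMarkovKernel κ] {pS : S → S} {zS zS' : S → V} {pT : T → T}
    {eT : T → ℝ} (hpS : Measurable pS) (hzS : Measurable zS) (hzS' : Measurable zS')
    (hpT : Measurable pT) (heT : Measurable eT)
    (hS : ∀ g : S → V → ENNReal, Measurable (Function.uncurry g) →
      ∫⁻ s, g (pS s) (zS' s) ∂μ = ∫⁻ s, ∫⁻ w, g (pS s) w ∂κ (zS s) ∂μ)
    (hT : ∀ g : T → ℝ → ENNReal, Measurable (Function.uncurry g) →
      ∫⁻ t, g (pT t) (eT t) ∂ν = ∫⁻ t, ∫⁻ x, g (pT t) x ∂ξ ∂ν)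
    {f : S × T → ℝ → V → ENNReal} (hf : Measurable fun p : (S × T) × ℝ × V => f p.1 p.2.1 p.2.2) :
    ∫⁻ p, f (pS p.1, pT p.2) (eT p.2) (zS' p.1) ∂μ.prod ν =
      ∫⁻ p, ∫⁻ e, ∫⁻ w, f (pS p.1, pT p.2) e w ∂κ (zS p.1) ∂ξ ∂μ.prod ν := by
  have m1 : Measurable fun p : S × T => f (pS p.1, pT p.2) (eT p.2) (zS' p.1) := by
    have h : Measurable fun p : S × T => ((pS p.1, pT p.2), eT p.2, zS' p.1) := by fun_prop
    exact hf.comp h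
  have hker : Measurable fun q : ((S × T) × ℝ) × V =>
      ∫⁻ w, f (pS q.1.1.1, pT q.1.1.2) q.1.2 w ∂κ q.2 := by
    have h0 : Measurable fun r : (((S × T) × ℝ) × V) × V =>
      ((pS r.1.1.1.1, pT r.1.1.1.2), r.1.1.2, r.2) := by fun_prop
    have h1 := hf.comp h0
    exact Measurable.lintegral_kernel_prod_right
      (κ := κ.comap (fun q : ((S × T) × ℝ) × V => q.2) measurable_snd)
      (f := fun q w => f (pS q.1.1.1, pT q.1.1.2) q.1.2 w) h1
  have hker2 : Measurable fun q : (S × T) × ℝ =>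
      ∫⁻ w, f (pS q.1.1, pT q.1.2) q.2 w ∂κ (zS q.1.1) := by
    have h0 : Measurable fun q : (S × T) × ℝ => (q, zS q.1.1) := by fun_prop
    exact hker.comp h0
  have m2 : Measurable fun p : S × T =>
      ∫⁻ e, ∫⁻ w, f (pS p.1, pT p.2) e w ∂κ (zS p.1) ∂ξ := hker2.lintegral_prod_right'
  have m3 : Measurable fun p : S × T => ∫⁻ w, f (pS p.1, pT p.2) (eT p.2) w ∂κ (zS p.1) := by
    have h0 : Measurable fun p : S × T => (p, eT p.2) := by fun_prop
    exact hker2.comp h0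
  rw [lintegral_prod_symm _ m1.aemeasurable, lintegral_prod _ m2.aemeasurable]
  calc _ = ∫⁻ t, ∫⁻ s, ∫⁻ w, f (pS s, pT t) (eT t) w ∂κ (zS s) ∂μ ∂ν := by
        refine lintegral_congr fun t => ?_
        refine hS (fun z w => f (z, pT t) (eT t) w) ?_
        have h0 : Measurable fun q : S × V => ((q.1, pT t), eT t, q.2) := by fun_prop
        exact hf.comp h0
    _ = ∫⁻ s, ∫⁻ t, ∫⁻ w, f (pS s, pT t) (eT t) w ∂κ (zS s) ∂ν ∂μ := by
        rw [← lintegral_prod_symm _ m3.aemeasurable, lintegral_prod _ m3.aemeasurable]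
    _ = _ := by
        refine lintegral_congr fun s => ?_
        refine hT (fun e x => ∫⁻ w, f (pS s, e) x w ∂κ (zS s)) ?_
        have h0 : Measurable fun q : (T × ℝ) × V => ((pS s, q.1.1), q.1.2, q.2) := by fun_prop
        exact Measurable.lintegral_prod_right' (hf.comp h0)

/-- The Markov property of the walk at its arrival at the `k`-th vertex: given the past, the next
clock and the next vertex are independent, exponential and distributed according to the step. -/
theorem lintegral_walk_step (k : ℕ) {f : Sample D n → ℝ → Vertex D n → ENNReal}
    (hf : Measurable fun p : Sample D n × ℝ × Vertex D n => f p.1 p.2.1 p.2.2) :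
    ∫⁻ ω, f (past k ω) (ω.2 k) (ω.1 (k + 1)) ∂walkLaw D n =
      ∫⁻ ω, ∫⁻ e, ∫⁻ w, f (past k ω) e w ∂stepKernel D n (ω.1 k) ∂expMeasure 1 ∂walkLaw D n :=
  lintegral_prod_step (measurable_skeletonPast k) (measurable_pi_apply k)
    (measurable_pi_apply (k + 1)) (measurable_clockPast k) (measurable_pi_apply k)
    (fun _ hg => lintegral_skeleton_step k hg) (fun _ hg => lintegral_clock_step k hg) hf

/-! ### Weights of the path up to a given boundary time -/

/-- The holding time of the walk at its `i`-th vertex. -/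
def holdingTime (ω : Sample D n) (i : ℕ) : ℝ := ω.2 i / ((degree (ω.1 i) : ℝ) / (2 * Real.pi))

/-- The local time at `∂` upon arrival at the `k`-th vertex. -/
def boundaryTime (ω : Sample D n) (k : ℕ) : ℝ :=
  ∑ i ∈ Finset.range k, if ω.1 i = none then holdingTime ω i else 0

/-- The product over the vertices of `D_n` visited before step `k` of weights that may depend on the
local time at `∂`, on the vertex and on the holding time there. -/
def pathWeight (w : ℝ → Vertex D n → ℝ → ENNReal) (ω : Sample D n) (k : ℕ) : ENNReal :=
  ∏ i ∈ Finset.range k,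
    if ω.1 i = none then 1 else w (boundaryTime ω i) (ω.1 i) (holdingTime ω i)

/-- The weight of the path at step `k` if the local time at `∂` passes `t` during that step, and
zero otherwise. -/
def stoppedWeight (w : ℝ → Vertex D n → ℝ → ENNReal) (t : ℝ) (ω : Sample D n) (k : ℕ) : ENNReal :=
  if boundaryTime ω k ≤ t ∧ t < boundaryTime ω (k + 1) then pathWeight w ω k else 0

theorem measurable_gammaPDF (a r : ℝ) : Measurable (gammaPDF a r) :=
  (measurable_gammaPDFReal a r).ennreal_ofReal

theorem ae_clock_pos : ∀ᵐ ω ∂walkLaw D n, ∀ i, 0 < ω.2 i := by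
  rw [ae_all_iff]
  intro i
  have h1 : ∀ᵐ x ∂expMeasure 1, 0 < x := by
    have h : (expMeasure 1) (Set.Iic 0) = 0 := by
      rw [expMeasure, gammaMeasure, withDensity_apply _ measurableSet_Iic]
      have h0 : ∀ᵐ x : ℝ ∂volume, x ≠ 0 := by
        simp [ae_iff, measure_singleton]
      rw [lintegral_eq_zero_iff' (measurable_gammaPDF 1 1).aemeasurable]
      filter_upwards [ae_restrict_mem measurableSet_Iic, ae_restrict_of_ae h0] with x hx hx0
      exact gammaPDF_of_neg (lt_of_le_of_ne hx hx0)
    rw [ae_iff]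
    simpa [Set.Iic, not_lt] using h
  have h2 : (Measure.infinitePi fun _ : ℕ => expMeasure 1).map (fun e => e i) = expMeasure 1 :=
    Measure.infinitePi_map_eval (μ := fun _ : ℕ => expMeasure 1) i
  rw [← h2] at h1
  have h3 := ae_of_ae_map (measurable_pi_apply i).aemeasurable h1
  exact (Measure.quasiMeasurePreserving_snd (μ := skeletonLaw D n)).ae h3

theorem lintegral_expMeasure_one {f : ℝ → ENNReal} (hf : Measurable f) :
    ∫⁻ x, f x ∂expMeasure 1 = ∫⁻ x in Set.Ioi 0, ENNReal.ofReal (Real.exp (-x)) * f x := by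
  rw [expMeasure, gammaMeasure,
    lintegral_withDensity_eq_lintegral_mul _ (measurable_gammaPDF 1 1) hf,
      ← lintegral_indicator measurableSet_Ioi]
  refine lintegral_congr_ae ?_
  have h0 : ∀ᵐ x : ℝ ∂volume, x ≠ 0 := by simp [ae_iff, measure_singleton]
  filter_upwards [h0] with x hx
  by_cases h : 0 < x
  · simp [Set.indicator, h, gammaPDF_of_nonneg h.le]
  · simp [Set.indicator, h, gammaPDF_of_neg (lt_of_le_of_ne (not_lt.1 h) hx)]

theorem lintegral_expMeasure_exp {a : ℝ} (ha : -1 < a) :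
    ∫⁻ x, ENNReal.ofReal (Real.exp (-(a * x))) ∂expMeasure 1 = ENNReal.ofReal (1 / (1 + a)) := by
  rw [lintegral_expMeasure_one (by fun_prop)]
  have h1 : ∀ x : ℝ, ENNReal.ofReal (Real.exp (-x)) * ENNReal.ofReal (Real.exp (-(a * x))) =
      ENNReal.ofReal (Real.exp (-(1 + a) * x)) := fun x => by
    rw [← ENNReal.ofReal_mul (Real.exp_pos _).le, ← Real.exp_add]; ring_nf
  simp_rw [h1]
  have hi := integrableOn_exp_mul_Ioi (a := -(1 + a)) (by linarith) 0
  rw [← ofReal_integral_eq_lintegral_ofReal hi (ae_of_all _ fun x => (Real.exp_pos _).le),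
    integral_exp_mul_Ioi (by linarith)]
  congr 1
  simp
  rw [neg_div, ← div_neg, inv_eq_one_div]; congr 1; ring

theorem holdingTime_nonneg {ω : Sample D n} (h : ∀ i, 0 < ω.2 i) (i : ℕ) : 0 ≤ holdingTime ω i :=
  div_nonneg (h i).le (by positivity)

theorem boundaryTime_zero (ω : Sample D n) : boundaryTime ω 0 = 0 := by simp [boundaryTime]

theorem boundaryTime_succ (ω : Sample D n) (k : ℕ) : boundaryTime ω (k + 1) =
    boundaryTime ω k + if ω.1 k = none then holdingTime ω k else 0 :=
  Finset.sum_range_succ _ _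

theorem boundaryTime_mono {ω : Sample D n} (h : ∀ i, 0 < ω.2 i) : Monotone (boundaryTime ω) :=
  monotone_nat_of_le_succ fun k => by
    rw [boundaryTime_succ]
    split_ifs
    · exact le_add_of_nonneg_right (holdingTime_nonneg h k)
    · simp

theorem boundaryTime_nonneg {ω : Sample D n} (h : ∀ i, 0 < ω.2 i) (k : ℕ) :
    0 ≤ boundaryTime ω k := by
  rw [← boundaryTime_zero ω]; exact boundaryTime_mono h k.zero_le

theorem pathWeight_succ (w : ℝ → Vertex D n → ℝ → ENNReal) (ω : Sample D n) (k : ℕ) :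
    pathWeight w ω (k + 1) = pathWeight w ω k *
      if ω.1 k = none then 1 else w (boundaryTime ω k) (ω.1 k) (holdingTime ω k) :=
  Finset.prod_range_succ _ _

theorem past_fst {k i : ℕ} (h : i ≤ k) (ω : Sample D n) : (past k ω).1 i = ω.1 i := by
  simp [past, skeletonPast, h]

theorem past_snd {k i : ℕ} (h : i < k) (ω : Sample D n) : (past k ω).2 i = ω.2 i := by
  simp [past, clockPast, h]

theorem holdingTime_past {k i : ℕ} (h : i < k) (ω : Sample D n) :
    holdingTime (past k ω) i = holdingTime ω i := by
  simp only [holdingTime, past_fst h.le, past_snd h]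

theorem boundaryTime_past {k i : ℕ} (h : i ≤ k) (ω : Sample D n) :
    boundaryTime (past k ω) i = boundaryTime ω i := by
  refine Finset.sum_congr rfl fun j hj => ?_
  have hj' : j < k := (Finset.mem_range.1 hj).trans_le h
  rw [past_fst hj'.le, holdingTime_past hj']

theorem pathWeight_past (w : ℝ → Vertex D n → ℝ → ENNReal) (k : ℕ) (ω : Sample D n) :
    pathWeight w (past k ω) k = pathWeight w ω k := by
  refine Finset.prod_congr rfl fun j hj => ?_
  have hj' : j < k := Finset.mem_range.1 hj
  rw [past_fst hj'.le, holdingTime_past hj', boundaryTime_past hj'.le]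

theorem measurable_skeleton (i : ℕ) : Measurable fun ω : Sample D n => ω.1 i :=
  (measurable_pi_apply i).comp measurable_fst

theorem measurable_holdingTime (i : ℕ) : Measurable fun ω : Sample D n => holdingTime ω i := by
  have h : Measurable fun v : Vertex D n => (degree v : ℝ) / (2 * Real.pi) := Measurable.of_discrete
  exact ((measurable_pi_apply i).comp measurable_snd).div (h.comp (measurable_skeleton i))

theorem measurableSet_skeleton_eq (i : ℕ) (v : Vertex D n) :
    MeasurableSet {ω : Sample D n | ω.1 i = v} :=
  measurable_skeleton i (MeasurableSet.of_discrete (s := {v}))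

theorem measurable_boundaryTime (k : ℕ) : Measurable fun ω : Sample D n => boundaryTime ω k :=
  Finset.measurable_sum _ fun i _ =>
    Measurable.ite (measurableSet_skeleton_eq i none) (measurable_holdingTime i) measurable_const

/-- Joint measurability of a function of real parameters and a vertex. -/
theorem measurable_vertex_fun {α β : Type*} [MeasurableSpace α] [MeasurableSpace β]
    {f : Vertex D n → α → β} (hf : ∀ v, Measurable (f v)) :
    Measurable fun p : Vertex D n × α => f p.1 p.2 :=
  measurable_from_prod_countable_right hf

theorem measurable_pathWeight {w : ℝ → Vertex D n → ℝ → ENNReal}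
    (hw : ∀ v, Measurable fun p : ℝ × ℝ => w p.1 v p.2) (k : ℕ) :
    Measurable fun ω : Sample D n => pathWeight w ω k := by
  refine Finset.measurable_prod _ fun i _ => ?_
  refine Measurable.ite (measurableSet_skeleton_eq i none) measurable_const ?_
  exact (measurable_vertex_fun (f := fun v (p : ℝ × ℝ) => w p.1 v p.2) hw).comp
    ((measurable_skeleton i).prodMk ((measurable_boundaryTime i).prodMk (measurable_holdingTime i)))

theorem measurable_stoppedWeight {w : ℝ → Vertex D n → ℝ → ENNReal}
    (hw : ∀ v, Measurable fun p : ℝ × ℝ => w p.1 v p.2) (t : ℝ) (k : ℕ) :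
    Measurable fun ω : Sample D n => stoppedWeight w t ω k := by
  refine Measurable.ite ?_ (measurable_pathWeight hw k) measurable_const
  exact (measurableSet_le (measurable_boundaryTime k) measurable_const).inter
    (measurableSet_lt measurable_const (measurable_boundaryTime (k + 1)))

/-- The value after one step: from `∂` the process either ends, if the local time at `∂` passes `t`
before the clock `e` rings, or moves to `v'`; from a vertex of `D_n` it picks up a weight. -/
def stepValue (w : ℝ → Vertex D n → ℝ → ENNReal) (Φ : ℝ → Vertex D n → ENNReal) (t σ : ℝ)
    (v : Vertex D n) (e : ℝ) (v' : Vertex D n) : ENNReal :=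
  if v = none then
    (if t < σ + e / ((degree v : ℝ) / (2 * Real.pi)) then 1
      else Φ (σ + e / ((degree v : ℝ) / (2 * Real.pi))) v')
  else w σ v (e / ((degree v : ℝ) / (2 * Real.pi))) * Φ σ v'

/-- The total weight of the paths that have ended before step `k`, plus the value `Φ` of those
that have not. -/
def valueProcess (w : ℝ → Vertex D n → ℝ → ENNReal) (Φ : ℝ → Vertex D n → ENNReal) (t : ℝ)
    (ω : Sample D n) (k : ℕ) : ENNReal :=
  ∑ i ∈ Finset.range k, stoppedWeight w t ω i +
    if boundaryTime ω k ≤ t then pathWeight w ω k * Φ (boundaryTime ω k) (ω.1 k) else 0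

theorem valueProcess_succ {w : ℝ → Vertex D n → ℝ → ENNReal} {Φ : ℝ → Vertex D n → ENNReal} {t : ℝ}
    {ω : Sample D n} (hω : ∀ i, 0 < ω.2 i) (k : ℕ) :
    valueProcess w Φ t ω (k + 1) = ∑ i ∈ Finset.range k, stoppedWeight w t ω i +
      if boundaryTime ω k ≤ t then pathWeight w ω k *
        stepValue w Φ t (boundaryTime ω k) (ω.1 k) (ω.2 k) (ω.1 (k + 1)) else 0 := by
  have hm := boundaryTime_mono hω k.le_succ
  rw [valueProcess, Finset.sum_range_succ, add_assoc]
  congr 1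
  by_cases hk : boundaryTime ω k ≤ t
  · rw [if_pos hk]
    by_cases hz : ω.1 k = none
    · have hs : boundaryTime ω (k + 1) =
          boundaryTime ω k + ω.2 k / ((degree (ω.1 k) : ℝ) / (2 * Real.pi)) := by
        rw [boundaryTime_succ, if_pos hz]; rfl
      have hw : pathWeight w ω (k + 1) = pathWeight w ω k := by
        rw [pathWeight_succ, if_pos hz, mul_one]
      rw [stoppedWeight, stepValue, if_pos hz, ← hs, hw]
      by_cases ht : t < boundaryTime ω (k + 1)
      · simp [hk, ht, not_le.2 ht]
      · simp [ht, not_lt.1 ht]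
    · have hs : boundaryTime ω (k + 1) = boundaryTime ω k := by
        rw [boundaryTime_succ, if_neg hz, add_zero]
      rw [stoppedWeight, stepValue, if_neg hz, hs, if_pos hk, pathWeight_succ, if_neg hz]
      simp [not_lt.2 hk, mul_assoc, holdingTime]
  · rw [if_neg hk, if_neg fun h => hk (hm.trans h), stoppedWeight, if_neg fun h => hk h.1]
    simp

theorem measurable_stepValue {w : ℝ → Vertex D n → ℝ → ENNReal} {Φ : ℝ → Vertex D n → ENNReal}
    (hw : ∀ v, Measurable fun p : ℝ × ℝ => w p.1 v p.2) (hΦ : ∀ v, Measurable fun σ => Φ σ v)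
    (t : ℝ) : Measurable fun q : (Vertex D n × Vertex D n) × (ℝ × ℝ) =>
      stepValue w Φ t q.2.1 q.1.1 q.2.2 q.1.2 := by
  refine measurable_from_prod_countable_right
    (f := fun q : (Vertex D n × Vertex D n) × (ℝ × ℝ) =>
      stepValue w Φ t q.2.1 q.1.1 q.2.2 q.1.2) fun q => ?_
  obtain ⟨v, v'⟩ := q
  simp only [stepValue]
  have h1 : Measurable fun p : ℝ × ℝ => p.1 + p.2 / ((degree v : ℝ) / (2 * Real.pi)) := by fun_prop
  by_cases hv : v = none
  · simp only [hv, if_true]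
    rw [hv] at h1
    exact Measurable.ite (measurableSet_lt measurable_const h1) measurable_const
      ((hΦ v').comp h1)
  · simp only [hv, if_false]
    have h2 : Measurable fun p : ℝ × ℝ => (p.1, p.2 / ((degree v : ℝ) / (2 * Real.pi))) := by
      fun_prop
    exact ((hw v).comp h2).mul ((hΦ v').comp measurable_fst)

/-- By the Markov property, the value at step `k + 1` may be averaged over the next clock and the
next vertex. -/
theorem lintegral_valueProcess_succ {w : ℝ → Vertex D n → ℝ → ENNReal}
    {Φ : ℝ → Vertex D n → ENNReal} (hw : ∀ v, Measurable fun p : ℝ × ℝ => w p.1 v p.2)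
    (hΦ : ∀ v, Measurable fun σ => Φ σ v) (t : ℝ) (k : ℕ) :
    ∫⁻ ω, valueProcess w Φ t ω (k + 1) ∂walkLaw D n =
      ∫⁻ ω, ∑ i ∈ Finset.range k, stoppedWeight w t ω i ∂walkLaw D n +
      ∫⁻ ω, (if boundaryTime ω k ≤ t then pathWeight w ω k * ∫⁻ e, ∫⁻ v',
        stepValue w Φ t (boundaryTime ω k) (ω.1 k) e v' ∂stepKernel D n (ω.1 k) ∂expMeasure 1
        else 0) ∂walkLaw D n := by
  have h1 : ∫⁻ ω, valueProcess w Φ t ω (k + 1) ∂walkLaw D n =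
      ∫⁻ ω, (∑ i ∈ Finset.range k, stoppedWeight w t ω i +
      if boundaryTime ω k ≤ t then pathWeight w ω k *
        stepValue w Φ t (boundaryTime ω k) (ω.1 k) (ω.2 k) (ω.1 (k + 1)) else 0) ∂walkLaw D n := by
    refine lintegral_congr_ae ?_
    filter_upwards [ae_clock_pos] with ω hω using valueProcess_succ hω k
  rw [h1, lintegral_add_left (Finset.measurable_sum _ fun i _ => measurable_stoppedWeight hw t i)]
  congr 1
  have hstep := measurable_stepValue hw hΦ t
  have hW : ∀ ω : Sample D n, ∀ e v', (if boundaryTime ω k ≤ t then pathWeight w ω k *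
        stepValue w Φ t (boundaryTime ω k) (ω.1 k) e v' else 0) =
      (if boundaryTime (past k ω) k ≤ t then pathWeight w (past k ω) k *
        stepValue w Φ t (boundaryTime (past k ω) k) ((past k ω).1 k) e v' else 0) := by
    intro ω e v'
    rw [boundaryTime_past le_rfl, pathWeight_past, past_fst le_rfl]
  refine (lintegral_congr fun ω => hW ω _ _).trans ?_
  have hb := measurable_boundaryTime (D := D) (n := n) k
  have hp := measurable_pathWeight hw k
  rw [lintegral_walk_step k (f := fun ω e v' => if boundaryTime ω k ≤ t then pathWeight w ω k *
        stepValue w Φ t (boundaryTime ω k) (ω.1 k) e v' else 0)]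
  · refine lintegral_congr fun ω => ?_
    rw [boundaryTime_past le_rfl, pathWeight_past, past_fst le_rfl]
    split_ifs
    · have hi : ∀ e, Measurable fun v' => stepValue w Φ t (boundaryTime ω k) (ω.1 k) e v' :=
        fun e => Measurable.of_discrete
      simp_rw [lintegral_const_mul _ (hi _)]
      rw [lintegral_const_mul]
      have h2 : Measurable fun q : ℝ × Vertex D n => ((ω.1 k, q.2), (boundaryTime ω k, q.1)) := by
        fun_prop
      exact Measurable.lintegral_prod_right' (hstep.comp h2)
    · simp
  · have h2 : Measurable fun p : Sample D n × ℝ × Vertex D n =>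
        ((p.1.1 k, p.2.2), (boundaryTime p.1 k, p.2.1)) := by fun_prop
    exact Measurable.ite (measurableSet_le (hb.comp measurable_fst) measurable_const)
      ((hp.comp measurable_fst).mul (hstep.comp h2)) measurable_const

theorem lintegral_valueProcess {w : ℝ → Vertex D n → ℝ → ENNReal}
    {Φ : ℝ → Vertex D n → ENNReal} (hw : ∀ v, Measurable fun p : ℝ × ℝ => w p.1 v p.2) (t : ℝ)
    (k : ℕ) :
    ∫⁻ ω, valueProcess w Φ t ω k ∂walkLaw D n =
      ∫⁻ ω, ∑ i ∈ Finset.range k, stoppedWeight w t ω i ∂walkLaw D n +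
      ∫⁻ ω, (if boundaryTime ω k ≤ t then pathWeight w ω k * Φ (boundaryTime ω k) (ω.1 k)
        else 0) ∂walkLaw D n :=
  lintegral_add_left (Finset.measurable_sum _ fun i _ => measurable_stoppedWeight hw t i) _

theorem ae_skeleton_zero : ∀ᵐ ω ∂walkLaw D n, ω.1 0 = none := by
  have h1 : ∀ᵐ z ∂skeletonLaw D n, z 0 = none := by
    have h : (skeletonLaw D n).map (Preorder.frestrictLe (π := fun _ => Vertex D n) 0) =
        (Measure.dirac none).map
          (MeasurableEquiv.piUnique fun _ : Finset.Iic 0 => Vertex D n).symm := by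
      rw [skeletonLaw, Kernel.trajMeasure, Measure.map_comp _ _ (by fun_prop),
        Kernel.traj_map_frestrictLe, Kernel.partialTraj_self, Measure.id_comp]
    have h2 : (skeletonLaw D n).map (fun z => z 0) = Measure.dirac none := by
      have h3 : (fun z : ℕ → Vertex D n => z 0) =
        (fun y : (i : Finset.Iic 0) → Vertex D n => y ⟨0, by simp⟩) ∘
          (Preorder.frestrictLe (π := fun _ => Vertex D n) 0) := rfl
      rw [h3, ← Measure.map_map (by fun_prop) (by fun_prop), h,
        Measure.map_map (by fun_prop) (by fun_prop)]
      exact Measure.map_id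
    have h4 : ∀ᵐ v ∂(skeletonLaw D n).map (fun z => z 0), v = none := by
      rw [h2, ae_dirac_iff (MeasurableSet.of_discrete)]
    exact ae_of_ae_map (measurable_pi_apply 0).aemeasurable h4
  exact (Measure.quasiMeasurePreserving_fst (μ := skeletonLaw D n)).ae h1

theorem lintegral_valueProcess_zero (w : ℝ → Vertex D n → ℝ → ENNReal)
    (Φ : ℝ → Vertex D n → ENNReal) {t : ℝ} (ht : 0 ≤ t) :
    ∫⁻ ω, valueProcess w Φ t ω 0 ∂walkLaw D n = Φ 0 none := by
  have h : ∀ᵐ ω ∂walkLaw D n, valueProcess w Φ t ω 0 = Φ 0 none := by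
    filter_upwards [ae_skeleton_zero] with ω hω
    simp [valueProcess, boundaryTime_zero, pathWeight, ht, hω]
  rw [lintegral_congr_ae h]
  simp

/-- If `Φ` does not increase on average, then it bounds the expected weight of the walk stopped when
its local time at `∂` passes `t`. -/
theorem lintegral_tsum_stoppedWeight_le {w : ℝ → Vertex D n → ℝ → ENNReal}
    {Φ : ℝ → Vertex D n → ENNReal} (hw : ∀ v, Measurable fun p : ℝ × ℝ => w p.1 v p.2)
    (hΦ : ∀ v, Measurable fun σ => Φ σ v) {t : ℝ} (ht : 0 ≤ t)
    (hsup : ∀ σ v, 0 ≤ σ → σ ≤ t →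
      ∫⁻ e, ∫⁻ v', stepValue w Φ t σ v e v' ∂stepKernel D n v ∂expMeasure 1 ≤ Φ σ v) :
    ∫⁻ ω, ∑' k, stoppedWeight w t ω k ∂walkLaw D n ≤ Φ 0 none := by
  have h1 : ∀ k, ∫⁻ ω, valueProcess w Φ t ω k ∂walkLaw D n ≤ Φ 0 none := by
    intro k
    induction k with
    | zero => exact (lintegral_valueProcess_zero w Φ ht).le
    | succ k ih =>
      refine le_trans ?_ ih
      rw [lintegral_valueProcess_succ hw hΦ, lintegral_valueProcess hw]
      refine add_le_add_right (lintegral_mono_ae ?_) _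
      filter_upwards [ae_clock_pos] with ω hω
      split_ifs with hk
      · gcongr
        exact hsup _ _ (boundaryTime_nonneg hω k) hk
      · exact le_rfl
  rw [lintegral_tsum fun k => (measurable_stoppedWeight hw t k).aemeasurable]
  refine ENNReal.tsum_le_of_sum_range_le fun k => ?_
  rw [← lintegral_finsetSum _ fun i _ => measurable_stoppedWeight hw t i]
  refine le_trans ?_ (h1 k)
  exact lintegral_mono fun ω => le_self_add

/-- If the bounded function `Φ` does not decrease on average, the weights are at most one and the
walk is stopped almost surely, then `Φ` is a lower bound for the expected weight. -/
theorem le_lintegral_tsum_stoppedWeight {w : ℝ → Vertex D n → ℝ → ENNReal}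
    {Φ : ℝ → Vertex D n → ENNReal} (hw : ∀ v, Measurable fun p : ℝ × ℝ => w p.1 v p.2)
    (hΦ : ∀ v, Measurable fun σ => Φ σ v) {t : ℝ} (ht : 0 ≤ t) (hw1 : ∀ σ v h, w σ v h ≤ 1)
    {B : ENNReal} (hB : B ≠ ⊤) (hΦB : ∀ σ v, σ ≤ t → Φ σ v ≤ B)
    (hlim : Tendsto (fun k => walkLaw D n {ω | boundaryTime ω k ≤ t}) atTop (𝓝 0))
    (hsub : ∀ σ v, 0 ≤ σ → σ ≤ t →
      Φ σ v ≤ ∫⁻ e, ∫⁻ v', stepValue w Φ t σ v e v' ∂stepKernel D n v ∂expMeasure 1) :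
    Φ 0 none ≤ ∫⁻ ω, ∑' k, stoppedWeight w t ω k ∂walkLaw D n := by
  have h1 : ∀ k, Φ 0 none ≤ ∫⁻ ω, valueProcess w Φ t ω k ∂walkLaw D n := by
    intro k
    induction k with
    | zero => exact (lintegral_valueProcess_zero w Φ ht).ge
    | succ k ih =>
      refine le_trans ih ?_
      rw [lintegral_valueProcess_succ hw hΦ, lintegral_valueProcess hw]
      refine add_le_add_right (lintegral_mono_ae ?_) _
      filter_upwards [ae_clock_pos] with ω hω
      split_ifs with hk
      · gcongr
        exact hsub _ _ (boundaryTime_nonneg hω k) hk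
      · exact le_rfl
  have h2 : ∀ k, Φ 0 none ≤ ∫⁻ ω, ∑' k, stoppedWeight w t ω k ∂walkLaw D n +
      B * walkLaw D n {ω | boundaryTime ω k ≤ t} := by
    intro k
    refine (h1 k).trans ?_
    rw [lintegral_valueProcess hw]
    gcongr
    · exact ENNReal.sum_le_tsum _
    · rw [← lintegral_indicator_const (measurableSet_le (measurable_boundaryTime k)
        measurable_const)]
      refine lintegral_mono fun ω => ?_
      simp only [Set.indicator, Set.mem_ofPred_eq]
      split_ifs with hk
      · refine (mul_le_mul' ?_ (hΦB _ _ hk)).trans (one_mul _).le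
        refine Finset.prod_le_one' fun i _ => ?_
        split_ifs
        · exact le_rfl
        · exact hw1 _ _ _
      · exact le_rfl
  have h3 : Tendsto (fun k => ∫⁻ ω, ∑' k, stoppedWeight w t ω k ∂walkLaw D n +
      B * walkLaw D n {ω | boundaryTime ω k ≤ t}) atTop
      (𝓝 (∫⁻ ω, ∑' k, stoppedWeight w t ω k ∂walkLaw D n + B * 0)) :=
    (ENNReal.Tendsto.const_mul hlim (Or.inr hB)).const_add _
  rw [mul_zero, add_zero] at h3
  exact ge_of_tendsto' h3 h2

/-! ### Potential theory on `ℤ²` -/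

/-- The generator of the walk on `ℤ²` that crosses each edge at rate `1 / (2π)`. -/
def lap (f : ℤ × ℤ → ℝ) (x : ℤ × ℤ) : ℝ := (∑ y ∈ neighbors x, (f y - f x)) / (2 * Real.pi)

theorem two_pi_pos : 0 < 2 * Real.pi := by positivity

theorem sum_neighbors {M : Type*} [AddCommMonoid M] (f : ℤ × ℤ → M) (x : ℤ × ℤ) :
    ∑ y ∈ neighbors x, f y =
      f (x.1 + 1, x.2) + (f (x.1 - 1, x.2) + (f (x.1, x.2 + 1) + f (x.1, x.2 - 1))) := by
  rw [neighbors, Finset.sum_insert, Finset.sum_insert, Finset.sum_insert, Finset.sum_singleton]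
  all_goals simp only [Finset.mem_insert, Finset.mem_singleton, Prod.mk.injEq]; omega

theorem card_neighbors (x : ℤ × ℤ) : (neighbors x).card = 4 := by
  rw [Finset.card_eq_sum_ones, sum_neighbors]; rfl

theorem mem_neighbors {x y : ℤ × ℤ} : y ∈ neighbors x ↔
    y = (x.1 + 1, x.2) ∨ y = (x.1 - 1, x.2) ∨ y = (x.1, x.2 + 1) ∨ y = (x.1, x.2 - 1) := by
  simp [neighbors]

theorem mem_neighbors_comm {x y : ℤ × ℤ} : y ∈ neighbors x ↔ x ∈ neighbors y := by
  obtain ⟨a, b⟩ := x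
  obtain ⟨c, d⟩ := y
  simp only [mem_neighbors, Prod.mk.injEq]
  omega

theorem lap_mul (f : ℤ × ℤ → ℝ) (x : ℤ × ℤ) :
    2 * Real.pi * lap f x = ∑ y ∈ neighbors x, f y - 4 * f x := by
  rw [lap, mul_div_cancel₀ _ two_pi_pos.ne', Finset.sum_sub_distrib, Finset.sum_const,
    card_neighbors]
  simp

theorem lap_add (f g : ℤ × ℤ → ℝ) (x : ℤ × ℤ) :
    lap (fun y => f y + g y) x = lap f x + lap g x := by
  simp only [lap, ← add_div, ← Finset.sum_add_distrib]
  congr 1; refine Finset.sum_congr rfl fun _ _ => by ring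

theorem lap_const_mul (c : ℝ) (f : ℤ × ℤ → ℝ) (x : ℤ × ℤ) :
    lap (fun y => c * f y) x = c * lap f x := by
  simp only [lap, ← mul_div_assoc, Finset.mul_sum]
  congr 1; refine Finset.sum_congr rfl fun _ _ => by ring

theorem lap_neg (f : ℤ × ℤ → ℝ) (x : ℤ × ℤ) : lap (fun y => -f y) x = -lap f x := by
  simpa using lap_const_mul (-1) f x

theorem lap_sub (f g : ℤ × ℤ → ℝ) (x : ℤ × ℤ) :
    lap (fun y => f y - g y) x = lap f x - lap g x := by
  simp only [sub_eq_add_neg, lap_add, lap_neg]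

theorem lap_const (c : ℝ) (x : ℤ × ℤ) : lap (fun _ => c) x = 0 := by simp [lap]

theorem lap_sum {ι : Type*} (s : Finset ι) (f : ι → ℤ × ℤ → ℝ) (x : ℤ × ℤ) :
    lap (fun y => ∑ i ∈ s, f i y) x = ∑ i ∈ s, lap (f i) x := by
  simp only [lap, ← Finset.sum_div, ← Finset.sum_sub_distrib]
  rw [Finset.sum_comm]

theorem lap_translate (f : ℤ × ℤ → ℝ) (a x : ℤ × ℤ) :
    lap (fun y => f (y - a)) x = lap f (x - a) := by
  obtain ⟨a1, a2⟩ := a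
  obtain ⟨x1, x2⟩ := x
  simp only [lap, sum_neighbors, Prod.mk_sub_mk]
  ring_nf

/-- The flow inside a finite set cancels. -/
theorem sum_sum_antisymm (S : Finset (ℤ × ℤ)) (F : ℤ × ℤ → ℤ × ℤ → ℝ)
    (hF : ∀ x y, F x y = -F y x) :
    ∑ x ∈ S, ∑ y ∈ neighbors x, F x y =
      ∑ x ∈ S, ∑ y ∈ (neighbors x).filter (· ∉ S), F x y := by
  have h1 : ∀ x ∈ S, ∑ y ∈ neighbors x, F x y =
      ∑ y ∈ S, (if y ∈ neighbors x then F x y else 0) +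
        ∑ y ∈ (neighbors x).filter (· ∉ S), F x y := by
    intro x _
    rw [← Finset.sum_filter_add_sum_filter_not (neighbors x) (· ∈ S)]
    congr 1
    rw [← Finset.sum_filter]
    refine Finset.sum_congr ?_ fun _ _ => rfl
    ext y; simp [and_comm]
  rw [Finset.sum_congr rfl h1, Finset.sum_add_distrib]
  have h2 : ∑ x ∈ S, ∑ y ∈ S, (if y ∈ neighbors x then F x y else 0) =
      -∑ x ∈ S, ∑ y ∈ S, (if y ∈ neighbors x then F x y else 0) := by
    conv_lhs => rw [Finset.sum_comm]
    rw [← Finset.sum_neg_distrib]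
    refine Finset.sum_congr rfl fun x _ => ?_
    rw [← Finset.sum_neg_distrib]
    refine Finset.sum_congr rfl fun y _ => ?_
    by_cases h : y ∈ neighbors x
    · rw [if_pos h, if_pos (mem_neighbors_comm.1 h)]; exact hF y x
    · rw [if_neg h, if_neg (fun h' => h (mem_neighbors_comm.1 h')), neg_zero]
  linarith

/-- The minimum principle: a function that is superharmonic where it is negative, and non-negative
on the outer boundary, is non-negative. -/
theorem min_principle {V : Finset (ℤ × ℤ)} {f : ℤ × ℤ → ℝ}
    (hV : ∀ x ∈ V, 0 ≤ f x ∨ lap f x ≤ 0)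
    (hb : ∀ x ∈ V, ∀ y ∈ neighbors x, y ∉ V → 0 ≤ f y) : ∀ x ∈ V, 0 ≤ f x := by
  by_contra! hcon
  obtain ⟨x₀, hx₀, hneg⟩ := hcon
  -- At the rightmost minimum point the neighbour on the right has a strictly larger value, and
  -- the Laplacian is positive.
  obtain ⟨m, hm, hmin⟩ := V.exists_min_image f ⟨x₀, hx₀⟩
  obtain ⟨x, hx, hmax⟩ := (V.filter fun y => f y = f m).exists_max_image Prod.fst
    ⟨m, by simp [hm]⟩
  rw [Finset.mem_filter] at hx
  have hfx : f x < 0 := by rw [hx.2]; exact (hmin x₀ hx₀).trans_lt hneg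
  have hge : ∀ y ∈ neighbors x, 0 ≤ f y - f x := by
    intro y hy
    by_cases hyV : y ∈ V
    · have := hmin y hyV; rw [← hx.2] at this; linarith
    · linarith [hb x hx.1 y hy hyV]
  have hmem : ((x.1 + 1, x.2) : ℤ × ℤ) ∈ neighbors x := by simp [neighbors]
  have hgt : 0 < f (x.1 + 1, x.2) - f x := by
    by_cases hyV : ((x.1 + 1, x.2) : ℤ × ℤ) ∈ V
    · refine lt_of_le_of_ne (hge _ hmem) fun h => ?_
      have := hmax (x.1 + 1, x.2) (by rw [Finset.mem_filter]; exact ⟨hyV, by linarith [hx.2]⟩)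
      simp at this
    · linarith [hb x hx.1 _ hmem hyV]
  have hpos : 0 < ∑ y ∈ neighbors x, (f y - f x) := Finset.sum_pos' hge ⟨_, hmem, hgt⟩
  rcases hV x hx.1 with h | h
  · linarith
  · rw [lap, div_nonpos_iff] at h
    have := two_pi_pos
    rcases h with h | h <;> linarith [h.1, h.2]

theorem eq_zero_of_harmonic {V : Finset (ℤ × ℤ)} {f : ℤ × ℤ → ℝ} (hV : ∀ x ∈ V, lap f x = 0)
    (hb : ∀ y, y ∉ V → f y = 0) (x : ℤ × ℤ) : f x = 0 := by
  by_cases hx : x ∈ V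
  · refine le_antisymm ?_ ?_
    · have := min_principle (V := V) (f := fun y => -f y)
        (fun y hy => Or.inr (by rw [lap_neg, hV y hy, neg_zero]))
        (fun _ _ y _ hy => by rw [hb y hy, neg_zero]) x hx
      linarith
    · exact min_principle (V := V) (f := f) (fun y hy => Or.inr (hV y hy).le)
        (fun _ _ y _ hy => (hb y hy).ge) x hx
  · exact hb x hx

/-- The Poisson equation with zero boundary values is solvable. -/
theorem exists_poisson (V : Finset (ℤ × ℤ)) (φ : ℤ × ℤ → ℝ) :
    ∃ g : ℤ × ℤ → ℝ, (∀ y, y ∉ V → g y = 0) ∧ ∀ y ∈ V, -lap g y = φ y := by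
  let ext : (V → ℝ) → ℤ × ℤ → ℝ := fun f y => if h : y ∈ V then f ⟨y, h⟩ else 0
  let L : (V → ℝ) →ₗ[ℝ] (V → ℝ) :=
    { toFun := fun f y => -lap (ext f) y
      map_add' := fun f g => by
        funext y
        have : ext (f + g) = fun y => ext f y + ext g y := by
          funext y; simp only [ext]; split_ifs <;> simp
        simp only [this, lap_add, Pi.add_apply]; ring
      map_smul' := fun c f => by
        funext y
        have : ext (c • f) = fun y => c * ext f y := by
          funext y; simp only [ext]; split_ifs <;> simp
        simp only [this, lap_const_mul, Pi.smul_apply, RingHom.id_apply, smul_eq_mul]; ring }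
  have hinj : Function.Injective L := by
    rw [injective_iff_map_eq_zero]
    intro f hf
    have h0 := eq_zero_of_harmonic (V := V) (f := ext f)
      (fun x hx => by have := congrFun hf ⟨x, hx⟩; simpa [L] using this)
      (fun y hy => by simp [ext, hy])
    funext y
    have := h0 y
    simpa [ext] using this
  obtain ⟨f, hf⟩ := LinearMap.injective_iff_surjective.1 hinj fun y => φ y
  refine ⟨ext f, fun y hy => by simp [ext, hy], fun y hy => ?_⟩
  exact congrFun hf ⟨y, hy⟩

/-- The Green function of `V` with pole `x`: `y ↦ green V x y` vanishes off `V` and its negative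
Laplacian on `V` is the unit mass at `x`. -/
def green (V : Finset (ℤ × ℤ)) (x : ℤ × ℤ) : ℤ × ℤ → ℝ :=
  (exists_poisson V fun y => if y = x then 1 else 0).choose

variable {V : Finset (ℤ × ℤ)}

theorem green_of_notMem (x : ℤ × ℤ) {y : ℤ × ℤ} (hy : y ∉ V) : green V x y = 0 :=
  (exists_poisson V fun y => if y = x then 1 else 0).choose_spec.1 y hy

theorem lap_green (x : ℤ × ℤ) {y : ℤ × ℤ} (hy : y ∈ V) :
    lap (green V x) y = -if y = x then 1 else 0 := by
  rw [← (exists_poisson V fun y => if y = x then 1 else 0).choose_spec.2 y hy, neg_neg]; rfl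

theorem green_nonneg (x y : ℤ × ℤ) : 0 ≤ green V x y := by
  by_cases hy : y ∈ V
  · refine min_principle (V := V) (fun z hz => Or.inr ?_)
      (fun _ _ z _ hz => (green_of_notMem x hz).ge) y hy
    rw [lap_green x hz]; split_ifs <;> simp
  · exact (green_of_notMem x hy).ge

/-- Summation by parts. -/
theorem sum_mul_lap_comm {f g : ℤ × ℤ → ℝ} (hf : ∀ y, y ∉ V → f y = 0)
    (hg : ∀ y, y ∉ V → g y = 0) : ∑ x ∈ V, f x * lap g x = ∑ x ∈ V, g x * lap f x := by
  rw [← sub_eq_zero, ← Finset.sum_sub_distrib]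
  have h := sum_sum_antisymm V (fun x y => f x * g y - g x * f y) fun x y => by ring
  have h0 : ∑ x ∈ V, ∑ y ∈ (neighbors x).filter (· ∉ V), (f x * g y - g x * f y) = 0 := by
    refine Finset.sum_eq_zero fun x _ => Finset.sum_eq_zero fun y hy => ?_
    have hyV := (Finset.mem_filter.1 hy).2
    rw [hf y hyV, hg y hyV]; ring
  rw [h0] at h
  have h1 : ∀ x, f x * lap g x - g x * lap f x =
      (∑ y ∈ neighbors x, (f x * g y - g x * f y)) / (2 * Real.pi) := by
    intro x
    rw [lap, lap, mul_div_assoc', mul_div_assoc', ← sub_div, Finset.mul_sum, Finset.mul_sum,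
      ← Finset.sum_sub_distrib]
    congr 1; refine Finset.sum_congr rfl fun _ _ => by ring
  rw [Finset.sum_congr rfl fun x _ => h1 x, ← Finset.sum_div, h, zero_div]

theorem green_comm {x y : ℤ × ℤ} (hx : x ∈ V) (hy : y ∈ V) : green V x y = green V y x := by
  have h := sum_mul_lap_comm (V := V) (f := green V x) (g := green V y)
    (fun z hz => green_of_notMem x hz) (fun z hz => green_of_notMem y hz)
  have e1 : ∀ a b, b ∈ V → ∑ z ∈ V, green V a z * lap (green V b) z = -green V a b := by
    intro a b hb
    rw [Finset.sum_congr rfl fun z hz => by rw [lap_green b hz], Finset.sum_eq_single b]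
    · simp
    · intro z _ hz; simp [hz]
    · exact fun h => absurd hb h
  rw [e1 x y hy, e1 y x hx] at h
  linarith

/-- The total mass of the negative Laplacian of a function that vanishes off `V` leaves through the
outer boundary. -/
theorem sum_neg_lap {g : ℤ × ℤ → ℝ} (hg : ∀ y, y ∉ V → g y = 0) :
    ∑ x ∈ V, -lap g x =
      ∑ x ∈ V, (((neighbors x).filter (· ∉ V)).card : ℝ) * g x / (2 * Real.pi) := by
  have h := sum_sum_antisymm V (fun x y => g x - g y) fun x y => by ring
  have h1 : ∀ x, -lap g x = (∑ y ∈ neighbors x, (g x - g y)) / (2 * Real.pi) := by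
    intro x
    rw [lap, ← neg_div, ← Finset.sum_neg_distrib]
    congr 1; refine Finset.sum_congr rfl fun _ _ => by ring
  rw [Finset.sum_congr rfl fun x _ => h1 x, ← Finset.sum_div, h, ← Finset.sum_div]
  congr 1
  refine Finset.sum_congr rfl fun x _ => ?_
  rw [Finset.sum_congr rfl fun y hy => by
    rw [hg y (Finset.mem_filter.1 hy).2, sub_zero], Finset.sum_const, nsmul_eq_mul]

/-- The flow of the Green function through an edge is at most one: the whole unit flow leaves each
superlevel set, and all of it flows outwards. -/
theorem green_sub_le_of_neighbor (x : ℤ × ℤ) {u v : ℤ × ℤ} (huv : v ∈ neighbors u) :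
    green V x u - green V x v ≤ 2 * Real.pi := by
  set g := green V x
  by_contra! hlt
  have hv0 : 0 ≤ g v := green_nonneg x v
  have hpi := two_pi_pos
  have hu : u ∈ V := by
    by_contra hu
    have : g u = 0 := green_of_notMem x hu
    linarith
  -- The superlevel set at the height of `u`: it contains `u` but not `v`.
  set S := V.filter fun y => g u ≤ g y
  have hSV : ∀ y ∈ S, y ∈ V := fun y hy => (Finset.mem_filter.1 hy).1
  have hout : ∀ y, y ∉ S → g y < g u := by
    intro y hy
    by_cases hyV : y ∈ V
    · by_contra! h; exact hy (Finset.mem_filter.2 ⟨hyV, h⟩)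
    · have : g y = 0 := green_of_notMem x hyV
      linarith
  have h := sum_sum_antisymm S (fun a b => g a - g b) fun a b => by ring
  have h1 : ∑ a ∈ S, ∑ b ∈ neighbors a, (g a - g b) ≤ 2 * Real.pi := by
    have e : ∀ a ∈ S, ∑ b ∈ neighbors a, (g a - g b) =
        2 * Real.pi * if a = x then 1 else 0 := by
      intro a ha
      have := lap_green x (hSV a ha)
      rw [lap, div_eq_iff hpi.ne'] at this
      rw [← neg_inj, ← Finset.sum_neg_distrib]
      simp only [neg_sub]
      rw [this]; ring
    rw [Finset.sum_congr rfl e, ← Finset.mul_sum, Finset.sum_ite_eq']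
    split_ifs <;> linarith
  have h2 : g u - g v ≤ ∑ a ∈ S, ∑ b ∈ (neighbors a).filter (· ∉ S), (g a - g b) := by
    have hnn : ∀ a ∈ S, ∀ b ∈ (neighbors a).filter (· ∉ S), 0 ≤ g a - g b := by
      intro a ha b hb
      have h3 := hout b (Finset.mem_filter.1 hb).2
      have h4 := (Finset.mem_filter.1 ha).2
      linarith
    have hvS : v ∉ S := fun hv => by
      have := (Finset.mem_filter.1 hv).2
      linarith
    have huS : u ∈ S := Finset.mem_filter.2 ⟨hu, le_rfl⟩
    calc g u - g v ≤ ∑ b ∈ (neighbors u).filter (· ∉ S), (g u - g b) :=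
          Finset.single_le_sum (f := fun b => g u - g b) (hnn u huS)
            (Finset.mem_filter.2 ⟨huv, hvS⟩)
      _ ≤ _ := Finset.single_le_sum
          (f := fun a => ∑ b ∈ (neighbors a).filter (· ∉ S), (g a - g b))
          (fun a ha => Finset.sum_nonneg (hnn a ha)) huS
  linarith

theorem abs_green_sub_le_of_neighbor (x : ℤ × ℤ) {u v : ℤ × ℤ} (huv : v ∈ neighbors u) :
    |green V x u - green V x v| ≤ 2 * Real.pi := by
  rw [abs_le]
  constructor
  · linarith [green_sub_le_of_neighbor (V := V) x (mem_neighbors_comm.1 huv)]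
  · exact green_sub_le_of_neighbor x huv

/-- A function with bounded increments along edges is Lipschitz for the graph distance. -/
theorem abs_sub_le_of_neighbor {g : ℤ × ℤ → ℝ} {c : ℝ}
    (hg : ∀ u, ∀ v ∈ neighbors u, |g u - g v| ≤ c) (u v : ℤ × ℤ) :
    |g u - g v| ≤ c * (|((u - v).1 : ℝ)| + |((u - v).2 : ℝ)|) := by
  have line : ∀ (φ : ℤ → ℝ), (∀ i, |φ (i + 1) - φ i| ≤ c) → ∀ a b : ℤ,
      |φ a - φ b| ≤ c * |((a - b : ℤ) : ℝ)| := by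
    intro φ hφ
    have h0 : ∀ (k : ℕ) (b : ℤ), |φ (b + k) - φ b| ≤ c * k := by
      intro k b
      induction k with
      | zero => simp
      | succ k ih =>
        have h1 := hφ (b + k)
        have h2 : φ (b + (k + 1 : ℕ)) - φ b = (φ (b + k + 1) - φ (b + k)) + (φ (b + k) - φ b) := by
          push_cast; ring_nf
        rw [h2]
        calc _ ≤ _ := abs_add_le _ _
          _ ≤ c + c * k := add_le_add h1 ih
          _ = _ := by push_cast; ring
    intro a b
    rcases le_total b a with h | h
    · obtain ⟨k, rfl⟩ := Int.le.dest h
      simpa using h0 k b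
    · obtain ⟨k, rfl⟩ := Int.le.dest h
      rw [abs_sub_comm]
      simpa using h0 k a
  have h1 := line (fun i => g (i, u.2))
    (fun i => hg (i + 1, u.2) (i, u.2) (by simp [neighbors])) u.1 v.1
  have h2 := line (fun j => g (v.1, j))
    (fun j => hg (v.1, j + 1) (v.1, j) (by simp [neighbors])) u.2 v.2
  calc |g u - g v| = |(g (u.1, u.2) - g (v.1, u.2)) + (g (v.1, u.2) - g (v.1, v.2))| := by
        congr 1; ring
    _ ≤ _ := abs_add_le _ _
    _ ≤ _ := by rw [mul_add]; exact add_le_add h1 h2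

theorem abs_green_sub_le {w : ℤ × ℤ} (u v : ℤ × ℤ) : |green V w u - green V w v| ≤
    2 * Real.pi * (|((u - v).1 : ℝ)| + |((u - v).2 : ℝ)|) :=
  abs_sub_le_of_neighbor (fun _ _ h => abs_green_sub_le_of_neighbor w h) u v

/-! ### The logarithmic kernel and the Green function -/

/-- The logarithm of the Euclidean norm on `ℤ²`, with value `0` at the origin. -/
def logKernel (y : ℤ × ℤ) : ℝ := 1 / 2 * Real.log ((y.1 : ℝ) ^ 2 + (y.2 : ℝ) ^ 2)

/-- The logarithm is almost harmonic: the product of the squared norms of the four neighbours of a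
point of squared norm `s` is `(s² - 1)² + 16 a² b² = s⁴ (1 + O(s⁻²))`. -/
theorem abs_lap_logKernel_le (y : ℤ × ℤ) :
    |lap logKernel y| ≤ 1 / ((y.1 : ℝ) ^ 2 + (y.2 : ℝ) ^ 2) ^ 2 := by
  obtain ⟨p, q⟩ := y
  have hpi := Real.pi_gt_three
  rw [lap, abs_div, abs_of_pos two_pi_pos, div_le_iff₀ two_pi_pos]
  simp only [logKernel, sum_neighbors]
  push_cast
  by_cases hs : p ^ 2 + q ^ 2 ≤ 1
  · have hp : -1 ≤ p ∧ p ≤ 1 := by constructor <;> nlinarith [sq_nonneg q]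
    have hq : -1 ≤ q ∧ q ≤ 1 := by constructor <;> nlinarith [sq_nonneg p]
    have hl2 : Real.log 2 < 1 := by linarith [Real.log_two_lt_d9]
    have hl2' : 0 < Real.log 2 := Real.log_pos (by norm_num)
    have hl4 : Real.log 4 = 2 * Real.log 2 := by
      rw [show (4 : ℝ) = 2 ^ 2 by norm_num, Real.log_pow]; norm_num
    obtain ⟨hp1, hp2⟩ := hp
    obtain ⟨hq1, hq2⟩ := hq
    interval_cases p <;> interval_cases q <;> first | omega | skip
    all_goals norm_num [hl4]
    all_goals
      rw [abs_of_pos (by linarith)]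
      linarith
  · have hs2 : (2 : ℝ) ≤ (p : ℝ) ^ 2 + (q : ℝ) ^ 2 := by
      exact_mod_cast (by omega : 2 ≤ p ^ 2 + q ^ 2)
    set a : ℝ := (p : ℝ)
    set b : ℝ := (q : ℝ)
    set s : ℝ := a ^ 2 + b ^ 2 with hsdef
    have ha : a ^ 2 ≤ s := by nlinarith [sq_nonneg b]
    have hb : b ^ 2 ≤ s := by nlinarith [sq_nonneg a]
    have hs0 : 0 < s := by linarith
    have n1 : 0 < (a + 1) ^ 2 + b ^ 2 := by nlinarith [sq_nonneg (a + 2), sq_nonneg b]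
    have n2 : 0 < (a - 1) ^ 2 + b ^ 2 := by nlinarith [sq_nonneg (a - 2), sq_nonneg b]
    have n3 : 0 < a ^ 2 + (b + 1) ^ 2 := by nlinarith [sq_nonneg (b + 2), sq_nonneg a]
    have n4 : 0 < a ^ 2 + (b - 1) ^ 2 := by nlinarith [sq_nonneg (b - 2), sq_nonneg a]
    have hprod : ((a + 1) ^ 2 + b ^ 2) * ((a - 1) ^ 2 + b ^ 2) * (a ^ 2 + (b + 1) ^ 2) *
        (a ^ 2 + (b - 1) ^ 2) = (s ^ 2 - 1) ^ 2 + 16 * a ^ 2 * b ^ 2 := by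
      rw [hsdef]; ring
    set ε : ℝ := (16 * a ^ 2 * b ^ 2 - 2 * s ^ 2 + 1) / s ^ 4 with hε
    have hPε : (s ^ 2 - 1) ^ 2 + 16 * a ^ 2 * b ^ 2 = s ^ 4 * (1 + ε) := by
      rw [hε]; field_simp; ring
    have hab : 16 * a ^ 2 * b ^ 2 ≤ 4 * s ^ 2 := by
      rw [hsdef]; nlinarith [sq_nonneg (a ^ 2 - b ^ 2)]
    have hab0 : 0 ≤ 16 * a ^ 2 * b ^ 2 := by positivity
    have hs22 : 4 ≤ s ^ 2 := by nlinarith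
    have hεu : ε ≤ 3 / s ^ 2 := by
      rw [hε, div_le_div_iff₀ (by positivity) (by positivity)]
      nlinarith [mul_nonneg (sq_nonneg s) (sq_nonneg s), sq_nonneg s]
    have hεl : -(2 / s ^ 2) ≤ ε := by
      rw [hε, ← neg_div, div_le_div_iff₀ (by positivity) (by positivity)]
      nlinarith [mul_nonneg (sq_nonneg s) (sq_nonneg s), sq_nonneg s]
    have h2s : 2 / s ^ 2 ≤ 1 / 2 := by
      rw [div_le_div_iff₀ (by positivity) (by positivity)]; linarith
    have h1ε : 0 < 1 + ε := by linarith
    have key : 1 / 2 * Real.log ((a + 1) ^ 2 + b ^ 2) - 1 / 2 * Real.log s +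
        (1 / 2 * Real.log ((a - 1) ^ 2 + b ^ 2) - 1 / 2 * Real.log s +
        (1 / 2 * Real.log (a ^ 2 + (b + 1) ^ 2) - 1 / 2 * Real.log s +
        (1 / 2 * Real.log (a ^ 2 + (b - 1) ^ 2) - 1 / 2 * Real.log s))) =
        1 / 2 * Real.log (1 + ε) := by
      have h1 := congrArg Real.log (hprod.trans hPε)
      rw [Real.log_mul (by positivity) (by positivity),
        Real.log_mul (by positivity) (by positivity),
        Real.log_mul (by positivity) (by positivity), Real.log_mul (by positivity) (by positivity),
        Real.log_pow] at h1
      push_cast at h1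
      linarith
    rw [key]
    have hlu : Real.log (1 + ε) ≤ ε := by
      have := Real.log_le_sub_one_of_pos h1ε; linarith
    have hll : -(4 / s ^ 2) ≤ Real.log (1 + ε) := by
      have h3 := Real.one_sub_inv_le_log_of_pos h1ε
      have h4 : -(4 / s ^ 2) ≤ 1 - (1 + ε)⁻¹ := by
        have h5 : (1 + ε)⁻¹ ≤ (1 - 2 / s ^ 2)⁻¹ := inv_anti₀ (by linarith) (by linarith)
        have h6 : (1 - 2 / s ^ 2)⁻¹ ≤ 1 + 2 * (2 / s ^ 2) := by
          rw [inv_le_iff_one_le_mul₀ (by linarith)]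
          have : 0 ≤ 2 / s ^ 2 := by positivity
          nlinarith
        have : 4 / s ^ 2 = 2 * (2 / s ^ 2) := by ring
        linarith
      linarith
    have h34 : 3 / s ^ 2 ≤ 4 / s ^ 2 := by gcongr; norm_num
    have e4 : 4 / s ^ 2 = 4 * (1 / s ^ 2) := by ring
    have hs2p : 0 < 1 / s ^ 2 := by positivity
    have h6 : 1 / s ^ 2 * 6 ≤ 1 / s ^ 2 * (2 * Real.pi) :=
      mul_le_mul_of_nonneg_left (by linarith) hs2p.le
    rw [abs_le]
    constructor <;> linarith

/-- The square box of radius `N` around the origin. -/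
def box (N : ℕ) : Finset (ℤ × ℤ) := Finset.Icc (-(N : ℤ)) N ×ˢ Finset.Icc (-(N : ℤ)) N

theorem sum_box_le_tsum_sq {f : ℤ × ℤ → ℝ} {g : ℤ → ℝ} (hg : Summable g) (hg0 : ∀ a, 0 ≤ g a)
    {c : ℝ} (hc : 0 ≤ c) (hf : ∀ y, f y ≤ c * (g y.1 * g y.2)) (N : ℕ) :
    ∑ y ∈ box N, f y ≤ c * (∑' a, g a) ^ 2 := by
  calc ∑ y ∈ box N, f y ≤ ∑ y ∈ box N, c * (g y.1 * g y.2) := Finset.sum_le_sum fun y _ => hf y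
    _ = c * ((∑ a ∈ Finset.Icc (-(N : ℤ)) N, g a) * ∑ a ∈ Finset.Icc (-(N : ℤ)) N, g a) := by
        rw [← Finset.mul_sum, box, Finset.sum_product, Finset.sum_mul_sum]
    _ ≤ c * (∑' a, g a) ^ 2 := by
        rw [sq]
        have h := hg.sum_le_tsum (Finset.Icc (-(N : ℤ)) N) fun a _ => hg0 a
        have h0 : 0 ≤ ∑ a ∈ Finset.Icc (-(N : ℤ)) N, g a := Finset.sum_nonneg fun a _ => hg0 a
        exact mul_le_mul_of_nonneg_left (mul_le_mul h h h0 (tsum_nonneg hg0)) hc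

theorem summable_int_rpow : Summable fun a : ℤ => (1 + |(a : ℝ)|) ^ (-(3 / 2) : ℝ) := by
  have h : Summable fun n : ℕ => (1 + (n : ℝ)) ^ (-(3 / 2) : ℝ) := by
    have := (Real.summable_one_div_nat_add_rpow 1 (3 / 2)).2 (by norm_num)
    refine this.congr fun n => ?_
    rw [abs_of_nonneg (by positivity), add_comm, Real.rpow_neg (by positivity), one_div]
  refine Summable.of_nat_of_neg ?_ ?_
  · simpa using h
  · simpa using h

/-- The error in the harmonicity of the logarithm has a finite first moment. -/
theorem exists_sum_abs_lap_logKernel_le : ∃ c : ℝ, 0 ≤ c ∧ ∀ N : ℕ,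
    ∑ y ∈ box N, |lap logKernel y| * (2 * Real.pi * (|(y.1 : ℝ)| + |(y.2 : ℝ)|)) ≤ c := by
  set g : ℤ → ℝ := fun a => (1 + |(a : ℝ)|) ^ (-(3 / 2) : ℝ)
  have hg0 : ∀ a, 0 ≤ g a := fun a => Real.rpow_nonneg (by positivity) _
  refine ⟨2 * Real.pi * 18 * (∑' a, g a) ^ 2, by positivity, fun N =>
    sum_box_le_tsum_sq summable_int_rpow hg0 (by positivity) ?_ N⟩
  intro y
  obtain ⟨p, q⟩ := y
  simp only
  have h1 := abs_lap_logKernel_le (p, q)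
  simp only at h1
  set a : ℝ := |(p : ℝ)| with ha
  set b : ℝ := |(q : ℝ)| with hb
  have ha0 : 0 ≤ a := abs_nonneg _
  have hb0 : 0 ≤ b := abs_nonneg _
  rw [← sq_abs (p : ℝ), ← sq_abs (q : ℝ), ← ha, ← hb] at h1
  set s : ℝ := a ^ 2 + b ^ 2 with hs
  by_cases h0 : s = 0
  · have ha' : a = 0 := by nlinarith [sq_nonneg a, sq_nonneg b]
    have hb' : b = 0 := by nlinarith [sq_nonneg a, sq_nonneg b]
    rw [ha', hb']
    have := mul_nonneg (hg0 p) (hg0 q)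
    have hpi := Real.pi_pos
    simp only [add_zero, mul_zero]
    positivity
  · have hs1 : 1 ≤ s := by
      rw [hs, ha, hb, sq_abs, sq_abs] at h0 ⊢
      have h2 : p ^ 2 + q ^ 2 ≠ 0 := by exact_mod_cast h0
      exact_mod_cast (by have := sq_nonneg p; have := sq_nonneg q; omega : 1 ≤ p ^ 2 + q ^ 2)
    have hs0 : 0 < s := by linarith
    -- With `A = 1 + a`, `B = 1 + b` one has `A B ≤ 3 s` and `a + b ≤ √(2 s)`.
    have hAB : (1 + a) * (1 + b) ≤ 3 * s := by
      nlinarith [sq_nonneg (a - b), sq_nonneg (a - 1), sq_nonneg (b - 1)]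
    have hsq : 0 < Real.sqrt s := Real.sqrt_pos.2 hs0
    have hss : Real.sqrt s ^ 2 = s := Real.sq_sqrt hs0.le
    have hsum : a + b ≤ 2 * Real.sqrt s := by
      refine le_of_sq_le_sq ?_ (by positivity)
      rw [mul_pow, hss, hs]; nlinarith [sq_nonneg (a - b)]
    have hgg : g p * g q = ((1 + a) * (1 + b)) ^ (-(3 / 2) : ℝ) := by
      rw [Real.mul_rpow (by positivity) (by positivity)]
    have hlow : (3 * s) ^ (-(3 / 2) : ℝ) ≤ g p * g q := by
      rw [hgg]
      exact Real.rpow_le_rpow_of_nonpos (by positivity) hAB (by norm_num)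
    have h3s : (3 * s) ^ (-(3 / 2) : ℝ) = 1 / (3 * s * Real.sqrt (3 * s)) := by
      rw [Real.rpow_neg (by positivity), one_div, Real.sqrt_eq_rpow,
        show (3 / 2 : ℝ) = 1 + 1 / 2 by norm_num, Real.rpow_add (by positivity), Real.rpow_one]
    have hsqrt : Real.sqrt (3 * s) ≤ 3 * Real.sqrt s := by
      rw [Real.sqrt_mul (by norm_num)]
      gcongr
      rw [Real.sqrt_le_left (by norm_num)]; norm_num
    have hlow2 : 1 / (9 * (s * Real.sqrt s)) ≤ g p * g q := by
      refine le_trans ?_ hlow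
      rw [h3s]
      apply one_div_le_one_div_of_le (by positivity)
      nlinarith
    calc |lap logKernel (p, q)| * (2 * Real.pi * (a + b))
        ≤ 1 / s ^ 2 * (2 * Real.pi * (2 * Real.sqrt s)) := by gcongr
      _ = 2 * Real.pi * 18 * (1 / (9 * (s * Real.sqrt s))) := by
          field_simp
          rw [hss]; ring
      _ ≤ 2 * Real.pi * 18 * (g p * g q) := by gcongr

theorem arctan_sub_le {x y : ℝ} (hx : 0 ≤ x) (hxy : x ≤ y) :
    Real.arctan y - Real.arctan x ≤ (y - x) / (1 + x ^ 2) ∧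
      (y - x) / (1 + y ^ 2) ≤ Real.arctan y - Real.arctan x := by
  rcases hxy.eq_or_lt with rfl | hlt
  · simp
  obtain ⟨c, hc, hd⟩ := exists_hasDerivAt_eq_slope Real.arctan (fun z => 1 / (1 + z ^ 2)) hlt
    Real.continuous_arctan.continuousOn (fun z _ => Real.hasDerivAt_arctan z)
  have h0 : 0 < y - x := sub_pos.2 hlt
  rw [eq_div_iff h0.ne'] at hd
  have hc0 : 0 ≤ c := hx.trans hc.1.le
  rw [← hd, mul_comm, ← div_eq_mul_one_div]
  constructor
  · exact div_le_div_of_nonneg_left h0.le (by positivity) (by nlinarith [hc.1])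
  · exact div_le_div_of_nonneg_left h0.le (by positivity) (by nlinarith [hc.2])

theorem sum_Icc_even {φ : ℤ → ℝ} (hφ : ∀ j, φ (-j) = φ j) (N : ℕ) :
    ∑ j ∈ Finset.Icc (-(N : ℤ)) N, φ j = φ 0 + 2 * ∑ j ∈ Finset.range N, φ (j + 1 : ℕ) := by
  induction N with
  | zero => simp
  | succ N ih =>
    have h : Finset.Icc (-((N + 1 : ℕ) : ℤ)) ((N + 1 : ℕ) : ℤ) =
        insert (-((N + 1 : ℕ) : ℤ)) (insert ((N + 1 : ℕ) : ℤ) (Finset.Icc (-(N : ℤ)) N)) := by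
      ext z; simp only [Finset.mem_insert, Finset.mem_Icc]; omega
    rw [h, Finset.sum_insert, Finset.sum_insert, ih, Finset.sum_range_succ, hφ]
    · ring
    · simp
    · simp only [Finset.mem_insert, Finset.mem_Icc]; omega

theorem sum_Icc_second_difference (φ : ℤ → ℝ) (N : ℕ) :
    ∑ i ∈ Finset.Icc (-(N : ℤ)) N, (φ (i + 1) + φ (i - 1) - 2 * φ i) =
      φ (N + 1) - φ N + (φ (-N - 1) - φ (-N)) := by
  induction N with
  | zero => simp; ring
  | succ N ih =>
    have h : Finset.Icc (-((N + 1 : ℕ) : ℤ)) ((N + 1 : ℕ) : ℤ) =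
        insert (-((N + 1 : ℕ) : ℤ)) (insert ((N + 1 : ℕ) : ℤ) (Finset.Icc (-(N : ℤ)) N)) := by
      ext z; simp only [Finset.mem_insert, Finset.mem_Icc]; omega
    rw [h, Finset.sum_insert, Finset.sum_insert, ih]
    · push_cast
      have e1 : (-1 + -(N : ℤ) + 1) = -N := by ring
      rw [show (-((N : ℤ) + 1) + 1) = -N by ring, show ((N : ℤ) + 1 - 1) = N by ring,
        show (-((N : ℤ) + 1)) = -N - 1 by ring]
      ring
    · simp
    · simp only [Finset.mem_insert, Finset.mem_Icc]; omega

/-- The flux of the gradient of the logarithm through one side of the box. -/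
def sideFlux (N : ℕ) : ℝ :=
  ∑ j ∈ Finset.Icc (-(N : ℤ)) N, (logKernel (N + 1, j) - logKernel (N, j))

theorem logKernel_swap (a b : ℤ) : logKernel (a, b) = logKernel (b, a) := by
  simp [logKernel, add_comm]

theorem logKernel_neg_fst (a b : ℤ) : logKernel (-a, b) = logKernel (a, b) := by
  simp [logKernel]

theorem logKernel_neg_snd (a b : ℤ) : logKernel (a, -b) = logKernel (a, b) := by
  simp [logKernel]

/-- The divergence theorem in the box, whose four sides carry the same flux. -/
theorem sum_box_lap_logKernel (N : ℕ) :
    ∑ y ∈ box N, lap logKernel y = 2 / Real.pi * sideFlux N := by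
  have h1 : ∀ y, lap logKernel y =
      ((logKernel (y.1 + 1, y.2) + logKernel (y.1 - 1, y.2) - 2 * logKernel (y.1, y.2)) +
       (logKernel (y.1, y.2 + 1) + logKernel (y.1, y.2 - 1) - 2 * logKernel (y.1, y.2))) /
        (2 * Real.pi) := by
    intro y
    rw [lap, sum_neighbors]
    congr 1; ring
  simp_rw [h1]
  rw [← Finset.sum_div, Finset.sum_add_distrib, box]
  have e1 : ∑ y ∈ Finset.Icc (-(N : ℤ)) N ×ˢ Finset.Icc (-(N : ℤ)) N,
      (logKernel (y.1 + 1, y.2) + logKernel (y.1 - 1, y.2) - 2 * logKernel (y.1, y.2)) =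
      2 * sideFlux N := by
    rw [Finset.sum_product_right, sideFlux, Finset.mul_sum]
    refine Finset.sum_congr rfl fun j _ => ?_
    rw [sum_Icc_second_difference (fun i => logKernel (i, j)), logKernel_neg_fst,
      show (-(N : ℤ) - 1) = -(N + 1) by ring, logKernel_neg_fst]
    ring
  have e2 : ∑ y ∈ Finset.Icc (-(N : ℤ)) N ×ˢ Finset.Icc (-(N : ℤ)) N,
      (logKernel (y.1, y.2 + 1) + logKernel (y.1, y.2 - 1) - 2 * logKernel (y.1, y.2)) =
      2 * sideFlux N := by
    rw [Finset.sum_product, sideFlux, Finset.mul_sum]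
    refine Finset.sum_congr rfl fun j _ => ?_
    rw [sum_Icc_second_difference (fun i => logKernel (j, i)), logKernel_neg_snd,
      show (-(N : ℤ) - 1) = -(N + 1) by ring, logKernel_neg_snd, logKernel_swap j,
      logKernel_swap j]
    ring
  rw [e1, e2]
  have := Real.pi_pos.ne'
  field_simp
  ring

/-- The flux through a side of the box is a Riemann sum of `∫ 1 / (1 + x²) = π / 2` over `[-1, 1]`.
-/
theorem tendsto_sideFlux : Tendsto sideFlux atTop (𝓝 (Real.pi / 2)) := by
  have heq : ∀ N : ℕ, sideFlux N = (logKernel (N + 1, 0) - logKernel (N, 0)) +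
      2 * ∑ j ∈ Finset.range N,
        (logKernel (N + 1, (j + 1 : ℕ)) - logKernel (N, (j + 1 : ℕ))) := by
    intro N
    exact sum_Icc_even (φ := fun j => logKernel (N + 1, j) - logKernel (N, j))
      (fun j => by simp only [logKernel_neg_snd]) N
  have hterm : ∀ (N : ℕ) (j : ℕ), 0 < N →
      ((N : ℝ) + 1 / 2) / (((N : ℝ) + 1) ^ 2 + (j : ℝ) ^ 2) ≤
        logKernel (N + 1, j) - logKernel (N, j) ∧
      logKernel (N + 1, j) - logKernel (N, j) ≤
        ((N : ℝ) + 1 / 2) / ((N : ℝ) ^ 2 + (j : ℝ) ^ 2) := by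
    intro N j hN
    have hN' : (0 : ℝ) < N := by exact_mod_cast hN
    have hA : 0 < (N : ℝ) ^ 2 + (j : ℝ) ^ 2 := by positivity
    have hB : 0 < ((N : ℝ) + 1) ^ 2 + (j : ℝ) ^ 2 := by positivity
    have hd : logKernel (N + 1, j) - logKernel (N, j) =
        1 / 2 * Real.log ((((N : ℝ) + 1) ^ 2 + (j : ℝ) ^ 2) / ((N : ℝ) ^ 2 + (j : ℝ) ^ 2)) := by
      rw [Real.log_div hB.ne' hA.ne']
      simp only [logKernel]
      push_cast; ring
    rw [hd]
    have hp := div_pos hB hA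
    constructor
    · have h := Real.one_sub_inv_le_log_of_pos hp
      have e : 1 - ((((N : ℝ) + 1) ^ 2 + (j : ℝ) ^ 2) / ((N : ℝ) ^ 2 + (j : ℝ) ^ 2))⁻¹ =
          2 * (((N : ℝ) + 1 / 2) / (((N : ℝ) + 1) ^ 2 + (j : ℝ) ^ 2)) := by
        field_simp; ring
      linarith
    · have h := Real.log_le_sub_one_of_pos hp
      have e : (((N : ℝ) + 1) ^ 2 + (j : ℝ) ^ 2) / ((N : ℝ) ^ 2 + (j : ℝ) ^ 2) - 1 =
          2 * (((N : ℝ) + 1 / 2) / ((N : ℝ) ^ 2 + (j : ℝ) ^ 2)) := by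
        field_simp; ring
      linarith
  -- The arctangent compares the Riemann sums with `π / 4`.
  have hatan : ∀ (N j : ℕ), 0 < N →
      (N : ℝ) / ((N : ℝ) ^ 2 + ((j + 1 : ℕ) : ℝ) ^ 2) ≤
        Real.arctan (((j + 1 : ℕ) : ℝ) / N) - Real.arctan ((j : ℝ) / N) ∧
      Real.arctan (((j + 1 : ℕ) : ℝ) / N) - Real.arctan ((j : ℝ) / N) ≤
        (N : ℝ) / ((N : ℝ) ^ 2 + (j : ℝ) ^ 2) := by
    intro N j hN
    have hN' : (0 : ℝ) < N := by exact_mod_cast hN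
    have h := arctan_sub_le (x := (j : ℝ) / N) (y := ((j + 1 : ℕ) : ℝ) / N) (by positivity)
      (by gcongr; linarith)
    have e0 : ((j + 1 : ℕ) : ℝ) / N - (j : ℝ) / N = 1 / N := by push_cast; ring
    rw [e0] at h
    have e : ∀ x : ℝ, 1 / (N : ℝ) / (1 + (x / N) ^ 2) = N / ((N : ℝ) ^ 2 + x ^ 2) := by
      intro x; field_simp
    rw [e, e] at h
    exact ⟨h.2, h.1⟩
  have htel : ∀ N M : ℕ, ∑ j ∈ Finset.range M,
      (Real.arctan (((j + 1 : ℕ) : ℝ) / N) - Real.arctan ((j : ℝ) / N)) =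
        Real.arctan ((M : ℝ) / N) := by
    intro N M
    rw [Finset.sum_range_sub fun j => Real.arctan ((j : ℝ) / N)]
    simp
  have hupper : ∀ᶠ N : ℕ in atTop, sideFlux N ≤
      (1 + 1 / 2 * (1 / (N : ℝ))) * (1 / (N : ℝ) + Real.pi / 2) := by
    filter_upwards [eventually_gt_atTop 0] with N hN
    have hN' : (0 : ℝ) < N := by exact_mod_cast hN
    have e : ∀ x : ℝ, ((N : ℝ) + 1 / 2) / ((N : ℝ) ^ 2 + x ^ 2) =
        (1 + 1 / 2 * (1 / (N : ℝ))) * (N / ((N : ℝ) ^ 2 + x ^ 2)) := by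
      intro x; field_simp
    have h1 : logKernel (N + 1, 0) - logKernel (N, 0) ≤
        (1 + 1 / 2 * (1 / (N : ℝ))) * (1 / (N : ℝ)) := by
      have := (hterm N 0 hN).2
      rw [e] at this
      refine le_trans (by simpa using this) (le_of_eq ?_)
      field_simp
    have h2 : ∑ j ∈ Finset.range N,
        (logKernel (N + 1, (j + 1 : ℕ)) - logKernel (N, (j + 1 : ℕ))) ≤
        (1 + 1 / 2 * (1 / (N : ℝ))) * (Real.pi / 4) := by
      calc _ ≤ ∑ j ∈ Finset.range N, (1 + 1 / 2 * (1 / (N : ℝ))) *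
            (Real.arctan (((j + 1 : ℕ) : ℝ) / N) - Real.arctan ((j : ℝ) / N)) := by
            refine Finset.sum_le_sum fun j _ => ?_
            refine ((hterm N (j + 1) hN).2).trans ?_
            rw [e]
            exact mul_le_mul_of_nonneg_left (hatan N j hN).1 (by positivity)
        _ = _ := by
            rw [← Finset.mul_sum, htel, div_self hN'.ne', Real.arctan_one]
    rw [heq]
    linarith
  have hlower : ∀ᶠ N : ℕ in atTop,
      (1 - 1 / 2 * (1 / ((N : ℝ) + 1))) * (Real.pi / 2 - 1 / ((N : ℝ) + 1)) ≤ sideFlux N := by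
    filter_upwards [eventually_gt_atTop 0] with N hN
    have hN' : (0 : ℝ) < N := by exact_mod_cast hN
    have hc0 : 0 ≤ 1 - 1 / 2 * (1 / ((N : ℝ) + 1)) := by
      have : 1 / ((N : ℝ) + 1) ≤ 1 := by rw [div_le_one (by positivity)]; linarith
      linarith
    have e : ∀ x : ℝ, ((N : ℝ) + 1 / 2) / (((N : ℝ) + 1) ^ 2 + x ^ 2) =
        (1 - 1 / 2 * (1 / ((N : ℝ) + 1))) * (((N : ℝ) + 1) / (((N : ℝ) + 1) ^ 2 + x ^ 2)) := by
      intro x; field_simp; ring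
    have h1 : (1 - 1 / 2 * (1 / ((N : ℝ) + 1))) * (1 / ((N : ℝ) + 1)) ≤
        logKernel (N + 1, 0) - logKernel (N, 0) := by
      have := (hterm N 0 hN).1
      rw [e] at this
      refine le_trans (le_of_eq ?_) (by simpa using this)
      field_simp
    have h3 : ∑ j ∈ Finset.range (N + 1),
        (Real.arctan (((j + 1 : ℕ) : ℝ) / (N + 1 : ℕ)) - Real.arctan ((j : ℝ) / (N + 1 : ℕ))) =
        Real.pi / 4 := by
      rw [htel, div_self (by positivity), Real.arctan_one]
    have h4 : Real.arctan ((((0 : ℕ) + 1 : ℕ) : ℝ) / (N + 1 : ℕ)) -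
        Real.arctan (((0 : ℕ) : ℝ) / (N + 1 : ℕ)) ≤ 1 / ((N : ℝ) + 1) := by
      refine (hatan (N + 1) 0 N.succ_pos).2.trans (le_of_eq ?_)
      push_cast; field_simp; simp
    rw [Finset.sum_range_succ'] at h3
    have h2 : (1 - 1 / 2 * (1 / ((N : ℝ) + 1))) * (Real.pi / 4 - 1 / ((N : ℝ) + 1)) ≤
        ∑ j ∈ Finset.range N,
        (logKernel (N + 1, (j + 1 : ℕ)) - logKernel (N, (j + 1 : ℕ))) := by
      calc _ ≤ (1 - 1 / 2 * (1 / ((N : ℝ) + 1))) * ∑ j ∈ Finset.range N,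
            (Real.arctan (((j + 1 + 1 : ℕ) : ℝ) / (N + 1 : ℕ)) -
              Real.arctan (((j + 1 : ℕ) : ℝ) / (N + 1 : ℕ))) := by
            refine mul_le_mul_of_nonneg_left ?_ hc0
            linarith
        _ = ∑ j ∈ Finset.range N, (1 - 1 / 2 * (1 / ((N : ℝ) + 1))) *
            (Real.arctan (((j + 1 + 1 : ℕ) : ℝ) / (N + 1 : ℕ)) -
              Real.arctan (((j + 1 : ℕ) : ℝ) / (N + 1 : ℕ))) := Finset.mul_sum _ _ _
        _ ≤ _ := by
            refine Finset.sum_le_sum fun j _ => ?_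
            refine le_trans ?_ ((hterm N (j + 1) hN).1)
            rw [e]
            refine mul_le_mul_of_nonneg_left ?_ hc0
            have := (hatan (N + 1) (j + 1) N.succ_pos).2
            push_cast at this ⊢
            exact this
    rw [heq]
    nlinarith
  have hinv : Tendsto (fun N : ℕ => 1 / (N : ℝ)) atTop (𝓝 0) := tendsto_one_div_atTop_nhds_zero_nat
  have hinv' : Tendsto (fun N : ℕ => 1 / ((N : ℝ) + 1)) atTop (𝓝 0) :=
    tendsto_one_div_add_atTop_nhds_zero_nat
  refine tendsto_of_tendsto_of_tendsto_of_le_of_le' ?_ ?_ hlower hupper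
  · have := ((hinv'.const_mul (1 / 2)).const_sub 1).mul (hinv'.const_sub (Real.pi / 2))
    simpa using this
  · have := ((hinv.const_mul (1 / 2)).const_add 1).mul (hinv.add_const (Real.pi / 2))
    simpa using this

/-- The Laplacian of the logarithm has total mass one, so that `-log` has the same singularity as
the Green function. -/
theorem tendsto_sum_box_lap_logKernel :
    Tendsto (fun N : ℕ => ∑ y ∈ box N, lap logKernel y) atTop (𝓝 1) := by
  simp_rw [sum_box_lap_logKernel]
  have := tendsto_sideFlux.const_mul (2 / Real.pi)
  have e : 2 / Real.pi * (Real.pi / 2) = 1 := by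
    have := Real.pi_pos.ne'
    field_simp
  rwa [e] at this

/-- The Green function is, up to a universal constant, the difference between the logarithmic
kernel on the outer boundary and at the point: `G(x₀, ·) + log` is nearly harmonic. -/
theorem exists_green_bounds : ∃ c : ℝ, 0 ≤ c ∧ ∀ (V : Finset (ℤ × ℤ)) (x₀ w : ℤ × ℤ), x₀ ∈ V →
    w ∈ V → ∀ m M : ℝ,
    ((∀ x ∈ V, ∀ y ∈ neighbors x, y ∉ V → m ≤ logKernel (y - x₀)) →
      m - logKernel (w - x₀) - c ≤ green V x₀ w) ∧
    ((∀ x ∈ V, ∀ y ∈ neighbors x, y ∉ V → logKernel (y - x₀) ≤ M) →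
      green V x₀ w ≤ M - logKernel (w - x₀) + c) := by
  obtain ⟨c, hc, hsum⟩ := exists_sum_abs_lap_logKernel_le
  refine ⟨c, hc, fun V x₀ w hx₀ hw m M => ?_⟩
  -- `Q` is harmonic, with the boundary values of the logarithm: the Green potential removes the
  -- error in the harmonicity of the logarithm.
  set Q : ℤ × ℤ → ℝ := fun u =>
    ∑ y ∈ V, lap logKernel (y - x₀) * green V y u + logKernel (u - x₀) with hQ
  have hQlap : ∀ u ∈ V, lap Q u = 0 := by
    intro u hu
    rw [hQ, lap_add (fun u => ∑ y ∈ V, lap logKernel (y - x₀) * green V y u)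
      (fun u => logKernel (u - x₀)), lap_sum V
      (fun y u => lap logKernel (y - x₀) * green V y u), lap_translate]
    rw [Finset.sum_congr rfl fun y _ => by rw [lap_const_mul, lap_green y hu],
      Finset.sum_eq_single u]
    · simp
    · intro y _ hy; simp [hy.symm]
    · exact fun h => absurd hu h
  have hQout : ∀ u, u ∉ V → Q u = logKernel (u - x₀) := by
    intro u hu
    simp only [hQ]
    rw [Finset.sum_eq_zero fun y _ => by rw [green_of_notMem y hu, mul_zero], zero_add]
  -- The error has total mass one and a finite first moment, and the Green function is Lipschitz,
  -- so that the potential may be replaced by the Green function with pole `x₀`.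
  have hQw : |Q w - (green V x₀ w + logKernel (w - x₀))| ≤ c := by
    have hlim : Tendsto (fun N : ℕ => |green V x₀ w * (∑ z ∈ box N, lap logKernel z - 1)| + c)
        atTop (𝓝 c) := by
      have h1 := ((tendsto_sum_box_lap_logKernel.sub_const 1).const_mul (green V x₀ w)).abs
      simpa using h1.add_const c
    refine ge_of_tendsto hlim ?_
    obtain ⟨N₀, hN₀⟩ : ∃ N₀ : ℕ, ∀ y ∈ V, (y - x₀).1.natAbs ≤ N₀ ∧ (y - x₀).2.natAbs ≤ N₀ := by
      refine ⟨V.sup fun y => max (y - x₀).1.natAbs (y - x₀).2.natAbs, fun y hy => ?_⟩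
      have := Finset.le_sup (f := fun y => max (y - x₀).1.natAbs (y - x₀).2.natAbs) hy
      exact ⟨(le_max_left _ _).trans this, (le_max_right _ _).trans this⟩
    filter_upwards [eventually_ge_atTop N₀] with N hN
    have h1 : ∑ y ∈ V, lap logKernel (y - x₀) * green V y w =
        ∑ z ∈ box N, lap logKernel z * green V w (z + x₀) := by
      have h2 : ∑ y ∈ V, lap logKernel (y - x₀) * green V y w =
          ∑ z ∈ V.image (· - x₀), lap logKernel z * green V w (z + x₀) := by
        rw [Finset.sum_image fun a _ b _ h => sub_left_injective h]
        refine Finset.sum_congr rfl fun y hy => ?_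
        rw [sub_add_cancel, green_comm hy hw]
      rw [h2]
      refine Finset.sum_subset ?_ ?_
      · intro z hz
        obtain ⟨y, hy, rfl⟩ := Finset.mem_image.1 hz
        have := hN₀ y hy
        simp only [box, Finset.mem_product, Finset.mem_Icc]
        omega
      · intro z _ hz
        have : z + x₀ ∉ V := fun h => hz (Finset.mem_image.2 ⟨z + x₀, h, by simp⟩)
        rw [green_of_notMem w this, mul_zero]
    have h3 : Q w - (green V x₀ w + logKernel (w - x₀)) =
        green V x₀ w * (∑ z ∈ box N, lap logKernel z - 1) +
        ∑ z ∈ box N, lap logKernel z * (green V w (z + x₀) - green V w x₀) := by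
      simp only [hQ, h1, mul_sub, Finset.sum_sub_distrib, ← Finset.sum_mul]
      rw [green_comm hx₀ hw]; ring
    rw [h3]
    refine (abs_add_le _ _).trans (add_le_add le_rfl ?_)
    refine (Finset.abs_sum_le_sum_abs _ _).trans (le_trans ?_ (hsum N))
    refine Finset.sum_le_sum fun z _ => ?_
    rw [abs_mul]
    refine mul_le_mul_of_nonneg_left ?_ (abs_nonneg _)
    simpa using abs_green_sub_le (V := V) (w := w) (z + x₀) x₀
  rw [abs_le] at hQw
  constructor
  · intro hm
    have := min_principle (V := V) (f := fun u => Q u - m)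
      (fun x hx => Or.inr (by rw [lap_sub Q fun _ => m, hQlap x hx, lap_const, sub_zero]))
      (fun x hx y hy hyV => by rw [hQout y hyV]; linarith [hm x hx y hy hyV]) w hw
    linarith
  · intro hM
    have := min_principle (V := V) (f := fun u => M - Q u)
      (fun x hx => Or.inr (by
        rw [lap_sub (fun _ => M) Q, hQlap x hx, lap_const, sub_zero]))
      (fun x hx y hy hyV => by rw [hQout y hyV]; linarith [hM x hx y hy hyV]) w hw
    linarith

/-! ### The wired graph and the recurrence of `∂` -/

/-- The function on the wired graph with value `1` at `∂` and `u` on `D_n`. -/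
def vertexFun (u : ℤ × ℤ → ℝ) : Vertex D n → ℝ
  | none => 1
  | some x => u x.1

theorem vertexFun_nonneg {u : ℤ × ℤ → ℝ} (hu : ∀ x, 0 ≤ u x) (v : Vertex D n) :
    0 ≤ vertexFun u v := by
  cases v with
  | none => exact zero_le_one
  | some x => exact hu x.1

theorem sum_edgeCount_some (x : {x : ℤ × ℤ // x ∈ latticeDomain D n}) {u : ℤ × ℤ → ℝ}
    (hu : ∀ y, y ∉ latticeDomain D n → u y = 1) :
    ∑ w : Vertex D n, (edgeCount (some x) w : ℝ) * vertexFun u w = ∑ y ∈ neighbors x.1, u y := by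
  rw [Fintype.sum_option]
  simp only [edgeCount, vertexFun, Nat.cast_ite, Nat.cast_one, Nat.cast_zero, ite_mul, one_mul,
    zero_mul, mul_one]
  rw [Finset.sum_coe_sort (latticeDomain D n) fun y => if y ∈ neighbors x.1 then u y else 0,
    ← Finset.sum_filter, ← Finset.sum_filter_not_add_sum_filter (neighbors x.1)
      (· ∈ latticeDomain D n)]
  congr 1
  · rw [Finset.sum_congr rfl fun y hy => hu y (Finset.mem_filter.1 hy).2]; simp
  · refine Finset.sum_congr ?_ fun _ _ => rfl
    ext y; simp [and_comm]

theorem sum_edgeCount_none (u : ℤ × ℤ → ℝ) :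
    ∑ w : Vertex D n, (edgeCount none w : ℝ) * vertexFun u w =
      ∑ x ∈ latticeDomain D n,
        (((neighbors x).filter (· ∉ latticeDomain D n)).card : ℝ) * u x := by
  rw [Fintype.sum_option]
  simp only [edgeCount, vertexFun, Nat.cast_zero, zero_mul, zero_add]
  exact Finset.sum_coe_sort (latticeDomain D n)
    fun x => (((neighbors x).filter (· ∉ latticeDomain D n)).card : ℝ) * u x

theorem degree_eq_sum (v : Vertex D n) :
    (degree v : ℝ) = ∑ w : Vertex D n, (edgeCount v w : ℝ) * vertexFun (fun _ => 1) w := by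
  rw [degree, Nat.cast_sum]
  refine Finset.sum_congr rfl fun w _ => ?_
  cases w <;> simp [vertexFun]

theorem degree_some (x : {x : ℤ × ℤ // x ∈ latticeDomain D n}) :
    (degree (some x : Vertex D n) : ℝ) = 4 := by
  rw [degree_eq_sum, sum_edgeCount_some x fun _ _ => rfl]
  simp [card_neighbors]

theorem degree_none_pos (hV : (latticeDomain D n).Nonempty) :
    0 < (degree (none : Vertex D n) : ℝ) := by
  rw [degree_eq_sum, sum_edgeCount_none]
  obtain ⟨x, hx, hmax⟩ := (latticeDomain D n).exists_max_image Prod.fst hV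
  refine Finset.sum_pos' (fun y _ => by positivity) ⟨x, hx, ?_⟩
  rw [mul_one, Nat.cast_pos, Finset.card_pos]
  refine ⟨(x.1 + 1, x.2), Finset.mem_filter.2 ⟨by simp [neighbors], fun h => ?_⟩⟩
  have := hmax _ h
  simp at this

theorem degree_pos (hV : (latticeDomain D n).Nonempty) (v : Vertex D n) :
    0 < (degree v : ℝ) := by
  cases v with
  | none => exact degree_none_pos hV
  | some x => rw [degree_some]; norm_num

theorem lintegral_stepKernel (hV : (latticeDomain D n).Nonempty) (v : Vertex D n)
    {f : Vertex D n → ℝ} (hf : ∀ w, 0 ≤ f w) :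
    ∫⁻ w, ENNReal.ofReal (f w) ∂stepKernel D n v =
      ENNReal.ofReal ((∑ w, (edgeCount v w : ℝ) * f w) / degree v) := by
  have hdeg := degree_pos hV v
  have hsum : ∑' w, (edgeCount v w : ENNReal) = (degree v : ENNReal) := by
    rw [tsum_fintype, degree, Nat.cast_sum]
  have hne : ∑' w, (edgeCount v w : ENNReal) ≠ 0 := by
    rw [hsum]; exact_mod_cast (Nat.cast_pos.1 hdeg).ne'
  have hstep : ∀ w, stepPMF v w = (edgeCount v w : ENNReal) * (degree v : ENNReal)⁻¹ := by
    intro w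
    rw [stepPMF, dif_pos hne, PMF.normalize_apply, hsum]
  have h0 : ∀ w, 0 ≤ (edgeCount v w : ℝ) * f w := fun w => mul_nonneg (by positivity) (hf w)
  change ∫⁻ w, ENNReal.ofReal (f w) ∂(stepPMF v).toMeasure = _
  rw [lintegral_fintype, ENNReal.ofReal_div_of_pos hdeg,
    ENNReal.ofReal_sum_of_nonneg fun w _ => h0 w, ENNReal.ofReal_natCast, div_eq_mul_inv,
    Finset.sum_mul]
  refine Finset.sum_congr rfl fun w _ => ?_
  rw [PMF.toMeasure_apply_singleton _ _ (MeasurableSet.singleton w), hstep,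
    ENNReal.ofReal_mul (by positivity), ENNReal.ofReal_natCast]
  ring

theorem lintegral_stepKernel_some (hV : (latticeDomain D n).Nonempty)
    (x : {x : ℤ × ℤ // x ∈ latticeDomain D n}) {u : ℤ × ℤ → ℝ} (hu0 : ∀ y, 0 ≤ u y)
    (hu : ∀ y, y ∉ latticeDomain D n → u y = 1) :
    ∫⁻ w, ENNReal.ofReal (vertexFun u w) ∂stepKernel D n (some x) =
      ENNReal.ofReal ((∑ y ∈ neighbors x.1, u y) / 4) := by
  rw [lintegral_stepKernel hV _ (vertexFun_nonneg hu0), sum_edgeCount_some x hu, degree_some]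

/-- The sum of the Laplacian of `u` over `V`. If `u` has the value `1` at `∂`, this is the net flow
of `u` out of `∂`, and a step from `∂` reduces `u` on average at this rate per unit of local time.
-/
def chargeRate (V : Finset (ℤ × ℤ)) (u : ℤ × ℤ → ℝ) : ℝ := ∑ x ∈ V, lap u x

/-- By the divergence theorem, the mean of `u` after a step from `∂` is one minus the quotient of
`chargeRate` and the jump rate at `∂`. -/
theorem lintegral_stepKernel_none (hV : (latticeDomain D n).Nonempty) {u : ℤ × ℤ → ℝ}
    (hu0 : ∀ y, 0 ≤ u y) (hu : ∀ y, y ∉ latticeDomain D n → u y = 1) :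
    0 ≤ 1 - chargeRate (latticeDomain D n) u / ((degree (none : Vertex D n) : ℝ) / (2 * Real.pi)) ∧
    ∫⁻ w, ENNReal.ofReal (vertexFun u w) ∂stepKernel D n none =
      ENNReal.ofReal (1 - chargeRate (latticeDomain D n) u /
        ((degree (none : Vertex D n) : ℝ) / (2 * Real.pi))) := by
  have hdeg := degree_none_pos hV
  have hflux := sum_neg_lap (V := latticeDomain D n) (g := fun x => 1 - u x)
    fun y hy => by rw [hu y hy, sub_self]
  have h1 : chargeRate (latticeDomain D n) u =
      ((degree (none : Vertex D n) : ℝ) -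
        ∑ w : Vertex D n, (edgeCount none w : ℝ) * vertexFun u w) / (2 * Real.pi) := by
    rw [degree_eq_sum, sum_edgeCount_none, sum_edgeCount_none, ← Finset.sum_sub_distrib,
      Finset.sum_div]
    have e : chargeRate (latticeDomain D n) u =
        ∑ x ∈ latticeDomain D n, -lap (fun x => 1 - u x) x := by
      refine Finset.sum_congr rfl fun x _ => ?_
      rw [lap_sub (fun _ => 1) u, lap_const]; ring
    rw [e, hflux]
    refine Finset.sum_congr rfl fun x _ => ?_
    ring
  have h2 : 1 - chargeRate (latticeDomain D n) u /
      ((degree (none : Vertex D n) : ℝ) / (2 * Real.pi)) =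
      (∑ w : Vertex D n, (edgeCount none w : ℝ) * vertexFun u w) /
        degree (none : Vertex D n) := by
    rw [h1]
    have := two_pi_pos
    field_simp
    ring
  rw [h2]
  refine ⟨div_nonneg (Finset.sum_nonneg fun w _ => mul_nonneg (by positivity)
    (vertexFun_nonneg hu0 w)) hdeg.le, ?_⟩
  rw [lintegral_stepKernel hV _ (vertexFun_nonneg hu0)]

/-- Joint estimate behind the recurrence of `∂`: there are a function `u ≥ 1` on the wired graph
and `ρ > 1`, `κ > 0` such that `ρ^k exp(-κ S_k) u(Z_k)` is a supermartingale, `S_k` being the local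
time at `∂` upon arrival at the `k`-th vertex `Z_k`. -/
theorem lintegral_exp_boundaryTime_le (hV : (latticeDomain D n).Nonempty) :
    ∃ κ ρ : ℝ, 0 < κ ∧ 1 < ρ ∧ ∀ k, ENNReal.ofReal (ρ ^ k) *
      ∫⁻ ω, ENNReal.ofReal (Real.exp (-(κ * boundaryTime ω k))) ∂walkLaw D n ≤ 1 := by
  set V := latticeDomain D n with hVdef
  let q : ℤ × ℤ → ℝ := fun y => (y.1 : ℝ) ^ 2 + (y.2 : ℝ) ^ 2
  have hq0 : ∀ y, 0 ≤ q y := fun y => by positivity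
  set R : ℝ := ∑ x ∈ V, (q x + ∑ y ∈ neighbors x, q y) with hR
  have hR0 : 0 ≤ R := Finset.sum_nonneg fun x _ =>
    add_nonneg (hq0 x) (Finset.sum_nonneg fun y _ => hq0 y)
  have hRx : ∀ x ∈ V, q x + ∑ y ∈ neighbors x, q y ≤ R := fun x hx =>
    Finset.single_le_sum (f := fun x => q x + ∑ y ∈ neighbors x, q y)
      (fun x _ => add_nonneg (hq0 x) (Finset.sum_nonneg fun y _ => hq0 y)) hx
  have hqx : ∀ x ∈ V, q x ≤ R := fun x hx => by
    have := hRx x hx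
    have := Finset.sum_nonneg fun y (_ : y ∈ neighbors x) => hq0 y
    linarith
  have hqy : ∀ x ∈ V, ∀ y ∈ neighbors x, q y ≤ R := fun x hx y hy => by
    have h1 := hRx x hx
    have h2 := Finset.single_le_sum (f := q) (fun y _ => hq0 y) hy
    have := hq0 x
    linarith
  -- The average of `|y|²` over the neighbours of `x` is `|x|² + 1`, so that a step from `V` reduces
  -- `u` by a fixed factor.
  let u : ℤ × ℤ → ℝ := fun y => if y ∈ V then 1 + R - q y else 1
  have hu1 : ∀ y, 1 ≤ u y := fun y => by
    simp only [u]; split_ifs with h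
    · linarith [hqx y h]
    · exact le_rfl
  have huR : ∀ y, u y ≤ 1 + R := fun y => by
    simp only [u]; split_ifs with h
    · linarith [hq0 y]
    · linarith
  have hu0 : ∀ y, 0 ≤ u y := fun y => zero_le_one.trans (hu1 y)
  have hout : ∀ y, y ∉ V → u y = 1 := fun y hy => if_neg hy
  have hv1 : ∀ v : Vertex D n, 1 ≤ vertexFun u v := fun v => by
    cases v with
    | none => exact le_rfl
    | some x => exact hu1 x.1
  have hvR : ∀ v : Vertex D n, vertexFun u v ≤ 1 + R := fun v => by
    cases v with
    | none => simpa [vertexFun] using hR0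
    | some x => exact huR x.1
  set ρ : ℝ := 1 + 1 / (1 + R)
  have h1R : 0 < 1 + R := by linarith
  have hρ2 : ρ ≤ 2 := by
    have : 1 / (1 + R) ≤ 1 := by rw [div_le_one h1R]; linarith
    simp only [ρ]; linarith
  have hρ1 : 1 < ρ := by simp only [ρ]; linarith [one_div_pos.2 h1R]
  set l : ℝ := (degree (none : Vertex D n) : ℝ) / (2 * Real.pi)
  have hl : 0 < l := div_pos (degree_none_pos hV) two_pi_pos
  -- A step from `∂` may increase `u` up to `1 + R`; the discount at the rate `a l` compensates
  -- this.
  set a : ℝ := 2 * (1 + R)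
  have ha : 0 < a := by positivity
  refine ⟨a * l, ρ, by positivity, hρ1, ?_⟩
  have hsome : ∀ x : {x : ℤ × ℤ // x ∈ latticeDomain D n},
      ρ * ((∑ y ∈ neighbors x.1, u y) / 4) ≤ u x.1 := by
    intro x
    have hx : x.1 ∈ V := x.2
    have h1 : ∑ y ∈ neighbors x.1, u y ≤ ∑ y ∈ neighbors x.1, (1 + R - q y) := by
      refine Finset.sum_le_sum fun y hy => ?_
      simp only [u]; split_ifs with h
      · exact le_rfl
      · linarith [hqy x.1 hx y hy]
    have h2 : ∑ y ∈ neighbors x.1, (1 + R - q y) = 4 * (1 + R - q x.1 - 1) := by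
      rw [sum_neighbors]; simp only [q]; push_cast; ring
    have h3 : u x.1 = 1 + R - q x.1 := if_pos hx
    have h4 : ρ * ((∑ y ∈ neighbors x.1, u y) / 4) ≤ ρ * (R - q x.1) :=
      mul_le_mul_of_nonneg_left (by linarith) (by linarith)
    have h5 : 1 / (1 + R) * (R - q x.1) ≤ 1 := by
      rw [one_div, inv_mul_le_iff₀ h1R]; linarith [hq0 x.1]
    have h6 : ρ * (R - q x.1) = R - q x.1 + 1 / (1 + R) * (R - q x.1) := by simp only [ρ]; ring
    rw [h3]; linarith
  have main : ∀ k, ENNReal.ofReal (ρ ^ k) *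
      ∫⁻ ω, ENNReal.ofReal (Real.exp (-(a * l * boundaryTime ω k))) *
        ENNReal.ofReal (vertexFun u (ω.1 k)) ∂walkLaw D n ≤ 1 := by
    intro k
    induction k with
    | zero =>
      have h : ∀ᵐ ω ∂walkLaw D n, ENNReal.ofReal (Real.exp (-(a * l * boundaryTime ω 0))) *
          ENNReal.ofReal (vertexFun u (ω.1 0)) = 1 := by
        filter_upwards [ae_skeleton_zero] with ω hω
        simp [boundaryTime_zero, hω, vertexFun]
      rw [lintegral_congr_ae h]; simp
    | succ k ih =>
      refine le_trans ?_ ih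
      rw [pow_succ, ENNReal.ofReal_mul (by positivity), mul_assoc]
      gcongr
      set f : Sample D n → ℝ → Vertex D n → ENNReal := fun ω e w =>
        ENNReal.ofReal (Real.exp (-(a * l * boundaryTime ω k))) *
          (ENNReal.ofReal (Real.exp (-(if ω.1 k = none then a * e else 0))) *
          ENNReal.ofReal (vertexFun u w)) with hf
      have hfm : Measurable fun p : Sample D n × ℝ × Vertex D n => f p.1 p.2.1 p.2.2 := by
        have m1 : Measurable fun p : Sample D n × ℝ × Vertex D n => boundaryTime p.1 k :=
          (measurable_boundaryTime k).comp measurable_fst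
        have m2 : Measurable fun p : Sample D n × ℝ × Vertex D n =>
            if p.1.1 k = none then a * p.2.1 else 0 :=
          Measurable.ite ((measurableSet_skeleton_eq k none).preimage measurable_fst)
            (by fun_prop) measurable_const
        have m3 : Measurable fun p : Sample D n × ℝ × Vertex D n => vertexFun u p.2.2 :=
          (Measurable.of_discrete (f := vertexFun (D := D) (n := n) u)).comp (by fun_prop)
        refine Measurable.mul ?_ (Measurable.mul ?_ m3.ennreal_ofReal)
        · exact (Real.measurable_exp.comp (m1.const_mul (a * l)).neg).ennreal_ofReal
        · exact (Real.measurable_exp.comp m2.neg).ennreal_ofReal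
      have e1 : ∀ ω : Sample D n, ENNReal.ofReal (Real.exp (-(a * l * boundaryTime ω (k + 1)))) *
          ENNReal.ofReal (vertexFun u (ω.1 (k + 1))) = f (past k ω) (ω.2 k) (ω.1 (k + 1)) := by
        intro ω
        simp only [hf, boundaryTime_past le_rfl, past_fst le_rfl, boundaryTime_succ]
        rw [← mul_assoc]
        congr 1
        rw [← ENNReal.ofReal_mul (Real.exp_pos _).le, ← Real.exp_add]
        congr 2
        split_ifs with h
        · rw [holdingTime, h]
          change -(a * l * (boundaryTime ω k + ω.2 k / l)) = _
          field_simp; ring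
        · ring
      simp_rw [e1]
      rw [lintegral_walk_step k hfm, ← lintegral_const_mul' _ _ ENNReal.ofReal_ne_top]
      refine lintegral_mono fun ω => ?_
      simp only [hf, boundaryTime_past le_rfl, past_fst le_rfl]
      simp_rw [lintegral_const_mul' _ _ ENNReal.ofReal_ne_top]
      rw [mul_left_comm]
      gcongr
      cases hz : ω.1 k with
      | none =>
        simp only [if_true]
        rw [lintegral_mul_const _ (by fun_prop), lintegral_expMeasure_exp (by linarith)]
        have h1 : ∫⁻ w, ENNReal.ofReal (vertexFun u w) ∂stepKernel D n none ≤
            ENNReal.ofReal (1 + R) := by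
          calc _ ≤ ∫⁻ w, ENNReal.ofReal (1 + R) ∂stepKernel D n none :=
                lintegral_mono fun w => ENNReal.ofReal_le_ofReal (hvR w)
            _ = _ := by simp
        calc _ ≤ ENNReal.ofReal 2 * (ENNReal.ofReal (1 / (1 + a)) * ENNReal.ofReal (1 + R)) := by
              gcongr
          _ = ENNReal.ofReal (2 * (1 / (1 + a) * (1 + R))) := by
              rw [ENNReal.ofReal_mul (by norm_num), ENNReal.ofReal_mul (by positivity)]
          _ ≤ _ := by
              refine ENNReal.ofReal_le_ofReal ?_
              have : 2 * (1 / (1 + a) * (1 + R)) = a / (1 + a) := by simp only [a]; ring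
              rw [this]
              change _ ≤ (1 : ℝ)
              rw [div_le_one (by positivity)]; linarith
      | some x =>
        simp only [reduceCtorEq, if_false]
        rw [lintegral_stepKernel_some hV x hu0 hout]
        simp only [neg_zero, Real.exp_zero, ENNReal.ofReal_one, one_mul, lintegral_const,
          measure_univ, mul_one]
        rw [← ENNReal.ofReal_mul (by linarith)]
        exact ENNReal.ofReal_le_ofReal (hsome x)
  intro k
  refine le_trans ?_ (main k)
  gcongr with ω
  exact le_mul_of_one_le_right zero_le (by
    rw [← ENNReal.ofReal_one]; exact ENNReal.ofReal_le_ofReal (hv1 _))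

theorem tendsto_measure_boundaryTime_le (hV : (latticeDomain D n).Nonempty) (t : ℝ) :
    Tendsto (fun k => walkLaw D n {ω | boundaryTime ω k ≤ t}) atTop (𝓝 0) := by
  obtain ⟨κ, ρ, hκ, hρ, h⟩ := lintegral_exp_boundaryTime_le hV
  have hρ0 : 0 < ρ := by linarith
  have h1 : ∀ k, walkLaw D n {ω | boundaryTime ω k ≤ t} ≤
      ENNReal.ofReal (Real.exp (κ * t) * (ρ⁻¹) ^ k) := by
    intro k
    have hm : Measurable fun ω : Sample D n =>
        ENNReal.ofReal (Real.exp (-(κ * boundaryTime ω k))) :=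
      (Real.measurable_exp.comp ((measurable_boundaryTime k).const_mul κ).neg).ennreal_ofReal
    have h2 := mul_meas_ge_le_lintegral hm (ENNReal.ofReal (Real.exp (-(κ * t)))) (μ := walkLaw D n)
    have h3 : walkLaw D n {ω | boundaryTime ω k ≤ t} ≤ walkLaw D n
        {ω | ENNReal.ofReal (Real.exp (-(κ * t))) ≤
          ENNReal.ofReal (Real.exp (-(κ * boundaryTime ω k)))} := by
      refine measure_mono fun ω hω => ENNReal.ofReal_le_ofReal (Real.exp_le_exp.2 ?_)
      have := mul_le_mul_of_nonneg_left hω hκ.le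
      linarith
    have h4 : ENNReal.ofReal (ρ ^ k * Real.exp (-(κ * t))) *
        walkLaw D n {ω | boundaryTime ω k ≤ t} ≤ 1 := by
      rw [ENNReal.ofReal_mul (by positivity), mul_assoc]
      refine le_trans ?_ (h k)
      gcongr
      exact (mul_le_mul_right h3 _).trans h2
    have h5 : Real.exp (κ * t) * (ρ⁻¹) ^ k = (ρ ^ k * Real.exp (-(κ * t)))⁻¹ := by
      rw [mul_inv, Real.exp_neg, inv_inv, inv_pow]; ring
    rw [h5, ENNReal.ofReal_inv_of_pos (by positivity), ← one_div, ENNReal.le_div_iff_mul_le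
      (Or.inl (by simp; positivity)) (Or.inl ENNReal.ofReal_ne_top), mul_comm]
    exact h4
  have h2 : Tendsto (fun k : ℕ => ENNReal.ofReal (Real.exp (κ * t) * (ρ⁻¹) ^ k)) atTop (𝓝 0) := by
    rw [← ENNReal.ofReal_zero]
    refine ENNReal.tendsto_ofReal ?_
    have := (tendsto_pow_atTop_nhds_zero_of_lt_one (inv_nonneg.2 hρ0.le)
      (inv_lt_one_of_one_lt₀ hρ)).const_mul (Real.exp (κ * t))
    simpa using this
  exact tendsto_of_tendsto_of_tendsto_of_le_of_le tendsto_const_nhds h2 (fun _ => zero_le) h1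

/-- The vertex `∂` is recurrent: its local time is almost surely unbounded. -/
theorem ae_boundaryTime_unbounded (hV : (latticeDomain D n).Nonempty) :
    ∀ᵐ ω ∂walkLaw D n, ∀ t : ℝ, ∃ k, t < boundaryTime ω k := by
  have h : ∀ᵐ ω ∂walkLaw D n, ∀ m : ℕ, ∃ k, (m : ℝ) < boundaryTime ω k := by
    rw [ae_all_iff]
    intro m
    rw [ae_iff]
    refine le_antisymm ?_ zero_le
    refine ge_of_tendsto' (tendsto_measure_boundaryTime_le hV m) fun k =>
      measure_mono fun ω hω => ?_
    simp only [not_exists, not_lt, Set.mem_ofPred_eq] at hω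
    exact hω k
  filter_upwards [h] with ω hω t
  obtain ⟨m, hm⟩ := exists_nat_gt t
  obtain ⟨k, hk⟩ := hω m
  exact ⟨k, hm.trans hk⟩

/-! ### Supersolutions and subsolutions -/

/-- The probability `exp (-∫ κ)` of no event between the times `s` and `t₂`, if events occur at rate
`κ₁` before `t₁` and at rate `κ₂` after. -/
def survival (κ₁ κ₂ t₁ t₂ s : ℝ) : ℝ :=
  Real.exp (-(κ₁ * max (t₁ - s) 0 + κ₂ * (t₂ - max s t₁)))

theorem continuous_survival (κ₁ κ₂ t₁ t₂ : ℝ) : Continuous (survival κ₁ κ₂ t₁ t₂) := by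
  unfold survival; fun_prop

theorem hasDerivAt_survival (κ₁ κ₂ t₁ t₂ : ℝ) {s : ℝ} (hs : s ≠ t₁) :
    HasDerivAt (survival κ₁ κ₂ t₁ t₂)
      ((if s ≤ t₁ then κ₁ else κ₂) * survival κ₁ κ₂ t₁ t₂ s) s := by
  rcases lt_or_gt_of_ne hs with h | h
  · have h1 : survival κ₁ κ₂ t₁ t₂ =ᶠ[𝓝 s]
        fun x => Real.exp (-(κ₁ * (t₁ - x) + κ₂ * (t₂ - t₁))) := by
      filter_upwards [Iio_mem_nhds h] with x hx
      have hx' : x < t₁ := hx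
      rw [survival, max_eq_left (by linarith), max_eq_right hx'.le]
    rw [if_pos h.le, h1.eq_of_nhds, mul_comm]
    refine HasDerivAt.congr_of_eventuallyEq (HasDerivAt.exp ?_) h1
    have := ((((hasDerivAt_id s).const_sub t₁).const_mul κ₁).add_const (κ₂ * (t₂ - t₁))).neg
    exact this.congr_deriv (by ring)
  · have h1 : survival κ₁ κ₂ t₁ t₂ =ᶠ[𝓝 s] fun x => Real.exp (-(κ₂ * (t₂ - x))) := by
      filter_upwards [Ioi_mem_nhds h] with x hx
      have hx' : t₁ < x := hx
      rw [survival, max_eq_right (by linarith), max_eq_left hx'.le, mul_zero, zero_add]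
    rw [if_neg (not_le.2 h), h1.eq_of_nhds, mul_comm]
    refine HasDerivAt.congr_of_eventuallyEq (HasDerivAt.exp ?_) h1
    have := (((hasDerivAt_id s).const_sub t₂).const_mul κ₂).neg
    exact this.congr_deriv (by ring)

/-- The integrand is the derivative of `-exp (-e) * survival (σ + e / r)`, except at one point. -/
theorem integral_exp_mul_survival (κ₁ κ₂ t₁ t₂ : ℝ) {r σ T : ℝ} (hr : 0 < r) (hT : 0 ≤ T) :
    IntervalIntegrable (fun e => Real.exp (-e) * ((1 - (if σ + e / r ≤ t₁ then κ₁ else κ₂) / r) *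
      survival κ₁ κ₂ t₁ t₂ (σ + e / r))) volume 0 T ∧
    ∫ e in (0 : ℝ)..T, Real.exp (-e) * ((1 - (if σ + e / r ≤ t₁ then κ₁ else κ₂) / r) *
      survival κ₁ κ₂ t₁ t₂ (σ + e / r)) =
      survival κ₁ κ₂ t₁ t₂ σ - Real.exp (-T) * survival κ₁ κ₂ t₁ t₂ (σ + T / r) := by
  have hc : Continuous fun e : ℝ => survival κ₁ κ₂ t₁ t₂ (σ + e / r) :=
    (continuous_survival _ _ _ _).comp (by fun_prop)
  have hset : MeasurableSet {e : ℝ | σ + e / r ≤ t₁} :=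
    measurableSet_le (by fun_prop) measurable_const
  have hint : IntervalIntegrable (fun e => Real.exp (-e) *
      ((1 - (if σ + e / r ≤ t₁ then κ₁ else κ₂) / r) *
      survival κ₁ κ₂ t₁ t₂ (σ + e / r))) volume 0 T := by
    have i : ∀ κ : ℝ, IntegrableOn (fun e => Real.exp (-e) * ((1 - κ / r) *
        survival κ₁ κ₂ t₁ t₂ (σ + e / r))) (Set.Ioc 0 T) := fun κ =>
      (Continuous.integrableOn_Icc (by fun_prop)).mono_set Set.Ioc_subset_Icc_self
    rw [intervalIntegrable_iff_integrableOn_Ioc_of_le hT]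
    refine (Integrable.piecewise hset (i κ₁).integrableOn (i κ₂).integrableOn).congr ?_
    refine ae_of_all _ fun e => ?_
    simp only [Set.piecewise, Set.mem_ofPred_eq]
    split_ifs <;> rfl
  refine ⟨hint, ?_⟩
  have hΨ : ∀ e ∈ Set.Ioo 0 T \ {r * (t₁ - σ)},
      HasDerivAt (fun e => -(Real.exp (-e) * survival κ₁ κ₂ t₁ t₂ (σ + e / r)))
      (Real.exp (-e) * ((1 - (if σ + e / r ≤ t₁ then κ₁ else κ₂) / r) *
      survival κ₁ κ₂ t₁ t₂ (σ + e / r))) e := by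
    intro e he
    have hne : σ + e / r ≠ t₁ := by
      intro h
      apply he.2
      rw [Set.mem_singleton_iff, ← h]; field_simp; ring
    have h1 := (hasDerivAt_survival κ₁ κ₂ t₁ t₂ hne).comp e
      (((hasDerivAt_id e).div_const r).const_add σ)
    have h2 := (((hasDerivAt_id e).neg.exp).mul h1).neg
    refine h2.congr_deriv ?_
    simp only [Pi.neg_apply, id, Function.comp]
    ring
  rw [MeasureTheory.integral_eq_of_hasDerivAt_off_countable_of_le _ _ hT (Set.countable_singleton _)
    (by fun_prop) hΨ hint]
  simp
  ring

/-- First-step equation at `∂` for the survival probability: with jump rate `r`, an excursion that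
starts at local time `s` survives with probability `1 - κ(s) / r`. -/
theorem lintegral_survival {κ₁ κ₂ t₁ t₂ r σ : ℝ} (hr : 0 < r) (h12 : t₁ ≤ t₂) (hσ : σ ≤ t₂)
    (h1 : 0 ≤ 1 - κ₁ / r) (h2 : 0 ≤ 1 - κ₂ / r) :
    ∫⁻ e, (if t₂ < σ + e / r then 1 else
      ENNReal.ofReal ((1 - (if σ + e / r ≤ t₁ then κ₁ else κ₂) / r) *
        survival κ₁ κ₂ t₁ t₂ (σ + e / r))) ∂expMeasure 1 =
      ENNReal.ofReal (survival κ₁ κ₂ t₁ t₂ σ) := by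
  set T := r * (t₂ - σ) with hTdef
  have hT : 0 ≤ T := mul_nonneg hr.le (by linarith)
  have hiff : ∀ e, t₂ < σ + e / r ↔ T < e := by
    intro e
    rw [hTdef, ← sub_lt_iff_lt_add', lt_div_iff₀ hr, mul_comm]
  have hc : Continuous fun e : ℝ => survival κ₁ κ₂ t₁ t₂ (σ + e / r) :=
    (continuous_survival _ _ _ _).comp (by fun_prop)
  have hset : MeasurableSet {e : ℝ | σ + e / r ≤ t₁} :=
    measurableSet_le (by fun_prop) measurable_const
  rw [lintegral_expMeasure_one]
  · rw [← Set.Ioc_union_Ioi_eq_Ioi hT, lintegral_union measurableSet_Ioi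
      (Set.disjoint_left.2 fun e he he' => not_lt.2 he.2 he')]
    obtain ⟨hi, hI⟩ := integral_exp_mul_survival κ₁ κ₂ t₁ t₂ (σ := σ) hr hT
    have hnn : ∀ e, 0 ≤ Real.exp (-e) * ((1 - (if σ + e / r ≤ t₁ then κ₁ else κ₂) / r) *
        survival κ₁ κ₂ t₁ t₂ (σ + e / r)) := fun e => by
      refine mul_nonneg (Real.exp_pos _).le (mul_nonneg ?_ (Real.exp_pos _).le)
      split_ifs <;> assumption
    have e1 : ∫⁻ e in Set.Ioc 0 T, ENNReal.ofReal (Real.exp (-e)) *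
        (if t₂ < σ + e / r then 1 else
          ENNReal.ofReal ((1 - (if σ + e / r ≤ t₁ then κ₁ else κ₂) / r) *
            survival κ₁ κ₂ t₁ t₂ (σ + e / r))) =
        ENNReal.ofReal (survival κ₁ κ₂ t₁ t₂ σ - Real.exp (-T)) := by
      have hlast : survival κ₁ κ₂ t₁ t₂ (σ + T / r) = 1 := by
        have : σ + T / r = t₂ := by rw [hTdef]; field_simp; ring
        rw [this, survival, max_eq_right (by linarith : t₁ - t₂ ≤ 0), max_eq_left h12]
        simp
      rw [hlast, mul_one] at hI
      rw [← hI, intervalIntegral.integral_of_le hT, ofReal_integral_eq_lintegral_ofReal hi.1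
        (ae_of_all _ hnn)]
      refine setLIntegral_congr_fun measurableSet_Ioc fun e he => ?_
      rw [if_neg (by rw [hiff]; exact not_lt.2 he.2), ← ENNReal.ofReal_mul (Real.exp_pos _).le]
    have e2 : ∫⁻ e in Set.Ioi T, ENNReal.ofReal (Real.exp (-e)) *
        (if t₂ < σ + e / r then 1 else
          ENNReal.ofReal ((1 - (if σ + e / r ≤ t₁ then κ₁ else κ₂) / r) *
            survival κ₁ κ₂ t₁ t₂ (σ + e / r))) = ENNReal.ofReal (Real.exp (-T)) := by
      have hi2 : IntegrableOn (fun e : ℝ => Real.exp (-e)) (Set.Ioi T) := by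
        simpa using integrableOn_exp_mul_Ioi (a := -1) (by norm_num) T
      rw [← integral_exp_neg_Ioi T, ofReal_integral_eq_lintegral_ofReal hi2
        (ae_of_all _ fun e => (Real.exp_pos _).le)]
      refine setLIntegral_congr_fun measurableSet_Ioi fun e he => ?_
      rw [if_pos ((hiff e).2 he), mul_one]
    have hpos : 0 ≤ survival κ₁ κ₂ t₁ t₂ σ - Real.exp (-T) := by
      have := intervalIntegral.integral_nonneg (μ := volume) hT fun e _ => hnn e
      rw [hI] at this
      have hlast : survival κ₁ κ₂ t₁ t₂ (σ + T / r) = 1 := by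
        have : σ + T / r = t₂ := by rw [hTdef]; field_simp; ring
        rw [this, survival, max_eq_right (by linarith : t₁ - t₂ ≤ 0), max_eq_left h12]
        simp
      rwa [hlast, mul_one] at this
    rw [e1, e2, ← ENNReal.ofReal_add hpos (Real.exp_pos _).le]
    congr 1; ring
  · refine Measurable.ite (measurableSet_lt measurable_const (by fun_prop)) measurable_const ?_
    refine Measurable.ennreal_ofReal (Measurable.mul ?_ hc.measurable)
    exact measurable_const.sub ((Measurable.ite hset measurable_const measurable_const).div_const r)

/-- The candidate for the expected weight of the rest of the path, in terms of one function on the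
wired graph for each of the two phases. -/
def phaseValue (u₁ u₂ : ℤ × ℤ → ℝ) (t₁ t₂ : ℝ) (σ : ℝ) (v : Vertex D n) : ENNReal :=
  ENNReal.ofReal (vertexFun (if σ ≤ t₁ then u₁ else u₂) v *
    survival (chargeRate (latticeDomain D n) u₁) (chargeRate (latticeDomain D n) u₂) t₁ t₂ σ)

/-- The weights `w₁` up to local time `t₁` at `∂`, and `w₂` afterwards. -/
def phaseWeight (w₁ w₂ : Vertex D n → ℝ → ENNReal) (t₁ : ℝ) (σ : ℝ) (v : Vertex D n) (h : ℝ) :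
    ENNReal := if σ ≤ t₁ then w₁ v h else w₂ v h

theorem measurable_phaseWeight {w₁ w₂ : Vertex D n → ℝ → ENNReal} (h1 : ∀ v, Measurable (w₁ v))
    (h2 : ∀ v, Measurable (w₂ v)) (t₁ : ℝ) (v : Vertex D n) :
    Measurable fun p : ℝ × ℝ => phaseWeight w₁ w₂ t₁ p.1 v p.2 :=
  Measurable.ite (measurableSet_le measurable_fst measurable_const)
    ((h1 v).comp measurable_snd) ((h2 v).comp measurable_snd)

theorem measurable_phaseValue (u₁ u₂ : ℤ × ℤ → ℝ) (t₁ t₂ : ℝ) (v : Vertex D n) :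
    Measurable fun σ => phaseValue u₁ u₂ t₁ t₂ σ v := by
  unfold phaseValue
  refine Measurable.ennreal_ofReal (Measurable.mul ?_ (continuous_survival _ _ _ _).measurable)
  have : (fun σ : ℝ => vertexFun (if σ ≤ t₁ then u₁ else u₂) v) =
      fun σ => if σ ≤ t₁ then vertexFun u₁ v else vertexFun u₂ v := by
    funext σ; split_ifs <;> rfl
  rw [this]
  exact Measurable.ite measurableSet_Iic measurable_const measurable_const

/-- The rate at which the walk jumps from a vertex of `D_n`. -/
def innerRate : ℝ := 4 / (2 * Real.pi)

theorem innerRate_pos : 0 < innerRate := by unfold innerRate; positivity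

/-- The mean weight of a visit to a vertex. -/
def meanWeight (w : Vertex D n → ℝ → ENNReal) (v : Vertex D n) : ENNReal :=
  ∫⁻ e, w v (e / innerRate) ∂expMeasure 1

theorem lintegral_stepValue_none (hV : (latticeDomain D n).Nonempty) {u₁ u₂ : ℤ × ℤ → ℝ}
    (hu₁ : ∀ y, 0 ≤ u₁ y) (hu₂ : ∀ y, 0 ≤ u₂ y) (hb₁ : ∀ y, y ∉ latticeDomain D n → u₁ y = 1)
    (hb₂ : ∀ y, y ∉ latticeDomain D n → u₂ y = 1) (w : ℝ → Vertex D n → ℝ → ENNReal)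
    {t₁ t₂ σ : ℝ} (h12 : t₁ ≤ t₂) (hσ : σ ≤ t₂) :
    ∫⁻ e, ∫⁻ v', stepValue w (phaseValue u₁ u₂ t₁ t₂) t₂ σ none e v' ∂stepKernel D n none
      ∂expMeasure 1 = phaseValue u₁ u₂ t₁ t₂ σ (none : Vertex D n) := by
  set r : ℝ := (degree (none : Vertex D n) : ℝ) / (2 * Real.pi)
  have hr : 0 < r := div_pos (degree_none_pos hV) two_pi_pos
  obtain ⟨p1, q1⟩ := lintegral_stepKernel_none hV hu₁ hb₁
  obtain ⟨p2, q2⟩ := lintegral_stepKernel_none hV hu₂ hb₂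
  have h0 : phaseValue u₁ u₂ t₁ t₂ σ (none : Vertex D n) = ENNReal.ofReal
      (survival (chargeRate (latticeDomain D n) u₁) (chargeRate (latticeDomain D n) u₂)
        t₁ t₂ σ) := by
    simp [phaseValue, vertexFun]
  rw [h0, ← lintegral_survival hr h12 hσ p1 p2]
  refine lintegral_congr fun e => ?_
  simp only [stepValue, if_true]
  change ∫⁻ v', (if t₂ < σ + e / r then 1 else phaseValue u₁ u₂ t₁ t₂ (σ + e / r) v')
    ∂stepKernel D n none = _
  by_cases h : t₂ < σ + e / r
  · simp [h]
  · simp only [h, if_false, phaseValue]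
    by_cases h1 : σ + e / r ≤ t₁
    · simp only [h1, if_true]
      rw [ENNReal.ofReal_mul p1, ← q1, ← lintegral_mul_const' _ _ ENNReal.ofReal_ne_top]
      refine lintegral_congr fun v' => ?_
      rw [ENNReal.ofReal_mul (vertexFun_nonneg hu₁ v')]
    · simp only [h1, if_false]
      rw [ENNReal.ofReal_mul p2, ← q2, ← lintegral_mul_const' _ _ ENNReal.ofReal_ne_top]
      refine lintegral_congr fun v' => ?_
      rw [ENNReal.ofReal_mul (vertexFun_nonneg hu₂ v')]

theorem lintegral_stepValue_some (hV : (latticeDomain D n).Nonempty) {u₁ u₂ : ℤ × ℤ → ℝ}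
    (hu₁ : ∀ y, 0 ≤ u₁ y) (hu₂ : ∀ y, 0 ≤ u₂ y) (hb₁ : ∀ y, y ∉ latticeDomain D n → u₁ y = 1)
    (hb₂ : ∀ y, y ∉ latticeDomain D n → u₂ y = 1) {w₁ w₂ : Vertex D n → ℝ → ENNReal}
    (hw₁ : ∀ v, Measurable (w₁ v)) (hw₂ : ∀ v, Measurable (w₂ v))
    (t₁ t₂ σ : ℝ) (x : {x : ℤ × ℤ // x ∈ latticeDomain D n}) :
    ∫⁻ e, ∫⁻ v', stepValue (phaseWeight w₁ w₂ t₁) (phaseValue u₁ u₂ t₁ t₂) t₂ σ (some x) e v'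
      ∂stepKernel D n (some x) ∂expMeasure 1 =
      (meanWeight (if σ ≤ t₁ then w₁ else w₂) (some x) * ENNReal.ofReal
        ((∑ y ∈ neighbors x.1, (if σ ≤ t₁ then u₁ else u₂) y) / 4)) *
      ENNReal.ofReal (survival (chargeRate (latticeDomain D n) u₁)
        (chargeRate (latticeDomain D n) u₂) t₁ t₂ σ) := by
  have hu : ∀ y, 0 ≤ (if σ ≤ t₁ then u₁ else u₂) y := by split_ifs <;> assumption
  have hb : ∀ y, y ∉ latticeDomain D n → (if σ ≤ t₁ then u₁ else u₂) y = 1 := by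
    split_ifs <;> assumption
  have hw : ∀ v, Measurable ((if σ ≤ t₁ then w₁ else w₂) v) := by split_ifs <;> assumption
  have hpw : ∀ v h, phaseWeight w₁ w₂ t₁ σ v h = (if σ ≤ t₁ then w₁ else w₂) v h := by
    intro v h; unfold phaseWeight; split_ifs <;> rfl
  simp only [stepValue, reduceCtorEq, if_false, hpw, phaseValue, degree_some]
  set u := if σ ≤ t₁ then u₁ else u₂
  set w := if σ ≤ t₁ then w₁ else w₂
  set s := survival (chargeRate (latticeDomain D n) u₁) (chargeRate (latticeDomain D n) u₂) t₁ t₂ σ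
  have h1 : ∀ e, ∫⁻ v', w (some x) (e / (4 / (2 * Real.pi))) *
      ENNReal.ofReal (vertexFun u v' * s) ∂stepKernel D n (some x) =
      w (some x) (e / innerRate) * (ENNReal.ofReal ((∑ y ∈ neighbors x.1, u y) / 4) *
        ENNReal.ofReal s) := by
    intro e
    rw [lintegral_const_mul _ Measurable.of_discrete, ← lintegral_stepKernel_some hV x hu hb,
      ← lintegral_mul_const' _ _ ENNReal.ofReal_ne_top]
    congr 1
    refine lintegral_congr fun v' => ?_
    rw [ENNReal.ofReal_mul (vertexFun_nonneg hu v')]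
  simp_rw [h1]
  have hm : Measurable fun e : ℝ => w (some x) (e / innerRate) := (hw _).comp (by fun_prop)
  rw [lintegral_mul_const _ hm, meanWeight, mul_assoc]

/-- An upper bound for the expected weight of the walk stopped when its local time at `∂` passes
`t₂`, from a supersolution `uᵢ` of the first-step equation in each of the two phases. -/
theorem lintegral_stoppedWeight_le_of_supersolution (hV : (latticeDomain D n).Nonempty)
    {u₁ u₂ : ℤ × ℤ → ℝ}
    (hu₁ : ∀ y, 0 ≤ u₁ y) (hu₂ : ∀ y, 0 ≤ u₂ y) (hb₁ : ∀ y, y ∉ latticeDomain D n → u₁ y = 1)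
    (hb₂ : ∀ y, y ∉ latticeDomain D n → u₂ y = 1) {w₁ w₂ : Vertex D n → ℝ → ENNReal}
    (hw₁ : ∀ v, Measurable (w₁ v)) (hw₂ : ∀ v, Measurable (w₂ v))
    (hs₁ : ∀ x : {x : ℤ × ℤ // x ∈ latticeDomain D n}, meanWeight w₁ (some x) *
      ENNReal.ofReal ((∑ y ∈ neighbors x.1, u₁ y) / 4) ≤ ENNReal.ofReal (u₁ x.1))
    (hs₂ : ∀ x : {x : ℤ × ℤ // x ∈ latticeDomain D n}, meanWeight w₂ (some x) *
      ENNReal.ofReal ((∑ y ∈ neighbors x.1, u₂ y) / 4) ≤ ENNReal.ofReal (u₂ x.1))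
    {t₁ t₂ : ℝ} (ht₁ : 0 ≤ t₁) (h12 : t₁ ≤ t₂) :
    ∫⁻ ω, ∑' k, stoppedWeight (phaseWeight w₁ w₂ t₁) t₂ ω k ∂walkLaw D n ≤
      ENNReal.ofReal (Real.exp (-(chargeRate (latticeDomain D n) u₁ * t₁ +
        chargeRate (latticeDomain D n) u₂ * (t₂ - t₁)))) := by
  have h := lintegral_tsum_stoppedWeight_le (w := phaseWeight w₁ w₂ t₁)
    (Φ := phaseValue (D := D) (n := n) u₁ u₂ t₁ t₂) (measurable_phaseWeight hw₁ hw₂ t₁)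
    (measurable_phaseValue u₁ u₂ t₁ t₂) (ht₁.trans h12) ?_
  · refine h.trans (le_of_eq ?_)
    rw [phaseValue, vertexFun, one_mul, survival, max_eq_left (by linarith), max_eq_right ht₁,
      sub_zero]
  · intro σ v _ hσ
    cases v with
    | none => exact (lintegral_stepValue_none hV hu₁ hu₂ hb₁ hb₂ _ h12 hσ).le
    | some x =>
      rw [lintegral_stepValue_some hV hu₁ hu₂ hb₁ hb₂ hw₁ hw₂, phaseValue,
        ENNReal.ofReal_mul (vertexFun_nonneg (by split_ifs <;> assumption) _)]
      gcongr
      split_ifs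
      · exact hs₁ x
      · exact hs₂ x

/-- The lower bound that matches `lintegral_stoppedWeight_le_of_supersolution`, from subsolutions
and for weights bounded by one. -/
theorem le_lintegral_stoppedWeight_of_subsolution (hV : (latticeDomain D n).Nonempty)
    {u₁ u₂ : ℤ × ℤ → ℝ}
    (hu₁ : ∀ y, 0 ≤ u₁ y) (hu₂ : ∀ y, 0 ≤ u₂ y) (hb₁ : ∀ y, y ∉ latticeDomain D n → u₁ y = 1)
    (hb₂ : ∀ y, y ∉ latticeDomain D n → u₂ y = 1) {w₁ w₂ : Vertex D n → ℝ → ENNReal}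
    (hw₁ : ∀ v, Measurable (w₁ v)) (hw₂ : ∀ v, Measurable (w₂ v))
    (h1₁ : ∀ v h, w₁ v h ≤ 1) (h1₂ : ∀ v h, w₂ v h ≤ 1)
    (hs₁ : ∀ x : {x : ℤ × ℤ // x ∈ latticeDomain D n}, ENNReal.ofReal (u₁ x.1) ≤
      meanWeight w₁ (some x) * ENNReal.ofReal ((∑ y ∈ neighbors x.1, u₁ y) / 4))
    (hs₂ : ∀ x : {x : ℤ × ℤ // x ∈ latticeDomain D n}, ENNReal.ofReal (u₂ x.1) ≤
      meanWeight w₂ (some x) * ENNReal.ofReal ((∑ y ∈ neighbors x.1, u₂ y) / 4))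
    {t₁ t₂ : ℝ} (ht₁ : 0 ≤ t₁) (h12 : t₁ ≤ t₂)
    (hκ₁ : 0 ≤ chargeRate (latticeDomain D n) u₁) (hκ₂ : 0 ≤ chargeRate (latticeDomain D n) u₂) :
    ENNReal.ofReal (Real.exp (-(chargeRate (latticeDomain D n) u₁ * t₁ +
        chargeRate (latticeDomain D n) u₂ * (t₂ - t₁)))) ≤
      ∫⁻ ω, ∑' k, stoppedWeight (phaseWeight w₁ w₂ t₁) t₂ ω k ∂walkLaw D n := by
  have h := le_lintegral_tsum_stoppedWeight (w := phaseWeight w₁ w₂ t₁)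
    (Φ := phaseValue (D := D) (n := n) u₁ u₂ t₁ t₂) (measurable_phaseWeight hw₁ hw₂ t₁)
    (measurable_phaseValue u₁ u₂ t₁ t₂) (ht₁.trans h12)
    (fun σ v h => by unfold phaseWeight; split_ifs <;> [exact h1₁ v h; exact h1₂ v h])
    (B := ENNReal.ofReal (∑ v : Vertex D n, (vertexFun u₁ v + vertexFun u₂ v)))
    ENNReal.ofReal_ne_top ?_ (tendsto_measure_boundaryTime_le hV t₂) ?_
  · refine le_trans (le_of_eq ?_) h
    rw [phaseValue, vertexFun, one_mul, survival, max_eq_left (by linarith), max_eq_right ht₁,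
      sub_zero]
  · intro σ v hσ
    refine ENNReal.ofReal_le_ofReal ?_
    have hs1 : survival (chargeRate (latticeDomain D n) u₁) (chargeRate (latticeDomain D n) u₂)
        t₁ t₂ σ ≤ 1 := by
      rw [survival, Real.exp_le_one_iff, neg_nonpos]
      refine add_nonneg (mul_nonneg hκ₁ (le_max_right _ _)) (mul_nonneg hκ₂ ?_)
      have := max_le hσ h12
      linarith
    have h0 : 0 ≤ vertexFun (if σ ≤ t₁ then u₁ else u₂) v :=
      vertexFun_nonneg (by split_ifs <;> assumption) _
    refine (mul_le_of_le_one_right h0 hs1).trans ?_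
    have h2 : vertexFun (if σ ≤ t₁ then u₁ else u₂) v ≤ vertexFun u₁ v + vertexFun u₂ v := by
      have := vertexFun_nonneg hu₁ v
      have := vertexFun_nonneg hu₂ v
      split_ifs <;> linarith
    exact h2.trans (Finset.single_le_sum
      (f := fun v : Vertex D n => vertexFun u₁ v + vertexFun u₂ v)
      (fun v _ => add_nonneg (vertexFun_nonneg hu₁ v) (vertexFun_nonneg hu₂ v)) (Finset.mem_univ v))
  · intro σ v _ hσ
    cases v with
    | none => exact (lintegral_stepValue_none hV hu₁ hu₂ hb₁ hb₂ _ h12 hσ).ge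
    | some x =>
      rw [lintegral_stepValue_some hV hu₁ hu₂ hb₁ hb₂ hw₁ hw₂, phaseValue,
        ENNReal.ofReal_mul (vertexFun_nonneg (by split_ifs <;> assumption) _)]
      gcongr
      split_ifs
      · exact hs₁ x
      · exact hs₂ x

/-! ### Local times, real time and cover times of a sample path -/

/-- The almost sure properties of a sample that make its path well behaved: the clocks are positive,
the walk starts at `∂`, and its local time there is unbounded. -/
structure IsRegular (ω : Sample D n) : Prop where
  clock_pos : ∀ i, 0 < ω.2 i
  start : ω.1 0 = none
  unbounded : ∀ t : ℝ, ∃ k, t < boundaryTime ω k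

theorem ae_isRegular (hV : (latticeDomain D n).Nonempty) : ∀ᵐ ω ∂walkLaw D n, IsRegular ω := by
  filter_upwards [ae_clock_pos, ae_skeleton_zero, ae_boundaryTime_unbounded hV] with ω h1 h2 h3
  exact ⟨h1, h2, h3⟩

/-- The vertex `v` is visited by the time when the local time at `∂` passes `t`. -/
def IsVisited (ω : Sample D n) (t : ℝ) (v : Vertex D n) : Prop :=
  ∃ i, ω.1 i = v ∧ boundaryTime ω i ≤ t

/-- The time spent at `v` before the arrival at the `k`-th vertex. -/
def occupationTime (ω : Sample D n) (v : Vertex D n) (k : ℕ) : ℝ :=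
  ∑ i ∈ Finset.range k, if ω.1 i = v then holdingTime ω i else 0

theorem occupationTime_none (ω : Sample D n) (k : ℕ) :
    occupationTime ω none k = boundaryTime ω k := rfl

theorem jumpTime_succ (ω : Sample D n) (k : ℕ) :
    jumpTime ω (k + 1) = jumpTime ω k + holdingTime ω k := Finset.sum_range_succ _ _

theorem jumpTime_zero (ω : Sample D n) : jumpTime ω 0 = 0 := by simp [jumpTime]

section Regular
variable {ω : Sample D n}

theorem IsRegular.holdingTime_pos (hV : (latticeDomain D n).Nonempty) (hω : IsRegular ω) (i : ℕ) :
    0 < holdingTime ω i :=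
  div_pos (hω.clock_pos i) (div_pos (degree_pos hV _) two_pi_pos)

theorem IsRegular.jumpTime_strictMono (hV : (latticeDomain D n).Nonempty) (hω : IsRegular ω) :
    StrictMono (jumpTime ω) :=
  strictMono_nat_of_lt_succ fun k => by
    rw [jumpTime_succ]; linarith [hω.holdingTime_pos hV k]

theorem IsRegular.boundaryTime_mono (hω : IsRegular ω) : Monotone (boundaryTime ω) :=
  PhaseB.boundaryTime_mono hω.clock_pos

theorem IsRegular.boundaryTime_le_jumpTime (hω : IsRegular ω) (k : ℕ) :
    boundaryTime ω k ≤ jumpTime ω k :=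
  Finset.sum_le_sum fun i _ => by
    split_ifs
    · exact le_rfl
    · exact holdingTime_nonneg hω.clock_pos i

theorem IsRegular.exists_jumpTime (hω : IsRegular ω) {u : ℝ} (hu : 0 ≤ u) :
    ∃ k, jumpTime ω k ≤ u ∧ u < jumpTime ω (k + 1) := by
  classical
  have h : ∃ k, u < jumpTime ω k := by
    obtain ⟨k, hk⟩ := hω.unbounded u
    exact ⟨k, hk.trans_le (hω.boundaryTime_le_jumpTime k)⟩
  have h0 : Nat.find h ≠ 0 := by
    intro h0
    have := Nat.find_spec h
    rw [h0, jumpTime_zero] at this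
    linarith
  obtain ⟨k, hk⟩ := Nat.exists_eq_succ_of_ne_zero h0
  refine ⟨k, not_lt.1 (Nat.find_min h (by omega)), ?_⟩
  have := Nat.find_spec h
  rwa [hk] at this

/-- The step during which the local time at `∂` passes `t`. -/
theorem IsRegular.exists_boundaryTime (hω : IsRegular ω) {t : ℝ} (ht : 0 ≤ t) :
    ∃ k, boundaryTime ω k ≤ t ∧ t < boundaryTime ω (k + 1) ∧ ω.1 k = none := by
  classical
  have h := hω.unbounded t
  have h0 : Nat.find h ≠ 0 := by
    intro h0
    have := Nat.find_spec h
    rw [h0, boundaryTime_zero] at this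
    linarith
  obtain ⟨k, hk⟩ := Nat.exists_eq_succ_of_ne_zero h0
  have h1 : boundaryTime ω k ≤ t := not_lt.1 (Nat.find_min h (by omega))
  have h2 := Nat.find_spec h
  rw [hk] at h2
  refine ⟨k, h1, h2, ?_⟩
  by_contra hne
  have h3 : t < boundaryTime ω (k + 1) := h2
  rw [boundaryTime_succ, if_neg hne, add_zero] at h3
  linarith

theorem IsRegular.walk_eq (hV : (latticeDomain D n).Nonempty) (hω : IsRegular ω) {u : ℝ} {k : ℕ}
    (h1 : jumpTime ω k ≤ u) (h2 : u < jumpTime ω (k + 1)) : walk ω u = ω.1 k := by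
  have h : {j : ℕ | jumpTime ω j ≤ u} = Set.Iic k := by
    ext j
    simp only [Set.mem_ofPred_eq, Set.mem_Iic]
    constructor
    · intro hj
      exact Nat.lt_succ_iff.1 ((hω.jumpTime_strictMono hV).lt_iff_lt.1 (hj.trans_lt h2))
    · intro hj
      exact ((hω.jumpTime_strictMono hV).monotone hj).trans h1
  rw [walk, h, csSup_Iic]

open Classical in
theorem IsRegular.integral_walk (hV : (latticeDomain D n).Nonempty) (hω : IsRegular ω)
    (v : Vertex D n) {a b : ℝ} {k : ℕ} (ha : jumpTime ω k ≤ a) (hab : a ≤ b)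
    (hb : b ≤ jumpTime ω (k + 1)) :
    IntervalIntegrable (fun r => if walk ω r = v then (1 : ℝ) else 0) volume a b ∧
    ∫ r in a..b, (if walk ω r = v then (1 : ℝ) else 0) = if ω.1 k = v then b - a else 0 := by
  have h : ∀ᵐ r ∂(volume : Measure ℝ), r ∈ Set.uIoc a b →
      (if walk ω r = v then (1 : ℝ) else 0) = if ω.1 k = v then 1 else 0 := by
    have h0 : ∀ᵐ r ∂(volume : Measure ℝ), r ≠ b := by simp [ae_iff, measure_singleton]
    filter_upwards [h0] with r hr hrab
    rw [Set.uIoc_of_le hab] at hrab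
    rw [hω.walk_eq hV (ha.trans hrab.1.le) ((lt_of_le_of_ne hrab.2 hr).trans_le hb)]
  constructor
  · refine IntervalIntegrable.congr_ae (f := fun _ => if ω.1 k = v then (1 : ℝ) else 0)
      intervalIntegrable_const ?_
    refine (ae_restrict_iff' measurableSet_uIoc).2 ?_
    filter_upwards [h] with r hr hrab using (hr hrab).symm
  · rw [intervalIntegral.integral_congr_ae h, intervalIntegral.integral_const]
    simp

theorem IsRegular.realLocalTime_eq (hV : (latticeDomain D n).Nonempty) (hω : IsRegular ω)
    (v : Vertex D n) {u : ℝ} {k : ℕ} (h1 : jumpTime ω k ≤ u) (h2 : u ≤ jumpTime ω (k + 1)) :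
    realLocalTime ω u v =
      occupationTime ω v k + if ω.1 k = v then u - jumpTime ω k else 0 := by
  classical
  have hmono := (hω.jumpTime_strictMono hV).monotone
  have hk : ∀ i, IntervalIntegrable (fun r => if walk ω r = v then (1 : ℝ) else 0) volume
      (jumpTime ω i) (jumpTime ω (i + 1)) := fun i =>
    (hω.integral_walk hV v le_rfl (hmono i.le_succ) le_rfl).1
  have hsum := intervalIntegral.sum_integral_adjacent_intervals (n := k) fun i _ => hk i
  rw [jumpTime_zero] at hsum
  have h0k : IntervalIntegrable (fun r => if walk ω r = v then (1 : ℝ) else 0) volume 0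
      (jumpTime ω k) := by
    have := IntervalIntegrable.trans_iterate (n := k) fun i _ => hk i
    rwa [jumpTime_zero] at this
  obtain ⟨i1, e1⟩ := hω.integral_walk hV v le_rfl h1 h2
  have : realLocalTime ω u v = ∫ r in (0 : ℝ)..u, if walk ω r = v then (1 : ℝ) else 0 := by
    unfold realLocalTime
    congr
  rw [this, ← intervalIntegral.integral_add_adjacent_intervals h0k i1, e1, ← hsum]
  congr 1
  refine Finset.sum_congr rfl fun i _ => ?_
  rw [(hω.integral_walk hV v le_rfl (hmono i.le_succ) le_rfl).2, jumpTime_succ]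
  simp

/-- If the local time at `∂` passes `t` during the `k`-th holding time, then this happens at real
time `J_k + (t - S_k)`. -/
theorem IsRegular.realTime_eq (hV : (latticeDomain D n).Nonempty) (hω : IsRegular ω) {t : ℝ}
    {k : ℕ} (h1 : boundaryTime ω k ≤ t) (h2 : t < boundaryTime ω (k + 1)) (hk : ω.1 k = none) :
    realTime ω t = jumpTime ω k + (t - boundaryTime ω k) := by
  have hJ := hω.jumpTime_strictMono hV
  have hS := hω.boundaryTime_mono
  have hJ0 : 0 ≤ jumpTime ω k := by rw [← jumpTime_zero ω]; exact hJ.monotone k.zero_le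
  have hlt : t - boundaryTime ω k < holdingTime ω k := by
    rw [boundaryTime_succ, if_pos hk] at h2; linarith
  have hset : {u : ℝ | 0 ≤ u ∧ t < realLocalTime ω u none} =
      Set.Ioi (jumpTime ω k + (t - boundaryTime ω k)) := by
    ext u
    simp only [Set.mem_ofPred_eq, Set.mem_Ioi]
    constructor
    · rintro ⟨hu0, hu⟩
      obtain ⟨j, hj1, hj2⟩ := hω.exists_jumpTime hu0
      rw [hω.realLocalTime_eq hV none hj1 hj2.le, occupationTime_none] at hu
      by_contra! hle
      rcases lt_trichotomy j k with hjk | rfl | hjk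
      · have e1 : boundaryTime ω j + (if ω.1 j = none then u - jumpTime ω j else 0) ≤
            boundaryTime ω (j + 1) := by
          rw [boundaryTime_succ]
          rw [jumpTime_succ] at hj2
          split_ifs <;> linarith
        have := hS (Nat.succ_le_of_lt hjk)
        simp only [Nat.succ_eq_add_one] at this
        linarith
      · rw [if_pos hk] at hu; linarith
      · have := hJ.monotone (Nat.succ_le_of_lt hjk)
        rw [Nat.succ_eq_add_one, jumpTime_succ] at this
        linarith
    · intro hu
      have hu0 : 0 ≤ u := by linarith
      refine ⟨hu0, ?_⟩
      obtain ⟨j, hj1, hj2⟩ := hω.exists_jumpTime hu0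
      rw [hω.realLocalTime_eq hV none hj1 hj2.le, occupationTime_none]
      have hkj : k ≤ j := by
        by_contra! hjk
        have := hJ.monotone (Nat.succ_le_of_lt hjk)
        simp only [Nat.succ_eq_add_one] at this
        linarith
      rcases hkj.eq_or_lt with rfl | hkj
      · rw [if_pos hk]; linarith
      · have := hS (Nat.succ_le_of_lt hkj)
        simp only [Nat.succ_eq_add_one] at this
        split_ifs <;> linarith
  rw [realTime, hset, csInf_Ioi]

theorem IsRegular.localTime_eq (hV : (latticeDomain D n).Nonempty) (hω : IsRegular ω) {t : ℝ}
    {k : ℕ} (h1 : boundaryTime ω k ≤ t) (h2 : t < boundaryTime ω (k + 1)) (hk : ω.1 k = none)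
    (x : {x // x ∈ latticeDomain D n}) :
    localTime ω t (some x) = occupationTime ω (some x) k := by
  have hlt : t < boundaryTime ω k + holdingTime ω k := by
    rw [boundaryTime_succ, if_pos hk] at h2; exact h2
  rw [localTime, hω.realTime_eq hV h1 h2 hk,
    hω.realLocalTime_eq hV (some x) (k := k) (by linarith) (by rw [jumpTime_succ]; linarith), hk]
  simp

theorem IsRegular.isVisited_iff (hω : IsRegular ω) {t : ℝ}
    {k : ℕ} (h1 : boundaryTime ω k ≤ t) (h2 : t < boundaryTime ω (k + 1)) (hk : ω.1 k = none)
    (x : {x // x ∈ latticeDomain D n}) :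
    IsVisited ω t (some x) ↔ ∃ i < k, ω.1 i = some x := by
  constructor
  · rintro ⟨i, hi, hit⟩
    refine ⟨i, ?_, hi⟩
    have h3 : i < k + 1 := by
      by_contra! h
      exact absurd (hω.boundaryTime_mono h) (by linarith)
    refine lt_of_le_of_ne (Nat.lt_succ_iff.1 h3) fun h => ?_
    rw [h, hk] at hi
    exact absurd hi (by simp)
  · rintro ⟨i, hik, hi⟩
    exact ⟨i, hi, (hω.boundaryTime_mono hik.le).trans h1⟩

theorem IsRegular.localTime_pos_iff (hV : (latticeDomain D n).Nonempty) (hω : IsRegular ω) {t : ℝ}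
    (ht : 0 ≤ t) (x : {x // x ∈ latticeDomain D n}) :
    0 < localTime ω t (some x) ↔ IsVisited ω t (some x) := by
  obtain ⟨k, h1, h2, hk⟩ := hω.exists_boundaryTime ht
  rw [hω.localTime_eq hV h1 h2 hk, hω.isVisited_iff h1 h2 hk]
  have hnn : ∀ i ∈ Finset.range k, 0 ≤ if ω.1 i = some x then holdingTime ω i else 0 := by
    intro i _
    split_ifs
    · exact (hω.holdingTime_pos hV i).le
    · exact le_rfl
  constructor
  · intro h
    obtain ⟨i, hi, hpos⟩ := Finset.exists_lt_of_sum_lt (s := Finset.range k) (f := fun _ => (0 : ℝ))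
      (g := fun i => if ω.1 i = some x then holdingTime ω i else 0)
      (by simpa [occupationTime] using h)
    refine ⟨i, Finset.mem_range.1 hi, ?_⟩
    by_contra hne
    simp [hne] at hpos
  · rintro ⟨i, hi, hx⟩
    refine Finset.sum_pos' hnn ⟨i, Finset.mem_range.2 hi, ?_⟩
    rw [if_pos hx]; exact hω.holdingTime_pos hV i

/-- All vertices of `A ∩ D_n` are visited by the time when the local time at `∂` passes `t`. -/
def IsCovered (ω : Sample D n) (t : ℝ) (A : Finset (ℤ × ℤ)) : Prop :=
  ∀ v : {x // x ∈ latticeDomain D n}, v.1 ∈ A → IsVisited ω t (some v)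

theorem IsVisited.mono {s t : ℝ} (hst : s ≤ t) {v : Vertex D n} (h : IsVisited ω s v) :
    IsVisited ω t v := by
  obtain ⟨i, hi, his⟩ := h
  exact ⟨i, hi, his.trans hst⟩

theorem IsCovered.mono {s t : ℝ} (hst : s ≤ t) {A : Finset (ℤ × ℤ)} (h : IsCovered ω s A) :
    IsCovered ω t A := fun v hv => (h v hv).mono hst

/-- The step of the first visit to `v`. -/
def hitIndex (ω : Sample D n) (v : Vertex D n) : ℕ := sInf {i | ω.1 i = v}

/-- The step at which the cover of `A` is complete. -/
def coverIndex (ω : Sample D n) (A : Finset (ℤ × ℤ)) : ℕ :=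
  Finset.univ.sup fun v : {x // x ∈ latticeDomain D n} => if v.1 ∈ A then hitIndex ω (some v) else 0

theorem hitIndex_le {v : Vertex D n} {i : ℕ} (h : ω.1 i = v) : hitIndex ω v ≤ i := Nat.sInf_le h

theorem skeleton_hitIndex {v : Vertex D n} (h : ∃ i, ω.1 i = v) : ω.1 (hitIndex ω v) = v :=
  Nat.sInf_mem h

theorem hitIndex_le_coverIndex {A : Finset (ℤ × ℤ)} {v : {x // x ∈ latticeDomain D n}}
    (hv : v.1 ∈ A) : hitIndex ω (some v) ≤ coverIndex ω A := by
  have := Finset.le_sup (f := fun v : {x // x ∈ latticeDomain D n} =>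
    if v.1 ∈ A then hitIndex ω (some v) else 0) (Finset.mem_univ v)
  simp only [if_pos hv] at this
  exact this

theorem coverIndex_eq {A : Finset (ℤ × ℤ)} (hA : ∃ v : {x // x ∈ latticeDomain D n}, v.1 ∈ A) :
    ∃ v : {x // x ∈ latticeDomain D n}, v.1 ∈ A ∧ coverIndex ω A = hitIndex ω (some v) := by
  obtain ⟨v₀, hv₀⟩ := hA
  obtain ⟨v, _, hv⟩ := Finset.exists_mem_eq_sup Finset.univ ⟨v₀, Finset.mem_univ _⟩
    fun v : {x // x ∈ latticeDomain D n} => if v.1 ∈ A then hitIndex ω (some v) else 0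
  by_cases hvA : v.1 ∈ A
  · exact ⟨v, hvA, by rw [coverIndex, hv, if_pos hvA]⟩
  · refine ⟨v₀, hv₀, ?_⟩
    have h1 : coverIndex ω A = 0 := by rw [coverIndex, hv, if_neg hvA]
    have h2 := hitIndex_le_coverIndex (ω := ω) hv₀
    omega

theorem IsRegular.isCovered_iff (hω : IsRegular ω) (hrec : ∀ v, ∃ i, ω.1 i = v) {t : ℝ}
    (ht : 0 ≤ t) (A : Finset (ℤ × ℤ)) :
    IsCovered ω t A ↔ boundaryTime ω (coverIndex ω A) ≤ t := by
  constructor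
  · intro h
    by_cases hA : ∃ v : {x // x ∈ latticeDomain D n}, v.1 ∈ A
    · obtain ⟨v, hv, e⟩ := coverIndex_eq (ω := ω) hA
      obtain ⟨i, hi, hit⟩ := h v hv
      rw [e]
      exact (hω.boundaryTime_mono (hitIndex_le hi)).trans hit
    · have : coverIndex ω A = 0 := by
        rw [coverIndex, ← Nat.bot_eq_zero, Finset.sup_eq_bot_iff]
        intro v _
        rw [if_neg fun h => hA ⟨v, h⟩, Nat.bot_eq_zero]
      rw [this, boundaryTime_zero]; exact ht
  · intro h v hv
    exact ⟨hitIndex ω (some v), skeleton_hitIndex (hrec _),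
      (hω.boundaryTime_mono (hitIndex_le_coverIndex hv)).trans h⟩

theorem IsRegular.coverTime_le_iff (hV : (latticeDomain D n).Nonempty) (hω : IsRegular ω)
    (hrec : ∀ v, ∃ i, ω.1 i = v) {t : ℝ} (ht : 0 ≤ t) (A : Finset (ℤ × ℤ)) :
    coverTime A ω ≤ t ↔ IsCovered ω t A := by
  have h : {t : ℝ | 0 ≤ t ∧ ∀ v : {x // x ∈ latticeDomain D n}, v.1 ∈ A →
      0 < localTime ω t (some v)} = Set.Ici (boundaryTime ω (coverIndex ω A)) := by
    ext s
    simp only [Set.mem_ofPred_eq, Set.mem_Ici]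
    constructor
    · rintro ⟨hs, h⟩
      rw [← hω.isCovered_iff hrec hs]
      exact fun v hv => (hω.localTime_pos_iff hV hs v).1 (h v hv)
    · intro h
      have hs : 0 ≤ s := (boundaryTime_nonneg hω.clock_pos _).trans h
      refine ⟨hs, fun v hv => (hω.localTime_pos_iff hV hs v).2 ?_⟩
      exact (hω.isCovered_iff hrec hs A).2 h v hv
  rw [coverTime, h, csInf_Ici, hω.isCovered_iff hrec ht]

theorem IsRegular.lastVertex_eq (hV : (latticeDomain D n).Nonempty) (hω : IsRegular ω)
    (hrec : ∀ v, ∃ i, ω.1 i = v) (A : Finset (ℤ × ℤ)) :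
    lastVertex A ω = ω.1 (coverIndex ω A) := by
  have hJ := hω.jumpTime_strictMono hV
  have h : {u : ℝ | 0 ≤ u ∧ ∀ v : {x // x ∈ latticeDomain D n}, v.1 ∈ A →
      ∃ r ∈ Set.Icc 0 u, walk ω r = some v} = Set.Ici (jumpTime ω (coverIndex ω A)) := by
    ext u
    simp only [Set.mem_ofPred_eq, Set.mem_Ici]
    constructor
    · rintro ⟨hu, h⟩
      by_cases hA : ∃ v : {x // x ∈ latticeDomain D n}, v.1 ∈ A
      · obtain ⟨v, hv, e⟩ := coverIndex_eq (ω := ω) hA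
        obtain ⟨r, hr, hrv⟩ := h v hv
        obtain ⟨j, hj1, hj2⟩ := hω.exists_jumpTime hr.1
        rw [hω.walk_eq hV hj1 hj2] at hrv
        rw [e]
        exact ((hJ.monotone (hitIndex_le hrv)).trans hj1).trans hr.2
      · have : coverIndex ω A = 0 := by
          rw [coverIndex, ← Nat.bot_eq_zero, Finset.sup_eq_bot_iff]
          intro v _
          rw [if_neg fun h => hA ⟨v, h⟩, Nat.bot_eq_zero]
        rw [this, jumpTime_zero]; exact hu
    · intro h
      have h0 : ∀ k, 0 ≤ jumpTime ω k := fun k => by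
        rw [← jumpTime_zero ω]; exact hJ.monotone k.zero_le
      refine ⟨(h0 _).trans h, fun v hv => ⟨jumpTime ω (hitIndex ω (some v)),
        ⟨h0 _, (hJ.monotone (hitIndex_le_coverIndex hv)).trans h⟩, ?_⟩⟩
      rw [hω.walk_eq hV le_rfl (hJ (Nat.lt_succ_self _)), skeleton_hitIndex (hrec _)]
  rw [lastVertex, realCoverTime, h, csInf_Ici, hω.walk_eq hV le_rfl (hJ (Nat.lt_succ_self _))]

/-- If `A''` is covered at a time when `A ⊆ A' ∪ A''` is not, then the last vertex of `A` to be
visited belongs to `A'`. -/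
theorem IsRegular.exists_lastVertex_eq (hV : (latticeDomain D n).Nonempty) (hω : IsRegular ω)
    (hrec : ∀ v, ∃ i, ω.1 i = v) {t : ℝ} (ht : 0 ≤ t) {A A' A'' : Finset (ℤ × ℤ)}
    (hA : ∀ x ∈ A, x ∈ A' ∨ x ∈ A'') (h1 : IsCovered ω t A'') (h2 : ¬IsCovered ω t A) :
    ∃ v : {x // x ∈ latticeDomain D n}, lastVertex A ω = some v ∧ v.1 ∈ A ∧ v.1 ∈ A' := by
  have hne : ∃ v : {x // x ∈ latticeDomain D n}, v.1 ∈ A := by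
    by_contra! h
    exact h2 fun v hv => absurd hv (h v)
  obtain ⟨v, hv, e⟩ := coverIndex_eq (ω := ω) hne
  refine ⟨v, ?_, hv, (hA v.1 hv).resolve_right fun hv'' => ?_⟩
  · rw [hω.lastVertex_eq hV hrec, e, skeleton_hitIndex (hrec _)]
  · obtain ⟨i, hi, hit⟩ := h1 v hv''
    rw [hω.isCovered_iff hrec ht, e] at h2
    exact h2 ((hω.boundaryTime_mono (hitIndex_le hi)).trans hit)

/-- Exactly one step contributes to the total stopped weight. -/
theorem IsRegular.tsum_stoppedWeight (hω : IsRegular ω) (w : ℝ → Vertex D n → ℝ → ENNReal)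
    {t : ℝ} {k : ℕ} (h1 : boundaryTime ω k ≤ t) (h2 : t < boundaryTime ω (k + 1)) :
    ∑' j, stoppedWeight w t ω j = pathWeight w ω k := by
  rw [tsum_eq_single k]
  · rw [stoppedWeight, if_pos ⟨h1, h2⟩]
  · intro j hj
    rw [stoppedWeight, if_neg]
    rintro ⟨h3, h4⟩
    rcases lt_or_gt_of_ne hj with h | h
    · exact absurd (hω.boundaryTime_mono (Nat.succ_le_of_lt h)) (by
        simp only [Nat.succ_eq_add_one]; linarith)
    · exact absurd (hω.boundaryTime_mono (Nat.succ_le_of_lt h)) (by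
        simp only [Nat.succ_eq_add_one]; linarith)

end Regular

theorem measurableSet_isVisited (t : ℝ) (v : Vertex D n) :
    MeasurableSet {ω : Sample D n | IsVisited ω t v} := by
  have : {ω : Sample D n | IsVisited ω t v} =
      ⋃ i, {ω : Sample D n | ω.1 i = v} ∩ {ω | boundaryTime ω i ≤ t} := by
    ext ω; simp [IsVisited]
  rw [this]
  exact MeasurableSet.iUnion fun i => (measurableSet_skeleton_eq i v).inter
    (measurableSet_le (measurable_boundaryTime i) measurable_const)

theorem measurableSet_isCovered (t : ℝ) (A : Finset (ℤ × ℤ)) :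
    MeasurableSet {ω : Sample D n | IsCovered ω t A} := by
  have : {ω : Sample D n | IsCovered ω t A} =
      ⋂ v : {v : {x // x ∈ latticeDomain D n} // v.1 ∈ A},
        {ω : Sample D n | IsVisited ω t (some v.1)} := by
    ext ω; simp [IsCovered]
  rw [this]
  exact MeasurableSet.iInter fun v => measurableSet_isVisited t _

/-! ### Avoidance probabilities -/

/-- The weight of a visit of length `h` to `x`: zero if `x ∈ F`, and `exp (c x * h)` otherwise. -/
def tiltWeight (F : Finset (ℤ × ℤ)) (c : ℤ × ℤ → ℝ) : Vertex D n → ℝ → ENNReal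
  | none, _ => 1
  | some x, h => if x.1 ∈ F then 0 else ENNReal.ofReal (Real.exp (c x.1 * h))

theorem measurable_tiltWeight (F : Finset (ℤ × ℤ)) (c : ℤ × ℤ → ℝ) (v : Vertex D n) :
    Measurable (tiltWeight F c v) := by
  cases v with
  | none => exact measurable_const
  | some x =>
    by_cases hx : x.1 ∈ F
    · have h : tiltWeight (D := D) (n := n) F c (some x) = fun _ => 0 := by
        funext h; simp [tiltWeight, hx]
      rw [h]; exact measurable_const
    · have h : tiltWeight (D := D) (n := n) F c (some x) =
          fun h => ENNReal.ofReal (Real.exp (c x.1 * h)) := by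
        funext h; simp [tiltWeight, hx]
      rw [h]; fun_prop

theorem meanWeight_tiltWeight_of_mem {F : Finset (ℤ × ℤ)} (c : ℤ × ℤ → ℝ)
    {x : {x // x ∈ latticeDomain D n}} (hx : x.1 ∈ F) :
    meanWeight (tiltWeight F c) (some x) = 0 := by
  simp [meanWeight, tiltWeight, hx]

theorem meanWeight_tiltWeight {F : Finset (ℤ × ℤ)} {c : ℤ × ℤ → ℝ}
    {x : {x // x ∈ latticeDomain D n}} (hx : x.1 ∉ F) (hc : c x.1 < innerRate) :
    meanWeight (tiltWeight F c) (some x) = ENNReal.ofReal (innerRate / (innerRate - c x.1)) := by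
  have hr := innerRate_pos
  have h1 : ∀ e : ℝ, c x.1 * (e / innerRate) = -(-(c x.1 / innerRate) * e) := fun e => by ring
  simp only [meanWeight, tiltWeight, hx, if_false, h1]
  rw [lintegral_expMeasure_exp (by rw [neg_lt_neg_iff, div_lt_one hr]; exact hc)]
  congr 1
  rw [← sub_eq_add_neg, one_sub_div hr.ne', one_div_div]

/-- In terms of the generator, the first-step inequality at `x` reads `lap u x ≤ -c x * u x`. -/
theorem meanWeight_mul_le {F : Finset (ℤ × ℤ)} {c : ℤ × ℤ → ℝ} {u : ℤ × ℤ → ℝ}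
    {x : {x // x ∈ latticeDomain D n}}
    (h : x.1 ∈ F ∨ (c x.1 < innerRate ∧ lap u x.1 ≤ -(c x.1 * u x.1))) :
    meanWeight (tiltWeight F c) (some x) * ENNReal.ofReal ((∑ y ∈ neighbors x.1, u y) / 4) ≤
      ENNReal.ofReal (u x.1) := by
  by_cases hx : x.1 ∈ F
  · rw [meanWeight_tiltWeight_of_mem c hx, zero_mul]; exact zero_le
  · obtain ⟨hc, hl⟩ := h.resolve_left hx
    have hr := innerRate_pos
    rw [meanWeight_tiltWeight hx hc, ← ENNReal.ofReal_mul (by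
      exact div_nonneg hr.le (by linarith))]
    refine ENNReal.ofReal_le_ofReal ?_
    have h1 := lap_mul u x.1
    have h2 : innerRate * ((∑ y ∈ neighbors x.1, u y) / 4) = lap u x.1 + innerRate * u x.1 := by
      unfold innerRate
      have := two_pi_pos
      field_simp
      linarith
    rw [div_mul_eq_mul_div, h2, div_le_iff₀ (by linarith)]
    linarith

/-- Upper bound for exponential functionals of the local times at boundary time `t`. -/
theorem lintegral_tilt_le (hV : (latticeDomain D n).Nonempty) {F : Finset (ℤ × ℤ)}
    {c u : ℤ × ℤ → ℝ} (hu : ∀ y, 0 ≤ u y) (hb : ∀ y, y ∉ latticeDomain D n → u y = 1)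
    (h : ∀ x ∈ latticeDomain D n, x ∈ F ∨ (c x < innerRate ∧ lap u x ≤ -(c x * u x)))
    {t : ℝ} (ht : 0 ≤ t) :
    ∫⁻ ω, ∑' k, stoppedWeight (fun _ => tiltWeight F c) t ω k ∂walkLaw D n ≤
      ENNReal.ofReal (Real.exp (-(chargeRate (latticeDomain D n) u * t))) := by
  have h1 := lintegral_stoppedWeight_le_of_supersolution hV hu hu hb hb
    (measurable_tiltWeight F c) (measurable_tiltWeight F c)
    (fun x => meanWeight_mul_le (h x.1 x.2)) (fun x => meanWeight_mul_le (h x.1 x.2)) ht le_rfl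
  have h2 : phaseWeight (tiltWeight (D := D) (n := n) F c) (tiltWeight F c) t =
      fun _ => tiltWeight F c := by
    funext σ v h; simp [phaseWeight]
  rw [h2, sub_self, mul_zero, add_zero] at h1
  exact h1

/-- The exponent collected by the tilted weights before step `k`. -/
def tiltSum (c : ℤ × ℤ → ℝ) (ω : Sample D n) (k : ℕ) : ℝ :=
  ∑ i ∈ Finset.range k, match ω.1 i with
    | none => 0
    | some x => c x.1 * holdingTime ω i

theorem pathWeight_tiltWeight {F : Finset (ℤ × ℤ)} {ω : Sample D n} {k : ℕ}
    (h : ∀ i < k, ∀ x : {x // x ∈ latticeDomain D n}, x.1 ∈ F → ω.1 i ≠ some x)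
    (c : ℤ × ℤ → ℝ) :
    pathWeight (fun _ => tiltWeight F c) ω k = ENNReal.ofReal (Real.exp (tiltSum c ω k)) := by
  rw [tiltSum, Real.exp_sum, ENNReal.ofReal_prod_of_nonneg fun _ _ => (Real.exp_pos _).le]
  refine Finset.prod_congr rfl fun i hi => ?_
  cases hz : ω.1 i with
  | none => simp
  | some x =>
    have hx : x.1 ∉ F := fun hx => h i (Finset.mem_range.1 hi) x hx hz
    simp [tiltWeight, hx]

/-- No vertex of `F` is visited by the time when the local time at `∂` passes `t`. -/
def IsAvoided (ω : Sample D n) (t : ℝ) (F : Finset (ℤ × ℤ)) : Prop :=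
  ∀ v : {x // x ∈ latticeDomain D n}, v.1 ∈ F → ¬IsVisited ω t (some v)

theorem measurableSet_isAvoided (t : ℝ) (F : Finset (ℤ × ℤ)) :
    MeasurableSet {ω : Sample D n | IsAvoided ω t F} := by
  have : {ω : Sample D n | IsAvoided ω t F} =
      ⋂ v : {v : {x // x ∈ latticeDomain D n} // v.1 ∈ F},
        {ω : Sample D n | IsVisited ω t (some v.1)}ᶜ := by
    ext ω; simp [IsAvoided]
  rw [this]
  exact MeasurableSet.iInter fun v => (measurableSet_isVisited t _).compl

open Classical in
theorem IsRegular.tsum_stoppedWeight_avoid {ω : Sample D n} (hω : IsRegular ω)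
    {t₁ t₂ : ℝ} (ht₁ : 0 ≤ t₁) (h12 : t₁ ≤ t₂) (F₁ F₂ : Finset (ℤ × ℤ)) :
    ∑' k, stoppedWeight (phaseWeight (tiltWeight (F₁ ∪ F₂) 0) (tiltWeight F₂ 0) t₁) t₂ ω k =
      if IsAvoided ω t₁ F₁ ∧ IsAvoided ω t₂ F₂ then 1 else 0 := by
  obtain ⟨k, h1, h2, hk⟩ := hω.exists_boundaryTime (ht₁.trans h12)
  rw [hω.tsum_stoppedWeight _ h1 h2]
  split_ifs with hU
  · refine Finset.prod_eq_one fun i hi => ?_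
    have hik := Finset.mem_range.1 hi
    cases hz : ω.1 i with
    | none => simp
    | some x =>
      simp only [reduceCtorEq, if_false, phaseWeight]
      have hS : boundaryTime ω i ≤ t₂ := (hω.boundaryTime_mono hik.le).trans h1
      have hx2 : x.1 ∉ F₂ := fun hx => hU.2 x hx ⟨i, hz, hS⟩
      split_ifs with hS1
      · have hx1 : x.1 ∉ F₁ := fun hx => hU.1 x hx ⟨i, hz, hS1⟩
        simp [tiltWeight, hx1, hx2]
      · simp [tiltWeight, hx2]
  · have key : ∀ i, ∀ x : {x // x ∈ latticeDomain D n}, ω.1 i = some x → boundaryTime ω i ≤ t₂ →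
        (x.1 ∈ F₂ ∨ (x.1 ∈ F₁ ∧ boundaryTime ω i ≤ t₁)) →
        pathWeight (phaseWeight (tiltWeight (F₁ ∪ F₂) 0) (tiltWeight F₂ 0) t₁) ω k = 0 := by
      intro i x hz hS hx
      have hik : i < k := by
        have h3 : i < k + 1 := by
          by_contra! h
          exact absurd (hω.boundaryTime_mono h) (by linarith)
        refine lt_of_le_of_ne (Nat.lt_succ_iff.1 h3) fun h => ?_
        rw [h, hk] at hz
        exact absurd hz (by simp)
      refine Finset.prod_eq_zero (Finset.mem_range.2 hik) ?_
      rw [hz]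
      simp only [reduceCtorEq, if_false, phaseWeight]
      split_ifs with hS1
      · have : x.1 ∈ F₁ ∪ F₂ := by
          rw [Finset.mem_union]; tauto
        simp [tiltWeight, Finset.mem_union.1 this]
      · have : x.1 ∈ F₂ := by tauto
        simp [tiltWeight, this]
    rw [not_and_or] at hU
    rcases hU with hU | hU
    · simp only [IsAvoided, not_forall, not_not] at hU
      obtain ⟨x, hx, i, hi, hit⟩ := hU
      exact key i x hi (hit.trans h12) (Or.inr ⟨hx, hit⟩)
    · simp only [IsAvoided, not_forall, not_not] at hU
      obtain ⟨x, hx, i, hi, hit⟩ := hU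
      exact key i x hi hit (Or.inl hx)

theorem lintegral_avoid (hV : (latticeDomain D n).Nonempty) {t₁ t₂ : ℝ} (ht₁ : 0 ≤ t₁)
    (h12 : t₁ ≤ t₂) (F₁ F₂ : Finset (ℤ × ℤ)) :
    ∫⁻ ω, ∑' k, stoppedWeight (phaseWeight (tiltWeight (F₁ ∪ F₂) 0) (tiltWeight F₂ 0) t₁) t₂ ω k
      ∂walkLaw D n = walkLaw D n {ω | IsAvoided ω t₁ F₁ ∧ IsAvoided ω t₂ F₂} := by
  classical
  have hm : MeasurableSet {ω : Sample D n | IsAvoided ω t₁ F₁ ∧ IsAvoided ω t₂ F₂} :=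
    (measurableSet_isAvoided t₁ F₁).inter (measurableSet_isAvoided t₂ F₂)
  rw [← lintegral_indicator_one hm]
  refine lintegral_congr_ae ?_
  filter_upwards [ae_isRegular hV] with ω hω
  rw [hω.tsum_stoppedWeight_avoid ht₁ h12, Set.indicator]
  simp only [Set.mem_ofPred_eq, Pi.one_apply]

/-- `1 - c ∑_{y ∈ F} G(·, y)`: harmonic off `F`, with value `1` at the boundary. -/
def avoidFun (V F : Finset (ℤ × ℤ)) (c : ℝ) (z : ℤ × ℤ) : ℝ := 1 - c * ∑ y ∈ F, green V y z

section avoidFun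
variable {V F : Finset (ℤ × ℤ)} {c : ℝ}

theorem avoidFun_of_notMem {z : ℤ × ℤ} (hz : z ∉ V) : avoidFun V F c z = 1 := by
  rw [avoidFun, Finset.sum_eq_zero fun y _ => green_of_notMem y hz]; simp

theorem avoidFun_le_one (hc : 0 ≤ c) (z : ℤ × ℤ) : avoidFun V F c z ≤ 1 := by
  have := mul_nonneg hc (Finset.sum_nonneg fun y (_ : y ∈ F) => green_nonneg (V := V) y z)
  rw [avoidFun]; linarith

theorem lap_avoidFun {z : ℤ × ℤ} (hz : z ∈ V) :
    lap (avoidFun V F c) z = c * if z ∈ F then 1 else 0 := by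
  have h := lap_sub (fun _ => 1) (fun z => c * ∑ y ∈ F, green V y z) z
  rw [lap_const_mul c (fun z => ∑ y ∈ F, green V y z), lap_sum, lap_const] at h
  change lap (avoidFun V F c) z = _ at h
  rw [h, Finset.sum_congr rfl fun y _ => lap_green y hz, Finset.sum_neg_distrib]
  simp

theorem chargeRate_avoidFun (hF : F ⊆ V) : chargeRate V (avoidFun V F c) = c * F.card := by
  rw [chargeRate, Finset.sum_congr rfl fun z hz => lap_avoidFun hz, ← Finset.mul_sum,
    Finset.sum_ite_mem, Finset.inter_eq_right.2 hF]
  simp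

theorem avoidFun_nonneg (h : ∀ x ∈ F, 0 ≤ avoidFun V F c x) (z : ℤ × ℤ) :
    0 ≤ avoidFun V F c z := by
  by_cases hz : z ∈ V
  · refine min_principle (V := V) (fun x hx => ?_) (fun _ _ y _ hy => ?_) z hz
    · by_cases hxF : x ∈ F
      · exact Or.inl (h x hxF)
      · right; rw [lap_avoidFun hx]; simp [hxF]
    · rw [avoidFun_of_notMem hy]; exact zero_le_one
  · rw [avoidFun_of_notMem hz]; exact zero_le_one

end avoidFun

/-- The divergence theorem for `1 - u`, which vanishes off `V`. -/
theorem chargeRate_eq_flux {V : Finset (ℤ × ℤ)} {u : ℤ × ℤ → ℝ} (hu : ∀ y, y ∉ V → u y = 1) :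
    chargeRate V u =
      ∑ x ∈ V, (((neighbors x).filter (· ∉ V)).card : ℝ) * (1 - u x) / (2 * Real.pi) := by
  rw [← sum_neg_lap (V := V) (g := fun x => 1 - u x) fun y hy => by rw [hu y hy, sub_self]]
  refine Finset.sum_congr rfl fun x _ => ?_
  rw [lap_sub (fun _ => 1) u, lap_const]; ring

/-- Upper bound for the probability to avoid `F₁` up to time `t₁` and `F₂` up to time `t₂`, through
a lower bound for the capacities: `R` bounds the row sums of the Green matrix of `F₁ ∪ F₂`. -/
theorem measure_avoid_le (hV : (latticeDomain D n).Nonempty) {t₁ t₂ : ℝ} (ht₁ : 0 ≤ t₁)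
    (h12 : t₁ ≤ t₂) {F₁ F₂ : Finset (ℤ × ℤ)} (hF₁ : F₁ ⊆ latticeDomain D n)
    (hF₂ : F₂ ⊆ latticeDomain D n) (hdisj : Disjoint F₁ F₂) {R : ℝ} (hR : 0 < R)
    (hrow : ∀ x ∈ F₁ ∪ F₂, ∑ y ∈ F₁ ∪ F₂, green (latticeDomain D n) y x ≤ R) :
    walkLaw D n {ω | IsAvoided ω t₁ F₁ ∧ IsAvoided ω t₂ F₂} ≤
      ENNReal.ofReal (Real.exp (-((F₁.card * t₁ + F₂.card * t₂) / R))) := by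
  set V := latticeDomain D n
  have hpos : ∀ F : Finset (ℤ × ℤ), F ⊆ F₁ ∪ F₂ → ∀ y, 0 ≤ avoidFun V F (1 / R) y := by
    intro F hF
    refine avoidFun_nonneg fun x hx => ?_
    have h1 : ∑ y ∈ F, green V y x ≤ R :=
      (Finset.sum_le_sum_of_subset_of_nonneg hF fun y _ _ => green_nonneg y x).trans
        (hrow x (hF hx))
    rw [avoidFun, sub_nonneg, one_div, inv_mul_le_iff₀ hR]; linarith
  have hsup : ∀ F : Finset (ℤ × ℤ), ∀ x : {x // x ∈ latticeDomain D n}, x.1 ∈ F ∨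
      ((0 : ℤ × ℤ → ℝ) x.1 < innerRate ∧
        lap (avoidFun V F (1 / R)) x.1 ≤ -((0 : ℤ × ℤ → ℝ) x.1 * avoidFun V F (1 / R) x.1)) := by
    intro F x
    by_cases hx : x.1 ∈ F
    · exact Or.inl hx
    · right
      refine ⟨innerRate_pos, ?_⟩
      rw [lap_avoidFun x.2]; simp [hx]
  have h := lintegral_stoppedWeight_le_of_supersolution hV
    (hpos _ subset_rfl) (hpos F₂ Finset.subset_union_right)
    (fun y hy => avoidFun_of_notMem hy) (fun y hy => avoidFun_of_notMem hy)
    (measurable_tiltWeight (F₁ ∪ F₂) 0) (measurable_tiltWeight F₂ 0)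
    (fun x => meanWeight_mul_le (hsup _ x)) (fun x => meanWeight_mul_le (hsup _ x)) ht₁ h12
  rw [lintegral_avoid hV ht₁ h12] at h
  refine h.trans (le_of_eq ?_)
  rw [chargeRate_avoidFun (Finset.union_subset hF₁ hF₂), chargeRate_avoidFun hF₂,
    Finset.card_union_of_disjoint hdisj]
  congr 3
  push_cast
  field_simp
  ring

/-- Lower bound for the probability to avoid `F₁` up to time `t₁` and `F₂` up to time `t₂`, through
the subadditivity of capacity: `g` is a lower bound for the Green function on the diagonal. -/
theorem le_measure_avoid (hV : (latticeDomain D n).Nonempty) {t₁ t₂ : ℝ} (ht₁ : 0 ≤ t₁)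
    (h12 : t₁ ≤ t₂) {F₁ F₂ : Finset (ℤ × ℤ)} (hF₁ : F₁ ⊆ latticeDomain D n)
    (hF₂ : F₂ ⊆ latticeDomain D n) (hdisj : Disjoint F₁ F₂) {g : ℝ} (hg : 0 < g)
    (hdiag : ∀ x ∈ F₁ ∪ F₂, g ≤ green (latticeDomain D n) x x) :
    ENNReal.ofReal (Real.exp (-((F₁.card * t₁ + F₂.card * t₂) / g))) ≤
      walkLaw D n {ω | IsAvoided ω t₁ F₁ ∧ IsAvoided ω t₂ F₂} := by
  set V := latticeDomain D n with hVdef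
  -- The function `avoidFun` is not positive on `F`, and its positive part is a subsolution.
  set u : Finset (ℤ × ℤ) → ℤ × ℤ → ℝ := fun F z => max (avoidFun V F (1 / g) z) 0
  have hg' : 0 ≤ 1 / g := (one_div_pos.2 hg).le
  have hu0 : ∀ F y, 0 ≤ u F y := fun F y => le_max_right _ _
  have hu1 : ∀ F y, u F y ≤ 1 := fun F y => max_le (avoidFun_le_one hg' y) zero_le_one
  have hub : ∀ F, ∀ y, y ∉ V → u F y = 1 := fun F y hy => by
    simp only [u, avoidFun_of_notMem hy]; norm_num
  have hone : ∀ (F : Finset (ℤ × ℤ)) (v : Vertex D n) (h : ℝ), tiltWeight F 0 v h ≤ 1 := by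
    intro F v h
    cases v with
    | none => exact le_rfl
    | some x => simp only [tiltWeight]; split_ifs <;> simp
  have hzero : ∀ F ⊆ F₁ ∪ F₂, ∀ x ∈ F, u F x = 0 := by
    intro F hF x hx
    refine max_eq_right ?_
    have h1 : green V x x ≤ ∑ y ∈ F, green V y x :=
      Finset.single_le_sum (f := fun y => green V y x) (fun y _ => green_nonneg y x) hx
    have h2 := hdiag x (hF hx)
    rw [avoidFun, sub_nonpos, one_div, ← div_eq_inv_mul, le_div_iff₀ hg]; linarith
  have hsub : ∀ F ⊆ F₁ ∪ F₂, ∀ x : {x // x ∈ latticeDomain D n}, ENNReal.ofReal (u F x.1) ≤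
      meanWeight (tiltWeight F 0) (some x) *
        ENNReal.ofReal ((∑ y ∈ neighbors x.1, u F y) / 4) := by
    intro F hF x
    by_cases hx : x.1 ∈ F
    · rw [hzero F hF x.1 hx, ENNReal.ofReal_zero]; exact zero_le
    · rw [meanWeight_tiltWeight hx innerRate_pos]
      simp only [Pi.zero_apply, sub_zero, div_self innerRate_pos.ne', ENNReal.ofReal_one, one_mul]
      refine ENNReal.ofReal_le_ofReal ?_
      have h1 := lap_mul (avoidFun V F (1 / g)) x.1
      rw [lap_avoidFun x.2, if_neg hx, mul_zero, mul_zero] at h1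
      have h2 : ∑ y ∈ neighbors x.1, avoidFun V F (1 / g) y ≤ ∑ y ∈ neighbors x.1, u F y :=
        Finset.sum_le_sum fun y _ => le_max_left _ _
      have h3 : 0 ≤ ∑ y ∈ neighbors x.1, u F y := Finset.sum_nonneg fun y _ => hu0 F y
      exact max_le (by linarith) (by linarith)
  have hκ0 : ∀ F, 0 ≤ chargeRate V (u F) := by
    intro F
    rw [chargeRate_eq_flux (hub F)]
    refine Finset.sum_nonneg fun x _ => ?_
    have := hu1 F x
    exact div_nonneg (mul_nonneg (by positivity) (by linarith)) two_pi_pos.le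
  have hκ : ∀ F ⊆ V, chargeRate V (u F) ≤ 1 / g * F.card := by
    intro F hF
    rw [← chargeRate_avoidFun hF, chargeRate_eq_flux (hub F),
      chargeRate_eq_flux fun y hy => avoidFun_of_notMem hy]
    refine Finset.sum_le_sum fun x _ => ?_
    have : avoidFun V F (1 / g) x ≤ u F x := le_max_left _ _
    have h2 := two_pi_pos
    gcongr
  have h := le_lintegral_stoppedWeight_of_subsolution hV (hu0 (F₁ ∪ F₂)) (hu0 F₂) (hub _) (hub _)
    (measurable_tiltWeight (F₁ ∪ F₂) 0) (measurable_tiltWeight F₂ 0) (hone _) (hone _)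
    (hsub _ subset_rfl) (hsub F₂ Finset.subset_union_right) ht₁ h12 (hκ0 _) (hκ0 _)
  rw [lintegral_avoid hV ht₁ h12] at h
  refine le_trans (ENNReal.ofReal_le_ofReal (Real.exp_le_exp.2 (neg_le_neg ?_))) h
  have e1 := hκ _ (Finset.union_subset hF₁ hF₂)
  have e2 := hκ _ hF₂
  rw [Finset.card_union_of_disjoint hdisj] at e1
  push_cast at e1
  have e3 := mul_le_mul_of_nonneg_right e1 ht₁
  have e4 := mul_le_mul_of_nonneg_right e2 (sub_nonneg.2 h12)
  calc _ ≤ 1 / g * ((F₁.card : ℝ) + F₂.card) * t₁ + 1 / g * (F₂.card : ℝ) * (t₂ - t₁) :=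
        add_le_add e3 e4
    _ = _ := by ring

theorem green_self_pos {V : Finset (ℤ × ℤ)} {x : ℤ × ℤ} (hx : x ∈ V) : 0 < green V x x := by
  refine lt_of_le_of_ne (green_nonneg x x) fun h => ?_
  have h1 := lap_green (V := V) x hx
  rw [if_pos rfl, lap, ← h] at h1
  have h2 : 0 ≤ (∑ y ∈ neighbors x, (green V x y - 0)) / (2 * Real.pi) :=
    div_nonneg (Finset.sum_nonneg fun y _ => by rw [sub_zero]; exact green_nonneg x y)
      two_pi_pos.le
  linarith

theorem isAvoided_empty (ω : Sample D n) (t : ℝ) : IsAvoided ω t ∅ := fun _ h => absurd h (by simp)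

theorem isAvoided_singleton {ω : Sample D n} {t : ℝ} {x : ℤ × ℤ} (hx : x ∈ latticeDomain D n) :
    IsAvoided ω t {x} ↔ ¬IsVisited ω t (some ⟨x, hx⟩) := by
  constructor
  · intro h; exact h ⟨x, hx⟩ (by simp)
  · intro h v hv
    have : v = ⟨x, hx⟩ := Subtype.ext (Finset.mem_singleton.1 hv)
    rwa [this]

theorem measure_not_isVisited_le (hV : (latticeDomain D n).Nonempty) {t : ℝ} (ht : 0 ≤ t)
    {x : ℤ × ℤ} (hx : x ∈ latticeDomain D n) {R : ℝ} (hR : green (latticeDomain D n) x x ≤ R) :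
    walkLaw D n {ω | ¬IsVisited ω t (some ⟨x, hx⟩)} ≤ ENNReal.ofReal (Real.exp (-(t / R))) := by
  have hR0 : 0 < R := (green_self_pos hx).trans_le hR
  have h := measure_avoid_le hV ht le_rfl (F₁ := ∅) (F₂ := {x}) (by simp) (by simpa using hx)
    (by simp) hR0 (by simpa using hR)
  simpa [isAvoided_empty, isAvoided_singleton hx] using h

theorem le_measure_not_isVisited (hV : (latticeDomain D n).Nonempty) {t : ℝ} (ht : 0 ≤ t)
    {x : ℤ × ℤ} (hx : x ∈ latticeDomain D n) :
    ENNReal.ofReal (Real.exp (-(t / green (latticeDomain D n) x x))) ≤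
      walkLaw D n {ω | ¬IsVisited ω t (some ⟨x, hx⟩)} := by
  have h := le_measure_avoid hV ht le_rfl (F₁ := ∅) (F₂ := {x}) (by simp) (by simpa using hx)
    (by simp) (green_self_pos hx) (by simp)
  simpa [isAvoided_empty, isAvoided_singleton hx] using h

/-- Almost surely every vertex is visited. -/
theorem ae_exists_skeleton_eq (hV : (latticeDomain D n).Nonempty) :
    ∀ᵐ ω ∂walkLaw D n, ∀ v : Vertex D n, ∃ i, ω.1 i = v := by
  rw [ae_all_iff]
  intro v
  cases v with
  | none => filter_upwards [ae_skeleton_zero] with ω hω using ⟨0, hω⟩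
  | some x =>
    rw [ae_iff]
    refine le_antisymm ?_ zero_le
    have h1 : Tendsto (fun k : ℕ => ENNReal.ofReal
        (Real.exp (-((k : ℝ) / green (latticeDomain D n) x.1 x.1)))) atTop (𝓝 0) := by
      rw [← ENNReal.ofReal_zero]
      refine ENNReal.tendsto_ofReal (Real.tendsto_exp_neg_atTop_nhds_zero.comp ?_)
      exact tendsto_natCast_atTop_atTop.atTop_div_const (green_self_pos x.2)
    refine ge_of_tendsto' h1 fun k => ?_
    refine le_trans (measure_mono fun ω hω => ?_)
      (measure_not_isVisited_le hV (Nat.cast_nonneg k) x.2 le_rfl)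
    rintro ⟨i, hi, -⟩
    exact hω ⟨i, hi⟩

/-! ### Exponential functionals of the local times -/

/-- The product of the tilted weights of all visits that start by boundary time `t`. -/
def tiltTotal (F : Finset (ℤ × ℤ)) (c : ℤ × ℤ → ℝ) (t : ℝ) (ω : Sample D n) : ENNReal :=
  ∑' k, stoppedWeight (fun _ => tiltWeight F c) t ω k

theorem measurable_tiltTotal (F : Finset (ℤ × ℤ)) (c : ℤ × ℤ → ℝ) (t : ℝ) :
    Measurable (tiltTotal (D := D) (n := n) F c t) :=
  Measurable.tsum fun k => measurable_stoppedWeight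
    (fun v => (measurable_tiltWeight F c v).comp measurable_snd) t k

theorem IsRegular.tiltTotal_eq {ω : Sample D n} (hω : IsRegular ω) {t : ℝ} {k : ℕ}
    (h1 : boundaryTime ω k ≤ t) (h2 : t < boundaryTime ω (k + 1)) {F : Finset (ℤ × ℤ)}
    (hF : IsAvoided ω t F) (c : ℤ × ℤ → ℝ) :
    tiltTotal F c t ω = ENNReal.ofReal (Real.exp (tiltSum c ω k)) := by
  rw [tiltTotal, hω.tsum_stoppedWeight _ h1 h2, pathWeight_tiltWeight]
  intro i hi x hx hz
  exact hF x hx ⟨i, hz, (hω.boundaryTime_mono hi.le).trans h1⟩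

open Classical in
theorem tiltSum_single (a : ℝ) (x : {x // x ∈ latticeDomain D n}) (ω : Sample D n) (k : ℕ) :
    tiltSum (fun y => if y = x.1 then a else 0) ω k = a * occupationTime ω (some x) k := by
  rw [tiltSum, occupationTime, Finset.mul_sum]
  refine Finset.sum_congr rfl fun i _ => ?_
  cases hz : ω.1 i with
  | none => simp
  | some y =>
    by_cases hy : y = x
    · simp [hy]
    · have : y.1 ≠ x.1 := fun h => hy (Subtype.ext h)
      simp [hy, this]

theorem tiltSum_const (a : ℝ) (ω : Sample D n) (k : ℕ) :
    tiltSum (fun _ => a) ω k = a * (jumpTime ω k - boundaryTime ω k) := by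
  have h : jumpTime ω k = ∑ i ∈ Finset.range k, holdingTime ω i := rfl
  rw [tiltSum, h, boundaryTime, ← Finset.sum_sub_distrib, Finset.mul_sum]
  refine Finset.sum_congr rfl fun i _ => ?_
  cases hz : ω.1 i <;> simp

theorem IsRegular.tiltTotal_single (hV : (latticeDomain D n).Nonempty) {ω : Sample D n}
    (hω : IsRegular ω) {t : ℝ} (ht : 0 ≤ t) {F : Finset (ℤ × ℤ)} (hF : IsAvoided ω t F) (a : ℝ)
    (x : {x // x ∈ latticeDomain D n}) :
    tiltTotal F (fun y => if y = x.1 then a else 0) t ω =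
      ENNReal.ofReal (Real.exp (a * localTime ω t (some x))) := by
  obtain ⟨k, h1, h2, hk⟩ := hω.exists_boundaryTime ht
  rw [hω.tiltTotal_eq h1 h2 hF, tiltSum_single, hω.localTime_eq hV h1 h2 hk]

theorem IsRegular.tiltTotal_const (hV : (latticeDomain D n).Nonempty) {ω : Sample D n}
    (hω : IsRegular ω) {t : ℝ} (ht : 0 ≤ t) (a : ℝ) :
    tiltTotal ∅ (fun _ => a) t ω = ENNReal.ofReal (Real.exp (a * (realTime ω t - t))) := by
  obtain ⟨k, h1, h2, hk⟩ := hω.exists_boundaryTime ht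
  rw [hω.tiltTotal_eq h1 h2 (isAvoided_empty ω t), tiltSum_const, hω.realTime_eq hV h1 h2 hk]
  congr 3; ring

theorem lintegral_tiltTotal_le (hV : (latticeDomain D n).Nonempty) {F : Finset (ℤ × ℤ)}
    {c u : ℤ × ℤ → ℝ} (hu : ∀ y, 0 ≤ u y) (hb : ∀ y, y ∉ latticeDomain D n → u y = 1)
    (h : ∀ x ∈ latticeDomain D n, x ∈ F ∨ (c x < innerRate ∧ lap u x ≤ -(c x * u x)))
    {t : ℝ} (ht : 0 ≤ t) :
    ∫⁻ ω, tiltTotal F c t ω ∂walkLaw D n ≤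
      ENNReal.ofReal (Real.exp (-(chargeRate (latticeDomain D n) u * t))) :=
  lintegral_tilt_le hV hu hb h ht

/-- A visited vertex is unlikely to have a short local time. The Laplace transform of the local time
at `x` is `exp (-t / (ℓ + G(x, x)))` at `1 / ℓ`, and the paths that avoid `x` account for
`exp (-t / G(x, x))` of it. -/
theorem measure_localTime_le (hV : (latticeDomain D n).Nonempty) {t : ℝ} (ht : 0 ≤ t)
    (x : {x // x ∈ latticeDomain D n}) {l : ℝ} (hl : 0 < l) :
    (walkLaw D n).real {ω | IsVisited ω t (some x) ∧ localTime ω t (some x) ≤ l} ≤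
      Real.exp 1 * (Real.exp (-(t / (l + green (latticeDomain D n) x.1 x.1))) -
        Real.exp (-(t / green (latticeDomain D n) x.1 x.1))) := by
  classical
  set G := green (latticeDomain D n) x.1 x.1 with hG
  have hG0 : 0 < G := green_self_pos x.2
  -- The supersolution for the weight `exp (-L / l)` is `1 - G(·, x) / (l + G(x, x))`.
  set c : ℤ × ℤ → ℝ := fun y => if y = x.1 then -(1 / l) else 0 with hc
  have hpos : ∀ y, 0 ≤ avoidFun (latticeDomain D n) {x.1} (1 / (l + G)) y := by
    refine avoidFun_nonneg fun y hy => ?_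
    rw [Finset.mem_singleton.1 hy, avoidFun, Finset.sum_singleton, ← hG, sub_nonneg, one_div,
      inv_mul_le_iff₀ (by linarith)]
    linarith
  have hint := lintegral_tiltTotal_le hV (F := ∅) (c := c) hpos
    (fun y hy => avoidFun_of_notMem hy) (fun y hy => Or.inr (by
      rw [lap_avoidFun hy]
      by_cases hyx : y = x.1
      · refine ⟨by
          simp only [hc, hyx, if_true]
          have := innerRate_pos
          have := one_div_pos.2 hl
          linarith, ?_⟩
        simp only [hc, hyx, if_true, avoidFun, Finset.sum_singleton, Finset.mem_singleton]
        rw [← hG]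
        have : l + G ≠ 0 := by positivity
        refine le_of_eq ?_
        field_simp; ring
      · simp [hc, hyx, innerRate_pos])) ht
  rw [chargeRate_avoidFun (by simp), Finset.card_singleton, Nat.cast_one, mul_one] at hint
  set E := {ω : Sample D n | IsVisited ω t (some x) ∧
    ENNReal.ofReal (Real.exp (-1)) ≤ tiltTotal ∅ c t ω} with hE
  set N := {ω : Sample D n | ¬IsVisited ω t (some x)} with hN
  have hNm : MeasurableSet N := (measurableSet_isVisited t _).compl
  have hEm : MeasurableSet E := (measurableSet_isVisited t _).inter
    (measurableSet_le measurable_const (measurable_tiltTotal _ _ _))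
  have h1 : walkLaw D n {ω | IsVisited ω t (some x) ∧ localTime ω t (some x) ≤ l} ≤
      walkLaw D n E := by
    refine measure_mono_ae ?_
    filter_upwards [ae_isRegular hV] with ω hω hmem
    refine ⟨hmem.1, ?_⟩
    rw [hω.tiltTotal_single hV ht (isAvoided_empty ω t)]
    refine ENNReal.ofReal_le_ofReal (Real.exp_le_exp.2 ?_)
    have := mul_le_mul_of_nonneg_left hmem.2 (one_div_pos.2 hl).le
    rw [one_div_mul_cancel hl.ne'] at this
    linarith
  -- The weight is at least `exp (-1)` on `E`, and one if `x` is not visited.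
  have h2 : ENNReal.ofReal (Real.exp (-1)) * walkLaw D n E + walkLaw D n N ≤
      ∫⁻ ω, tiltTotal ∅ c t ω ∂walkLaw D n := by
    rw [← lintegral_indicator_const hEm, ← lintegral_indicator_one hNm,
      ← lintegral_add_right _ (measurable_one.indicator hNm)]
    refine lintegral_mono_ae ?_
    filter_upwards [ae_isRegular hV] with ω hω
    by_cases hv : IsVisited ω t (some x)
    · have hn : ω ∉ N := fun h => h hv
      rw [Set.indicator_of_notMem hn, add_zero]
      by_cases he : ω ∈ E
      · rw [Set.indicator_of_mem he]; exact he.2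
      · rw [Set.indicator_of_notMem he]; exact zero_le
    · have he : ω ∉ E := fun h => hv h.1
      have hn : ω ∈ N := hv
      rw [Set.indicator_of_notMem he, Set.indicator_of_mem hn, zero_add,
        hω.tiltTotal_single hV ht (isAvoided_empty ω t), Pi.one_apply]
      obtain ⟨k, k1, k2, hk⟩ := hω.exists_boundaryTime ht
      have h0 : localTime ω t (some x) = 0 := by
        rw [hω.localTime_eq hV k1 k2 hk, occupationTime]
        refine Finset.sum_eq_zero fun i hi => if_neg fun hz => hv ?_
        exact (hω.isVisited_iff k1 k2 hk x).2 ⟨i, Finset.mem_range.1 hi, hz⟩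
      rw [h0]; simp
  have h3 := h2.trans hint
  have h4 := le_measure_not_isVisited hV ht x.2
  rw [← ofReal_measureReal (measure_ne_top _ _), ← ofReal_measureReal (s := N) (measure_ne_top _ _),
    ← ENNReal.ofReal_mul (Real.exp_pos _).le, ← ENNReal.ofReal_add (by positivity) (by positivity),
    ENNReal.ofReal_le_ofReal_iff (Real.exp_pos _).le] at h3
  have h5 : Real.exp (-(t / G)) ≤ (walkLaw D n).real N :=
    (ENNReal.ofReal_le_iff_le_toReal (measure_ne_top _ _)).1 h4
  have h6 : (walkLaw D n).real {ω | IsVisited ω t (some x) ∧ localTime ω t (some x) ≤ l} ≤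
      (walkLaw D n).real E := ENNReal.toReal_mono (measure_ne_top _ _) h1
  refine h6.trans ?_
  have h7 : (walkLaw D n).real E = Real.exp 1 * (Real.exp (-1) * (walkLaw D n).real E) := by
    rw [← mul_assoc, ← Real.exp_add]; simp
  rw [h7]
  refine mul_le_mul_of_nonneg_left ?_ (Real.exp_pos _).le
  have h8 : 1 / (l + G) * t = t / (l + G) := by ring
  rw [h8] at h3
  linarith

/-- A vertex with a long local time is unlikely to have an unvisited neighbour: `Δ` bounds the
resistance between the two vertices up to a constant. -/
theorem measure_lt_localTime_le (hV : (latticeDomain D n).Nonempty) {t : ℝ} (ht : 0 ≤ t)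
    (x y : {x // x ∈ latticeDomain D n}) (hxy : x ≠ y) {Δ : ℝ} (hΔ : 1 ≤ Δ)
    (hx : green (latticeDomain D n) x.1 x.1 - green (latticeDomain D n) y.1 x.1 ≤ Δ)
    (hy : green (latticeDomain D n) y.1 y.1 - green (latticeDomain D n) x.1 y.1 ≤ Δ) (l : ℝ) :
    (walkLaw D n).real {ω | l ≤ localTime ω t (some x) ∧ ¬IsVisited ω t (some y)} ≤
      Real.exp (-(l / (2 * Δ))) := by
  classical
  set G := green (latticeDomain D n) with hG
  have hΔ0 : 0 < Δ := by linarith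
  set c : ℤ × ℤ → ℝ := fun z => if z = x.1 then 1 / (2 * Δ) else 0 with hc
  -- This `u` is a supersolution for the weight `exp (L / (2 Δ))` of the paths that avoid `y`. As
  -- its Laplacian has total mass zero, the bound does not depend on `t`.
  set u : ℤ × ℤ → ℝ := fun z => 1 + 1 / Δ * (G x.1 z - G y.1 z) with hu
  have hne : x.1 ≠ y.1 := fun h => hxy (Subtype.ext h)
  have hlap : ∀ z ∈ (latticeDomain D n), lap u z =
      1 / Δ * ((if z = y.1 then 1 else 0) - if z = x.1 then 1 else 0) := by
    intro z hz
    rw [hu, lap_add (fun _ => 1), lap_const_mul (1 / Δ) (fun z => G x.1 z - G y.1 z),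
      lap_sub (G x.1) (G y.1), lap_const, lap_green _ hz, lap_green _ hz]
    ring
  have hb : ∀ z, z ∉ (latticeDomain D n) → u z = 1 := fun z hz => by
    simp [hu, hG, green_of_notMem _ hz]
  have hpos : ∀ z, 0 ≤ u z := by
    intro z
    by_cases hz : z ∈ (latticeDomain D n)
    · refine min_principle (V := latticeDomain D n) (fun z hz => ?_)
        (fun _ _ z _ h => ?_) z hz
      · by_cases hzy : z = y.1
        · left
          rw [hu, hzy]
          have : 1 / Δ * (G y.1 y.1 - G x.1 y.1) ≤ 1 / Δ * Δ := by gcongr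
          rw [one_div_mul_cancel hΔ0.ne'] at this
          simp only; linarith
        · right
          rw [hlap z hz, if_neg hzy, zero_sub, mul_neg, neg_nonpos]
          positivity
      · rw [hb z h]; exact zero_le_one
    · rw [hb z hz]; exact zero_le_one
  have hch : chargeRate (latticeDomain D n) u = 0 := by
    rw [chargeRate, Finset.sum_congr rfl hlap, ← Finset.mul_sum, Finset.sum_sub_distrib,
      Finset.sum_ite_eq', Finset.sum_ite_eq', if_pos y.2, if_pos x.2]
    simp
  have hint := lintegral_tiltTotal_le hV (F := {y.1}) (c := c) hpos hb (fun z hz => by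
    by_cases hzy : z = y.1
    · left; simp [hzy]
    · right
      rw [hlap z hz, if_neg hzy]
      by_cases hzx : z = x.1
      · have h1 : 1 / Δ * (G x.1 x.1 - G y.1 x.1) ≤ 1 / Δ * Δ := by gcongr
        rw [one_div_mul_cancel hΔ0.ne'] at h1
        simp only [hc, hu, hzx, if_true]
        constructor
        · have h2 : 1 / (2 * Δ) ≤ 1 / 2 := by
            apply one_div_le_one_div_of_le <;> linarith
          have h3 : (1 : ℝ) / 2 < innerRate := by
            unfold innerRate
            rw [div_lt_div_iff₀ (by norm_num) two_pi_pos]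
            have := Real.pi_lt_four
            linarith
          linarith
        · have h2 : 1 / (2 * Δ) * (1 + 1 / Δ * (G x.1 x.1 - G y.1 x.1)) ≤
              1 / (2 * Δ) * 2 := by
            have : 0 ≤ 1 / (2 * Δ) := by positivity
            exact mul_le_mul_of_nonneg_left (by linarith) this
          have h3 : 1 / (2 * Δ) * 2 = 1 / Δ := by field_simp
          linarith
      · simp [hc, hzx, innerRate_pos]) ht
  rw [hch, zero_mul, neg_zero, Real.exp_zero, ENNReal.ofReal_one] at hint
  have h1 : walkLaw D n {ω | l ≤ localTime ω t (some x) ∧ ¬IsVisited ω t (some y)} ≤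
      walkLaw D n {ω | ENNReal.ofReal (Real.exp (l / (2 * Δ))) ≤ tiltTotal {y.1} c t ω} := by
    refine measure_mono_ae ?_
    filter_upwards [ae_isRegular hV] with ω hω hmem
    have hav : IsAvoided ω t {y.1} := (isAvoided_singleton y.2).2 hmem.2
    change _ ≤ tiltTotal {y.1} c t ω
    rw [hω.tiltTotal_single hV ht hav]
    refine ENNReal.ofReal_le_ofReal (Real.exp_le_exp.2 ?_)
    have h0 : 0 ≤ 1 / (2 * Δ) := by positivity
    have := mul_le_mul_of_nonneg_left hmem.1 h0
    rwa [one_div_mul_eq_div] at this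
  have h2 := (mul_meas_ge_le_lintegral₀ (measurable_tiltTotal {y.1} c t).aemeasurable
    (ENNReal.ofReal (Real.exp (l / (2 * Δ)))) (μ := walkLaw D n)).trans hint
  have h3 := (mul_le_mul_right h1 (ENNReal.ofReal (Real.exp (l / (2 * Δ))))).trans h2
  rw [← ofReal_measureReal (measure_ne_top _ _), ← ENNReal.ofReal_mul (Real.exp_pos _).le,
    ENNReal.ofReal_le_one] at h3
  rw [Real.exp_neg, ← one_div, le_div_iff₀ (Real.exp_pos _)]
  linarith

/-- Once a vertex is visited, the vertices around it are visited too, up to a small probability. -/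
theorem measure_visited_not_covered_le (hV : (latticeDomain D n).Nonempty) {t : ℝ} (ht : 0 ≤ t)
    (x : {x // x ∈ latticeDomain D n}) {B : Finset (ℤ × ℤ)} {Δ l : ℝ} (hΔ : 1 ≤ Δ) (hl : 0 < l)
    (hB : ∀ y ∈ B, y ∈ latticeDomain D n →
      green (latticeDomain D n) x.1 x.1 - green (latticeDomain D n) y x.1 ≤ Δ ∧
      green (latticeDomain D n) y y - green (latticeDomain D n) x.1 y ≤ Δ) :
    (walkLaw D n).real {ω | IsVisited ω t (some x) ∧ ¬IsCovered ω t B} ≤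
      Real.exp 1 * (Real.exp (-(t / (l + green (latticeDomain D n) x.1 x.1))) -
        Real.exp (-(t / green (latticeDomain D n) x.1 x.1))) +
      B.card * Real.exp (-(l / (2 * Δ))) := by
  classical
  set P : ℤ × ℤ → Set (Sample D n) := fun y =>
    {ω | ∃ h : y ∈ latticeDomain D n, x ≠ ⟨y, h⟩ ∧ l ≤ localTime ω t (some x) ∧
      ¬IsVisited ω t (some ⟨y, h⟩)} with hP
  have hsub : {ω : Sample D n | IsVisited ω t (some x) ∧ ¬IsCovered ω t B} ⊆
      {ω | IsVisited ω t (some x) ∧ localTime ω t (some x) ≤ l} ∪ ⋃ y ∈ B, P y := by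
    rintro ω ⟨h1, h2⟩
    by_cases hle : localTime ω t (some x) ≤ l
    · exact Or.inl ⟨h1, hle⟩
    · right
      simp only [IsCovered, not_forall] at h2
      obtain ⟨y, hyB, hy⟩ := h2
      refine Set.mem_biUnion hyB ⟨y.2, ?_, (not_le.1 hle).le, hy⟩
      rintro rfl
      exact hy h1
  refine (measureReal_mono hsub).trans ((measureReal_union_le _ _).trans
    (add_le_add (measure_localTime_le hV ht x hl) ?_))
  refine (measureReal_biUnion_finset_le B P).trans ?_
  rw [← nsmul_eq_mul]
  refine Finset.sum_le_card_nsmul _ _ _ fun y hy => ?_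
  by_cases h : ∃ h : y ∈ latticeDomain D n, x ≠ ⟨y, h⟩
  · obtain ⟨hyV, hxy⟩ := h
    refine le_trans (measureReal_mono ?_)
      (measure_lt_localTime_le hV ht x ⟨y, hyV⟩ hxy hΔ (hB y hy hyV).1 (hB y hy hyV).2 l)
    rintro ω ⟨_, _, h1, h2⟩
    exact ⟨h1, h2⟩
  · have : P y = ∅ := by
      ext ω
      simp only [hP, Set.mem_ofPred_eq, Set.mem_empty_iff_false, iff_false]
      rintro ⟨h1, h2, -⟩
      exact h ⟨h1, h2⟩
    rw [this, measureReal_empty]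
    exact (Real.exp_pos _).le

/-- The expected exit time of a finite set grows at most like the square of its radius, by
comparison with a quadratic function with Laplacian `-1`. -/
theorem exists_exitTime {V : Finset (ℤ × ℤ)} {R : ℝ}
    (hR : ∀ x ∈ V, ∀ y ∈ neighbors x, (y.1 : ℝ) ^ 2 + (y.2 : ℝ) ^ 2 ≤ R) :
    ∃ g : ℤ × ℤ → ℝ, (∀ y, y ∉ V → g y = 0) ∧ (∀ y ∈ V, lap g y = -1) ∧
      ∀ y ∈ V, 0 ≤ g y ∧ g y ≤ Real.pi / 2 * R := by
  obtain ⟨g, hg0, hg1⟩ := exists_poisson V fun _ => 1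
  have hlap : ∀ y ∈ V, lap g y = -1 := fun y hy => by linarith [hg1 y hy]
  refine ⟨g, hg0, hlap, fun y hy => ⟨?_, ?_⟩⟩
  · exact min_principle (fun z hz => Or.inr (by rw [hlap z hz]; norm_num))
      (fun _ _ z _ hz => (hg0 z hz).ge) y hy
  · set f : ℤ × ℤ → ℝ := fun z => Real.pi / 2 * (R - ((z.1 : ℝ) ^ 2 + (z.2 : ℝ) ^ 2)) - g z with hf
    have h : 0 ≤ f y := by
      refine min_principle (V := V) (fun z hz => Or.inr ?_) (fun z hz w hw hwV => ?_) y hy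
      · rw [hf, lap_sub (fun z => Real.pi / 2 * (R - ((z.1 : ℝ) ^ 2 + (z.2 : ℝ) ^ 2))) g, hlap z hz]
        simp only [lap, sum_neighbors]
        push_cast
        have hp := Real.pi_pos
        refine le_of_eq ?_
        field_simp
        ring
      · rw [hf]
        simp only [hg0 w hwV, sub_zero]
        exact mul_nonneg (by positivity) (sub_nonneg.2 (hR z hz w hw))
    have h0 : 0 ≤ Real.pi / 2 * ((y.1 : ℝ) ^ 2 + (y.2 : ℝ) ^ 2) := by positivity
    simp only [hf] at h
    linarith

/-- Upper deviations of the real time at boundary time `t`, from the exponential moment of the time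
spent off `∂`. A multiple of the expected exit time, plus one, is a supersolution. -/
theorem measure_le_realTime (hV : (latticeDomain D n).Nonempty) {t : ℝ} (ht : 0 ≤ t) {R θ : ℝ}
    (hR : ∀ x ∈ latticeDomain D n, ∀ y ∈ neighbors x, (y.1 : ℝ) ^ 2 + (y.2 : ℝ) ^ 2 ≤ R)
    (hR0 : 0 ≤ R) (hθ : 0 ≤ θ) (hθ1 : θ < innerRate) (hθR : Real.pi * R * θ ≤ 1) (a : ℝ) :
    (walkLaw D n).real {ω | a ≤ realTime ω t - t} ≤
      Real.exp (-(θ * a) + θ * (1 + Real.pi * R * θ) * ((latticeDomain D n).card * t)) := by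
  set V := latticeDomain D n with hVdef
  obtain ⟨g, hg0, hg1, hg2⟩ := exists_exitTime hR
  have hp := Real.pi_pos
  set θ' := θ * (1 + Real.pi * R * θ) with hθ'
  have hθ'0 : 0 ≤ θ' := by positivity
  set u : ℤ × ℤ → ℝ := fun z => 1 + θ' * g z with hu
  have hlap : ∀ z ∈ V, lap u z = -θ' := fun z hz => by
    rw [hu, lap_add (fun _ => 1), lap_const_mul, lap_const, hg1 z hz]; ring
  have hgn : ∀ z, 0 ≤ g z := fun z => by
    by_cases hz : z ∈ V
    · exact (hg2 z hz).1
    · exact (hg0 z hz).ge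
  have hint := lintegral_tiltTotal_le hV (F := ∅) (c := fun _ => θ) (u := u)
    (fun z => add_nonneg zero_le_one (mul_nonneg hθ'0 (hgn z)))
    (fun z hz => by simp [hu, hg0 z hz])
    (fun z hz => Or.inr ⟨hθ1, by
      rw [hlap z hz, neg_le_neg_iff]
      have h1 : θ' * g z ≤ 2 * θ * (Real.pi / 2 * R) := by
        have : θ' ≤ 2 * θ := by rw [hθ']; nlinarith
        exact mul_le_mul this (hg2 z hz).2 (hgn z) (by linarith)
      rw [hu, hθ']
      exact mul_le_mul_of_nonneg_left (by linarith) hθ⟩) ht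
  have hch : chargeRate V u = -(V.card * θ') := by
    rw [chargeRate, Finset.sum_congr rfl hlap, Finset.sum_const, nsmul_eq_mul, mul_neg]
  rw [hch] at hint
  have h1 : walkLaw D n {ω | a ≤ realTime ω t - t} ≤
      walkLaw D n {ω | ENNReal.ofReal (Real.exp (θ * a)) ≤ tiltTotal ∅ (fun _ => θ) t ω} := by
    refine measure_mono_ae ?_
    filter_upwards [ae_isRegular hV] with ω hω hmem
    change _ ≤ tiltTotal ∅ (fun _ => θ) t ω
    rw [hω.tiltTotal_const hV ht]
    exact ENNReal.ofReal_le_ofReal (Real.exp_le_exp.2 (mul_le_mul_of_nonneg_left hmem hθ))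
  have h3 := (mul_le_mul_right h1 (ENNReal.ofReal (Real.exp (θ * a)))).trans
    ((mul_meas_ge_le_lintegral₀ (measurable_tiltTotal ∅ (fun _ => θ) t).aemeasurable _).trans hint)
  rw [← ofReal_measureReal (measure_ne_top _ _), ← ENNReal.ofReal_mul (Real.exp_pos _).le,
    ENNReal.ofReal_le_ofReal_iff (Real.exp_pos _).le] at h3
  rw [Real.exp_add, Real.exp_neg, ← div_eq_inv_mul, le_div_iff₀ (Real.exp_pos _), mul_comm]
  refine h3.trans (le_of_eq ?_)
  congr 1; ring

/-- Lower deviations of the real time at boundary time `t`, from the Laplace transform of the time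
spent off `∂`. -/
theorem measure_realTime_le (hV : (latticeDomain D n).Nonempty) {t : ℝ} (ht : 0 ≤ t) {R θ : ℝ}
    (hR : ∀ x ∈ latticeDomain D n, ∀ y ∈ neighbors x, (y.1 : ℝ) ^ 2 + (y.2 : ℝ) ^ 2 ≤ R)
    (hR0 : 0 ≤ R) (hθ : 0 ≤ θ) (hθR : Real.pi * R * θ ≤ 1) (b : ℝ) :
    (walkLaw D n).real {ω | realTime ω t - t ≤ b} ≤
      Real.exp (θ * b - θ * (1 - Real.pi * R * θ) * ((latticeDomain D n).card * t)) := by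
  set V := latticeDomain D n with hVdef
  obtain ⟨g, hg0, hg1, hg2⟩ := exists_exitTime hR
  have hp := Real.pi_pos
  set θ' := θ * (1 - Real.pi * R * θ) with hθ'
  have hθ'0 : 0 ≤ θ' := mul_nonneg hθ (by linarith)
  set u : ℤ × ℤ → ℝ := fun z => 1 - θ' * g z with hu
  have hlap : ∀ z ∈ V, lap u z = θ' := fun z hz => by
    rw [hu, lap_sub (fun _ => 1), lap_const_mul, lap_const, hg1 z hz]; ring
  have hgn : ∀ z, 0 ≤ g z := fun z => by
    by_cases hz : z ∈ V
    · exact (hg2 z hz).1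
    · exact (hg0 z hz).ge
  have hθg : ∀ z ∈ V, θ' * g z ≤ Real.pi * R * θ := by
    intro z hz
    have h1 : θ' * g z ≤ θ * (Real.pi / 2 * R) := by
      have : θ' ≤ θ := by
        rw [hθ']
        have : 0 ≤ Real.pi * R * θ := by positivity
        exact mul_le_of_le_one_right hθ (by linarith)
      exact mul_le_mul this (hg2 z hz).2 (hgn z) hθ
    have : 0 ≤ θ * (Real.pi / 2 * R) := by positivity
    linarith
  have hint := lintegral_tiltTotal_le hV (F := ∅) (c := fun _ => -θ) (u := u)
    (fun z => by
      by_cases hz : z ∈ V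
      · have := hθg z hz
        simp only [hu]; linarith
      · simp [hu, hg0 z hz])
    (fun z hz => by simp [hu, hg0 z hz])
    (fun z hz => Or.inr ⟨by linarith [innerRate_pos], by
      rw [hlap z hz, neg_mul, neg_neg, hu, hθ']
      exact mul_le_mul_of_nonneg_left (by linarith [hθg z hz]) hθ⟩) ht
  have hch : chargeRate V u = V.card * θ' := by
    rw [chargeRate, Finset.sum_congr rfl hlap, Finset.sum_const, nsmul_eq_mul]
  rw [hch] at hint
  have h1 : walkLaw D n {ω | realTime ω t - t ≤ b} ≤
      walkLaw D n {ω | ENNReal.ofReal (Real.exp (-(θ * b))) ≤ tiltTotal ∅ (fun _ => -θ) t ω} := by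
    refine measure_mono_ae ?_
    filter_upwards [ae_isRegular hV] with ω hω hmem
    change _ ≤ tiltTotal ∅ (fun _ => -θ) t ω
    rw [hω.tiltTotal_const hV ht]
    refine ENNReal.ofReal_le_ofReal (Real.exp_le_exp.2 ?_)
    have := mul_le_mul_of_nonneg_left hmem hθ
    linarith
  have h3 := (mul_le_mul_right h1 (ENNReal.ofReal (Real.exp (-(θ * b))))).trans
    ((mul_meas_ge_le_lintegral₀ (measurable_tiltTotal ∅ (fun _ => -θ) t).aemeasurable _).trans hint)
  rw [← ofReal_measureReal (measure_ne_top _ _), ← ENNReal.ofReal_mul (Real.exp_pos _).le,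
    ENNReal.ofReal_le_ofReal_iff (Real.exp_pos _).le, Real.exp_neg,
    inv_mul_le_iff₀ (Real.exp_pos _), ← Real.exp_add] at h3
  refine h3.trans (le_of_eq ?_)
  congr 1; ring

/-! ### Geometry and Green function of the lattice domain -/

theorem norm_toPlane_sq (x : ℤ × ℤ) : ‖toPlane x‖ ^ 2 = (x.1 : ℝ) ^ 2 + (x.2 : ℝ) ^ 2 := by
  rw [EuclideanSpace.norm_sq_eq, Fin.sum_univ_two]
  simp [toPlane]

theorem toPlane_sub (x y : ℤ × ℤ) : toPlane (x - y) = toPlane x - toPlane y := by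
  ext i; fin_cases i <;> simp [toPlane]

theorem eDist_eq_norm (x y : ℤ × ℤ) : eDist x y = ‖toPlane (x - y)‖ := by
  rw [toPlane_sub, eDist]

theorem eDist_sq (x y : ℤ × ℤ) :
    eDist x y ^ 2 = ((x.1 : ℝ) - y.1) ^ 2 + ((x.2 : ℝ) - y.2) ^ 2 := by
  rw [eDist_eq_norm, norm_toPlane_sq]; simp

theorem eDist_nonneg (x y : ℤ × ℤ) : 0 ≤ eDist x y := norm_nonneg _

theorem eDist_self (x : ℤ × ℤ) : eDist x x = 0 := by simp [eDist]

theorem eDist_comm (x y : ℤ × ℤ) : eDist x y = eDist y x := norm_sub_rev _ _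

theorem eDist_triangle (x y z : ℤ × ℤ) : eDist x z ≤ eDist x y + eDist y z :=
  norm_sub_le_norm_sub_add_norm_sub _ _ _

theorem one_le_eDist {x y : ℤ × ℤ} (h : x ≠ y) : 1 ≤ eDist x y := by
  rw [← one_le_sq_iff₀ (eDist_nonneg x y), eDist_sq]
  have h1 : 1 ≤ (x.1 - y.1) ^ 2 + (x.2 - y.2) ^ 2 := by
    by_cases h1 : x.1 = y.1
    · have h2 : x.2 - y.2 ≠ 0 := fun h2 => h (Prod.ext h1 (by omega))
      have := (sq_pos_iff (a := x.2 - y.2)).2 h2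
      nlinarith [sq_nonneg (x.1 - y.1)]
    · have h2 : x.1 - y.1 ≠ 0 := fun h2 => h1 (by omega)
      have := (sq_pos_iff (a := x.1 - y.1)).2 h2
      nlinarith [sq_nonneg (x.2 - y.2)]
  exact_mod_cast h1

theorem logKernel_sub (x y : ℤ × ℤ) : logKernel (x - y) = Real.log (eDist x y) := by
  rw [eDist_eq_norm, logKernel, ← norm_toPlane_sq, Real.log_pow]; push_cast; ring

theorem eDist_of_mem_neighbors {x y : ℤ × ℤ} (h : y ∈ neighbors x) : eDist y x = 1 := by
  have h1 : eDist y x ^ 2 = 1 := by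
    rw [eDist_sq]
    rcases mem_neighbors.1 h with h | h | h | h <;> subst h <;> simp
  exact (pow_eq_one_iff_of_nonneg (eDist_nonneg y x) two_ne_zero).1 h1

theorem mem_latticeDomain {x : ℤ × ℤ} : x ∈ latticeDomain D n ↔
    Real.exp (-n) < Metric.infDist (Real.exp (-n) • toPlane x) D.carrierᶜ := by
  rw [latticeDomain, Set.Finite.mem_toFinset]; rfl

theorem smul_toPlane_mem {x : ℤ × ℤ} (hx : x ∈ latticeDomain D n) :
    Real.exp (-n) • toPlane x ∈ D.carrier := by
  by_contra hc
  have h1 := mem_latticeDomain.1 hx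
  rw [Metric.infDist_zero_of_mem hc] at h1
  exact absurd h1 (not_lt.2 (Real.exp_pos _).le)

theorem exists_norm_le (D : PlanarDomain) : ∃ R : ℝ, 0 < R ∧ ∀ n : ℝ, ∀ x ∈ latticeDomain D n,
    ‖toPlane x‖ ≤ R * Real.exp n := by
  obtain ⟨R, hR⟩ := D.isBounded.exists_norm_le
  refine ⟨max R 1, by positivity, fun n x hx => ?_⟩
  have h := (hR _ (smul_toPlane_mem hx)).trans (le_max_left R 1)
  rw [norm_smul, Real.norm_eq_abs, abs_of_pos (Real.exp_pos _), Real.exp_neg,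
    inv_mul_le_iff₀ (Real.exp_pos n)] at h
  rwa [mul_comm]

theorem exists_sq_le (D : PlanarDomain) : ∃ R : ℝ, 0 < R ∧ ∀ n : ℝ, 0 ≤ n →
    ∀ x ∈ latticeDomain D n, ∀ y ∈ neighbors x,
      (y.1 : ℝ) ^ 2 + (y.2 : ℝ) ^ 2 ≤ R * Real.exp (2 * n) := by
  obtain ⟨R, hR, h⟩ := exists_norm_le D
  refine ⟨(R + 1) ^ 2, by positivity, fun n hn x hx y hy => ?_⟩
  have h1 : ‖toPlane y‖ ≤ (R + 1) * Real.exp n := by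
    have h2 : ‖toPlane y‖ ≤ ‖toPlane x‖ + eDist y x := by
      have := norm_add_le (toPlane x) (toPlane y - toPlane x)
      rwa [add_sub_cancel] at this
    rw [eDist_of_mem_neighbors hy] at h2
    have := h n x hx
    have := Real.one_le_exp hn
    linarith
  rw [← norm_toPlane_sq, two_mul, Real.exp_add, ← sq (Real.exp n), ← mul_pow]
  exact pow_le_pow_left₀ (norm_nonneg _) h1 2

theorem lt_eDist_of_mem_bulk {x y : ℤ × ℤ} (hx : x ∈ bulk D n) (hy : y ∉ latticeDomain D n) :
    Real.exp (n - 2 * Real.log n) < eDist x y := by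
  have h := Metric.infDist_le_dist_of_mem (x := toPlane x)
    (Set.mem_image_of_mem toPlane (show y ∈ {y | y ∉ latticeDomain D n} from hy))
  rw [dist_eq_norm] at h
  exact lt_of_lt_of_le hx h

theorem mem_of_mem_bulk {x : ℤ × ℤ} (hx : x ∈ bulk D n) : x ∈ latticeDomain D n := by
  by_contra h
  have := lt_eDist_of_mem_bulk hx h
  rw [eDist_self] at this
  exact absurd this (not_lt.2 (Real.exp_pos _).le)

/-- The Green function of the lattice domain is `n - log ‖x - y‖`, up to a bounded error from above,
and in the bulk up to an error `2 log n` from below. On the diagonal, where `Real.log 0 = 0`, the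
bounds are those for `n` itself. -/
theorem exists_green_latticeDomain_bounds (D : PlanarDomain) : ∃ c : ℝ, 0 ≤ c ∧
    (∀ n : ℝ, 0 ≤ n → ∀ x ∈ latticeDomain D n, ∀ y ∈ latticeDomain D n,
      green (latticeDomain D n) x y ≤ n - Real.log (eDist x y) + c) ∧
    (∀ n : ℝ, ∀ x ∈ bulk D n, ∀ y ∈ latticeDomain D n,
      n - 2 * Real.log n - Real.log (eDist x y) - c ≤ green (latticeDomain D n) x y) := by
  obtain ⟨c, hc, hg⟩ := exists_green_bounds
  obtain ⟨R, hR, hRn⟩ := exists_norm_le D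
  have hl : 0 ≤ Real.log (2 * R + 1) := Real.log_nonneg (by linarith)
  refine ⟨c + Real.log (2 * R + 1), by linarith, fun n hn x hx y hy => ?_, fun n x hx y hy => ?_⟩
  · have h := (hg (latticeDomain D n) x y hx hy 0 (n + Real.log (2 * R + 1))).2 ?_
    · rw [logKernel_sub, eDist_comm] at h; linarith
    · intro z hz w hw hwV
      rw [logKernel_sub]
      have hwx : w ≠ x := fun h => hwV (h ▸ hx)
      have h1 := one_le_eDist hwx
      have h2 : eDist w x ≤ (2 * R + 1) * Real.exp n := by
        have e1 := eDist_triangle w z x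
        rw [eDist_of_mem_neighbors hw] at e1
        have e2 : eDist z x ≤ ‖toPlane z‖ + ‖toPlane x‖ := norm_sub_le _ _
        have e3 := hRn n z hz
        have e4 := hRn n x hx
        have e5 := Real.one_le_exp hn
        linarith
      refine (Real.log_le_log (by linarith) h2).trans ?_
      rw [Real.log_mul (by positivity) (Real.exp_pos n).ne', Real.log_exp]; linarith
  · have h := (hg (latticeDomain D n) x y (mem_of_mem_bulk hx) hy (n - 2 * Real.log n) 0).1 ?_
    · rw [logKernel_sub, eDist_comm] at h; linarith
    · intro z hz w hw hwV
      rw [logKernel_sub, eDist_comm]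
      have h1 := lt_eDist_of_mem_bulk hx hwV
      rw [Real.le_log_iff_exp_le ((Real.exp_pos _).trans h1)]
      exact h1.le

/-- The lattice domain contains the lattice points of a square of side proportional to `exp n`. -/
theorem exists_le_card (D : PlanarDomain) : ∃ c : ℝ, 0 < c ∧ ∀ᶠ n in atTop,
    c * Real.exp (2 * n) ≤ (latticeDomain D n).card := by
  obtain ⟨p, hp⟩ := D.isSimplyConnected.nonempty
  obtain ⟨δ, hδ, hball⟩ := Metric.isOpen_iff.1 D.isOpen p hp
  have hne : D.carrierᶜ.Nonempty := by
    by_contra h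
    rw [Set.not_nonempty_iff_eq_empty, Set.compl_empty_iff] at h
    exact NormedSpace.unbounded_univ ℝ Plane (h ▸ D.isBounded)
  refine ⟨(δ / 4) ^ 2, by positivity, ?_⟩
  have h1 : ∀ᶠ n in atTop, 4 / δ < Real.exp n :=
    Real.tendsto_exp_atTop.eventually_gt_atTop (4 / δ)
  filter_upwards [h1] with n hn
  have hE := Real.exp_pos n
  have hn' : 4 < δ * Real.exp n := by rwa [div_lt_iff₀' hδ] at hn
  set I : Fin 2 → Finset ℤ := fun i =>
    Finset.Icc ⌈Real.exp n * p i - δ / 4 * Real.exp n⌉ ⌊Real.exp n * p i + δ / 4 * Real.exp n⌋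
    with hI
  have hcard : ∀ i, δ / 4 * Real.exp n ≤ (I i).card := by
    intro i
    rw [hI]
    simp only [Int.card_Icc]
    have e1 := Int.lt_floor_add_one (Real.exp n * p i + δ / 4 * Real.exp n)
    have e2 := Int.ceil_lt_add_one (Real.exp n * p i - δ / 4 * Real.exp n)
    have e3 : ((⌊Real.exp n * p i + δ / 4 * Real.exp n⌋ + 1 -
        ⌈Real.exp n * p i - δ / 4 * Real.exp n⌉ : ℤ) : ℝ) ≤
        (((⌊Real.exp n * p i + δ / 4 * Real.exp n⌋ + 1 -
          ⌈Real.exp n * p i - δ / 4 * Real.exp n⌉).toNat : ℤ) : ℝ) :=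
      Int.cast_le.2 (Int.self_le_toNat _)
    rw [Int.cast_natCast] at e3
    push_cast at e3
    linarith
  have hsub : I 0 ×ˢ I 1 ⊆ latticeDomain D n := by
    intro x hx
    rw [mem_latticeDomain]
    have hlow : δ / 2 ≤ Metric.infDist (Real.exp (-n) • toPlane x) D.carrierᶜ := by
      rw [Metric.le_infDist hne]
      intro y hy
      have hy' : δ ≤ dist y p := by
        by_contra! h
        exact hy (hball h)
      have hxp : dist (Real.exp (-n) • toPlane x) p ≤ δ / 2 := by
        have e1 : Real.exp (-n) • toPlane x - p =
            Real.exp (-n) • (toPlane x - Real.exp n • p) := by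
          rw [smul_sub, smul_smul, ← Real.exp_add, neg_add_cancel, Real.exp_zero, one_smul]
        rw [dist_eq_norm, e1, norm_smul, Real.norm_eq_abs, abs_of_pos (Real.exp_pos _),
          Real.exp_neg, inv_mul_le_iff₀ hE]
        refine abs_le_of_sq_le_sq' ?_ (by positivity) |>.2
        rw [EuclideanSpace.norm_sq_eq, Fin.sum_univ_two]
        rw [Finset.mem_product] at hx
        have e2 : ∀ i, ∀ a ∈ I i, ((a : ℝ) - Real.exp n * p i) ^ 2 ≤ (δ / 4 * Real.exp n) ^ 2 := by
          intro i a ha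
          rw [hI, Finset.mem_Icc, Int.ceil_le, Int.le_floor] at ha
          exact sq_le_sq' (by linarith [ha.1]) (by linarith [ha.2])
        have e3 := e2 0 _ hx.1
        have e4 := e2 1 _ hx.2
        simp only [toPlane, PiLp.sub_apply, PiLp.smul_apply, smul_eq_mul, Real.norm_eq_abs, sq_abs]
        simp only [Fin.isValue, Matrix.cons_val_zero, Matrix.cons_val_one]
        nlinarith [sq_nonneg (δ * Real.exp n)]
      have := dist_triangle y (Real.exp (-n) • toPlane x) p
      rw [dist_comm]
      linarith
    refine lt_of_lt_of_le ?_ hlow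
    rw [Real.exp_neg, inv_lt_iff_one_lt_mul₀ hE]
    linarith
  calc (δ / 4) ^ 2 * Real.exp (2 * n) = (δ / 4 * Real.exp n) * (δ / 4 * Real.exp n) := by
        rw [two_mul, Real.exp_add]; ring
    _ ≤ (I 0).card * (I 1).card := by
        exact mul_le_mul (hcard 0) (hcard 1) (by positivity) (Nat.cast_nonneg _)
    _ = ((I 0 ×ˢ I 1).card : ℝ) := by rw [Finset.card_product]; push_cast; ring
    _ ≤ _ := Nat.cast_le.2 (Finset.card_le_card hsub)

theorem eventually_latticeDomain_nonempty (D : PlanarDomain) :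
    ∀ᶠ n in atTop, (latticeDomain D n).Nonempty := by
  obtain ⟨c, hc, h⟩ := exists_le_card D
  filter_upwards [h] with n hn
  rw [← Finset.card_pos]
  have : (0 : ℝ) < (latticeDomain D n).card := lt_of_lt_of_le (by positivity) hn
  exact_mod_cast this

/-! ### Bonferroni inequalities -/

/-- The elementary symmetric sum of degree `j` of the numbers `p i`, `i ∈ s`. -/
def symmSum {ι : Type*} (s : Finset ι) (p : ι → ℝ) (j : ℕ) : ℝ :=
  ∑ T ∈ s.powersetCard j, ∏ i ∈ T, p i

section symmSum
variable {ι : Type*} {s : Finset ι} {p : ι → ℝ}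

theorem symmSum_zero : symmSum s p 0 = 1 := by simp [symmSum]

theorem symmSum_insert [DecidableEq ι] {a : ι} (ha : a ∉ s) (j : ℕ) :
    symmSum (insert a s) p (j + 1) = symmSum s p (j + 1) + p a * symmSum s p j := by
  have hd : Disjoint (s.powersetCard (j + 1)) ((s.powersetCard j).image (insert a)) := by
    rw [Finset.disjoint_left]
    intro T hT hT'
    obtain ⟨T', -, rfl⟩ := Finset.mem_image.1 hT'
    exact ha ((Finset.mem_powersetCard.1 hT).1 (Finset.mem_insert_self _ _))
  have hn : ∀ T ∈ s.powersetCard j, a ∉ T := fun T hT h =>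
    ha ((Finset.mem_powersetCard.1 hT).1 h)
  rw [symmSum, Finset.powersetCard_succ_insert ha, Finset.sum_union hd, Finset.sum_image,
    symmSum, symmSum, Finset.mul_sum]
  · congr 1
    exact Finset.sum_congr rfl fun T hT => Finset.prod_insert (hn T hT)
  · intro T hT T' hT' h
    rw [← Finset.erase_insert (hn T hT), ← Finset.erase_insert (hn T' hT')]
    exact congrArg (fun U => Finset.erase U a) h

/-- The truncated inclusion-exclusion sums lie alternately above and below the full product. -/
theorem bonferroni (hp : ∀ i ∈ s, 0 ≤ p i ∧ p i ≤ 1) (m : ℕ) :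
    0 ≤ (-1) ^ m * (∏ i ∈ s, (1 - p i) - ∑ j ∈ Finset.range m, (-1) ^ j * symmSum s p j) ∧
      (-1) ^ m * (∏ i ∈ s, (1 - p i) - ∑ j ∈ Finset.range m, (-1) ^ j * symmSum s p j) ≤
        symmSum s p m := by
  classical
  induction s using Finset.induction_on generalizing m with
  | empty =>
    cases m with
    | zero => simp [symmSum_zero]
    | succ m =>
      rw [Finset.sum_range_succ']
      have h : ∀ j, symmSum (∅ : Finset ι) p (j + 1) = 0 := fun j => by
        rw [symmSum, Finset.powersetCard_eq_empty.2 (by simp), Finset.sum_empty]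
      simp [h, symmSum_zero]
  | insert a s ha ih =>
    have ih := ih fun i hi => hp i (Finset.mem_insert_of_mem hi)
    obtain ⟨ha0, ha1⟩ := hp a (Finset.mem_insert_self _ _)
    cases m with
    | zero =>
      obtain ⟨h0, h1⟩ := ih 0
      rw [symmSum_zero] at h1 ⊢
      simp only [pow_zero, Finset.range_zero, Finset.sum_empty, sub_zero, one_mul] at h0 h1 ⊢
      rw [Finset.prod_insert ha]
      exact ⟨mul_nonneg (by linarith) h0, mul_le_one₀ (by linarith) h0 h1⟩
    | succ m =>
      have key : (-1) ^ (m + 1) * (∏ i ∈ insert a s, (1 - p i) -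
            ∑ j ∈ Finset.range (m + 1), (-1) ^ j * symmSum (insert a s) p j) =
          (-1) ^ (m + 1) * (∏ i ∈ s, (1 - p i) -
            ∑ j ∈ Finset.range (m + 1), (-1) ^ j * symmSum s p j) +
          p a * ((-1) ^ m * (∏ i ∈ s, (1 - p i) -
            ∑ j ∈ Finset.range m, (-1) ^ j * symmSum s p j)) := by
        have e1 : ∑ j ∈ Finset.range (m + 1), (-1 : ℝ) ^ j * symmSum (insert a s) p j =
            ∑ j ∈ Finset.range (m + 1), (-1 : ℝ) ^ j * symmSum s p j -
              p a * ∑ j ∈ Finset.range m, (-1 : ℝ) ^ j * symmSum s p j := by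
          rw [Finset.sum_range_succ', Finset.sum_range_succ', symmSum_zero, symmSum_zero,
            Finset.mul_sum, Finset.sum_congr rfl fun j _ => by rw [symmSum_insert ha j, mul_add],
            Finset.sum_add_distrib]
          have e2 : ∑ j ∈ Finset.range m, (-1 : ℝ) ^ (j + 1) * (p a * symmSum s p j) =
              -∑ j ∈ Finset.range m, p a * ((-1) ^ j * symmSum s p j) := by
            rw [← Finset.sum_neg_distrib]
            exact Finset.sum_congr rfl fun j _ => by ring
          rw [e2]; ring
        rw [e1, Finset.prod_insert ha]
        ring
      rw [key, symmSum_insert ha]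
      exact ⟨add_nonneg (ih (m + 1)).1 (mul_nonneg ha0 (ih m).1),
        add_le_add (ih (m + 1)).2 (mul_le_mul_of_nonneg_left (ih m).2 ha0)⟩

theorem abs_prod_sub_sum_symmSum_le (hp : ∀ i ∈ s, 0 ≤ p i ∧ p i ≤ 1) (m : ℕ) :
    |∏ i ∈ s, (1 - p i) - ∑ j ∈ Finset.range m, (-1) ^ j * symmSum s p j| ≤ symmSum s p m := by
  obtain ⟨h0, h1⟩ := bonferroni hp m
  rw [← abs_of_nonneg h0, abs_mul, abs_pow, abs_neg, abs_one, one_pow, one_mul] at h1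
  exact h1

theorem pow_add_mul_le_add_pow {x y : ℝ} (hx : 0 ≤ x) (hy : 0 ≤ y) (j : ℕ) :
    x ^ (j + 1) + (j + 1) * (y * x ^ j) ≤ (x + y) ^ (j + 1) := by
  induction j with
  | zero => simp
  | succ j ih =>
    have h := mul_le_mul_of_nonneg_right ih (add_nonneg hx hy)
    rw [← pow_succ] at h
    refine le_trans ?_ h
    have : 0 ≤ (j + 1) * (y * x ^ j) * y := by positivity
    push_cast
    calc x ^ (j + 1 + 1) + (j + 1 + 1) * (y * x ^ (j + 1))
        ≤ x ^ (j + 1 + 1) + (j + 1 + 1) * (y * x ^ (j + 1)) + (j + 1) * (y * x ^ j) * y := by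
          linarith
      _ = _ := by ring

theorem symmSum_le (hp : ∀ i ∈ s, 0 ≤ p i) (j : ℕ) :
    symmSum s p j ≤ (∑ i ∈ s, p i) ^ j / j.factorial := by
  classical
  induction s using Finset.induction_on generalizing j with
  | empty =>
    cases j with
    | zero => simp [symmSum_zero]
    | succ j =>
      rw [symmSum, Finset.powersetCard_eq_empty.2 (by simp), Finset.sum_empty]
      positivity
  | insert a s ha ih =>
    cases j with
    | zero => simp [symmSum_zero]
    | succ j =>
      have hs : ∀ i ∈ s, 0 ≤ p i := fun i hi => hp i (Finset.mem_insert_of_mem hi)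
      have ha0 := hp a (Finset.mem_insert_self _ _)
      have hM : 0 ≤ ∑ i ∈ s, p i := Finset.sum_nonneg hs
      rw [symmSum_insert ha, Finset.sum_insert ha, add_comm (p a)]
      refine (add_le_add (ih hs (j + 1)) (mul_le_mul_of_nonneg_left (ih hs j) ha0)).trans ?_
      refine le_trans (le_of_eq ?_)
        (div_le_div_of_nonneg_right (pow_add_mul_le_add_pow hM ha0 j) (by positivity))
      rw [Nat.factorial_succ]
      push_cast
      have : (j.factorial : ℝ) ≠ 0 := by positivity
      field_simp

end symmSum

/-- The probability that none of the events occurs is close to the corresponding probability for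
independent events, as soon as the probabilities of the intersections of at most `m` of the events
are close to the products. -/
theorem abs_measure_iInter_compl_sub_prod_le {Ω ι : Type*} [MeasurableSpace Ω] (μ : Measure Ω)
    [IsProbabilityMeasure μ] {s : Finset ι} {B : ι → Set Ω} (hB : ∀ i, MeasurableSet (B i))
    {p : ι → ℝ} (hp : ∀ i ∈ s, 0 ≤ p i ∧ p i ≤ 1) {δ : ℝ} (m : ℕ)
    (h : ∀ T ⊆ s, T.card ≤ m → |μ.real (⋂ i ∈ T, B i) - ∏ i ∈ T, p i| ≤ δ * ∏ i ∈ T, p i) :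
    |μ.real (⋂ i ∈ s, (B i)ᶜ) - ∏ i ∈ s, (1 - p i)| ≤
      δ * Real.exp (∑ i ∈ s, p i) + (2 + δ) * ((∑ i ∈ s, p i) ^ m / m.factorial) := by
  classical
  set f : ι → Ω → ℝ := fun i => (B i).indicator 1 with hf
  have hf01 : ∀ ω i, 0 ≤ f i ω ∧ f i ω ≤ 1 := fun ω i => by
    simp only [hf, Set.indicator, Pi.one_apply]; split_ifs <;> norm_num
  have hprod : ∀ T : Finset ι, (fun ω => ∏ i ∈ T, f i ω) = (⋂ i ∈ T, B i).indicator 1 := by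
    intro T
    funext ω
    by_cases hω : ω ∈ ⋂ i ∈ T, B i
    · rw [Set.indicator_of_mem hω]
      refine Finset.prod_eq_one fun i hi => ?_
      exact Set.indicator_of_mem (Set.mem_iInter₂.1 hω i hi) _
    · rw [Set.indicator_of_notMem hω]
      simp only [Set.mem_iInter, not_forall] at hω
      obtain ⟨i, hi, hiω⟩ := hω
      exact Finset.prod_eq_zero hi (Set.indicator_of_notMem hiω _)
  have hmeas : ∀ T : Finset ι, MeasurableSet (⋂ i ∈ T, B i) := fun T =>
    T.measurableSet_biInter fun i _ => hB i
  have hint : ∀ T : Finset ι, Integrable (fun ω => ∏ i ∈ T, f i ω) μ := fun T => by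
    rw [hprod]; exact (integrable_const (1 : ℝ)).indicator (hmeas T)
  have hval : ∀ T : Finset ι, ∫ ω, ∏ i ∈ T, f i ω ∂μ = μ.real (⋂ i ∈ T, B i) := fun T => by
    rw [hprod]; exact integral_indicator_one (hmeas T)
  have hcompl : (fun ω => ∏ i ∈ s, (1 - f i ω)) = (⋂ i ∈ s, (B i)ᶜ).indicator 1 := by
    funext ω
    by_cases hω : ω ∈ ⋂ i ∈ s, (B i)ᶜ
    · rw [Set.indicator_of_mem hω]
      refine Finset.prod_eq_one fun i hi => ?_
      have := Set.mem_iInter₂.1 hω i hi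
      simp [hf, Set.indicator_of_notMem this]
    · rw [Set.indicator_of_notMem hω]
      simp only [Set.mem_iInter, not_forall, Set.mem_compl_iff, not_not] at hω
      obtain ⟨i, hi, hiω⟩ := hω
      exact Finset.prod_eq_zero hi (by simp [hf, Set.indicator_of_mem hiω])
  have hcm : MeasurableSet (⋂ i ∈ s, (B i)ᶜ) :=
    s.measurableSet_biInter fun i _ => (hB i).compl
  have hci : Integrable (fun ω => ∏ i ∈ s, (1 - f i ω)) μ := by
    rw [hcompl]; exact (integrable_const (1 : ℝ)).indicator hcm
  have hcv : ∫ ω, ∏ i ∈ s, (1 - f i ω) ∂μ = μ.real (⋂ i ∈ s, (B i)ᶜ) := by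
    rw [hcompl]; exact integral_indicator_one hcm
  have hsi : ∀ j, Integrable (fun ω => symmSum s (fun i => f i ω) j) μ := fun j =>
    integrable_finsetSum _ fun T _ => hint T
  have hsv : ∀ j ≤ m, |∫ ω, symmSum s (fun i => f i ω) j ∂μ - symmSum s p j| ≤
      δ * symmSum s p j := by
    intro j hj
    simp only [symmSum]
    rw [integral_finsetSum _ fun T _ => hint T, ← Finset.sum_sub_distrib, Finset.mul_sum]
    refine (Finset.abs_sum_le_sum_abs _ _).trans (Finset.sum_le_sum fun T hT => ?_)
    rw [hval]
    rw [Finset.mem_powersetCard] at hT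
    exact h T hT.1 (hT.2.trans_le hj)
  have hps : ∀ i ∈ s, 0 ≤ p i := fun i hi => (hp i hi).1
  set M := ∑ i ∈ s, p i with hM
  have hM0 : 0 ≤ M := Finset.sum_nonneg hps
  have hδ : 0 ≤ δ := by
    have h1 := h ∅ (Finset.empty_subset s) (by simp)
    simpa using (abs_nonneg _).trans h1
  -- the truncated sum for the events
  have h1 : |μ.real (⋂ i ∈ s, (B i)ᶜ) -
      ∑ j ∈ Finset.range m, (-1) ^ j * ∫ ω, symmSum s (fun i => f i ω) j ∂μ| ≤
        (1 + δ) * symmSum s p m := by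
    have e1 : μ.real (⋂ i ∈ s, (B i)ᶜ) -
        ∑ j ∈ Finset.range m, (-1) ^ j * ∫ ω, symmSum s (fun i => f i ω) j ∂μ =
        ∫ ω, (∏ i ∈ s, (1 - f i ω) -
          ∑ j ∈ Finset.range m, (-1) ^ j * symmSum s (fun i => f i ω) j) ∂μ := by
      rw [integral_sub hci (integrable_finsetSum _ fun j _ => (hsi j).const_mul _), hcv,
        integral_finsetSum _ fun j _ => (hsi j).const_mul _]
      congr 1
      exact Finset.sum_congr rfl fun j _ => (integral_const_mul _ _).symm
    rw [e1]
    refine (abs_integral_le_integral_abs).trans ?_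
    have e2 := integral_mono_of_nonneg (μ := μ) (ae_of_all _ fun ω => abs_nonneg _) (hsi m)
      (ae_of_all _ fun ω => abs_prod_sub_sum_symmSum_le (s := s) (fun i _ => hf01 ω i) m)
    have e3 := (abs_le.1 (hsv m le_rfl)).2
    linarith
  have h2 : |∑ j ∈ Finset.range m, (-1) ^ j * ∫ ω, symmSum s (fun i => f i ω) j ∂μ -
      ∑ j ∈ Finset.range m, (-1) ^ j * symmSum s p j| ≤ δ * Real.exp M := by
    rw [← Finset.sum_sub_distrib]
    refine (Finset.abs_sum_le_sum_abs _ _).trans ?_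
    have e1 : ∑ j ∈ Finset.range m, M ^ j / j.factorial ≤ Real.exp M :=
      Real.sum_le_exp_of_nonneg hM0 m
    refine le_trans ?_ (mul_le_mul_of_nonneg_left e1 hδ)
    rw [Finset.mul_sum]
    refine Finset.sum_le_sum fun j hj => ?_
    rw [← mul_sub, abs_mul, abs_pow, abs_neg, abs_one, one_pow, one_mul]
    exact (hsv j (Finset.mem_range.1 hj).le).trans
      (mul_le_mul_of_nonneg_left (symmSum_le hps j) hδ)
  have h3 := abs_prod_sub_sum_symmSum_le hp m
  have h4 := symmSum_le hps m
  rw [abs_sub_comm] at h3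
  have h5 := abs_sub_le (μ.real (⋂ i ∈ s, (B i)ᶜ))
    (∑ j ∈ Finset.range m, (-1) ^ j * ∫ ω, symmSum s (fun i => f i ω) j ∂μ)
    (∏ i ∈ s, (1 - p i))
  have h6 := abs_sub_le (∑ j ∈ Finset.range m, (-1) ^ j * ∫ ω, symmSum s (fun i => f i ω) j ∂μ)
    (∑ j ∈ Finset.range m, (-1) ^ j * symmSum s p j) (∏ i ∈ s, (1 - p i))
  have h7 : (2 + δ) * symmSum s p m ≤ (2 + δ) * (M ^ m / m.factorial) :=
    mul_le_mul_of_nonneg_left h4 (by linarith)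
  linarith

/-! ### Clusters -/

/-- The points of `A` in the balls with centres in `C`. -/
def clusterPoints (r : ℝ) (A C : Finset (ℤ × ℤ)) : Finset (ℤ × ℤ) := by
  classical exact A.filter fun x => ∃ z ∈ C, x ∈ ball z r

section Clusters
variable {r R : ℝ} {A C : Finset (ℤ × ℤ)} {x y z : ℤ × ℤ}

theorem mem_clusterPoints : x ∈ clusterPoints r A C ↔ x ∈ A ∧ ∃ z ∈ C, x ∈ ball z r := by
  classical simp [clusterPoints]

theorem mem_clusterPoints_singleton : x ∈ clusterPoints r A {z} ↔ x ∈ A ∧ x ∈ ball z r := by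
  simp [mem_clusterPoints]

theorem IsMinimalCover.clusterPoints_eq (h : IsMinimalCover r A C) : clusterPoints r A C = A := by
  ext x
  rw [mem_clusterPoints]
  exact ⟨fun h => h.1, fun hx => ⟨hx, h.1 x hx⟩⟩

theorem abs_sub_le_eDist (x y : ℤ × ℤ) :
    |(x.1 : ℝ) - y.1| ≤ eDist x y ∧ |(x.2 : ℝ) - y.2| ≤ eDist x y := by
  have h := eDist_sq x y
  constructor
  · exact abs_le_of_sq_le_sq (by nlinarith [sq_nonneg ((x.2 : ℝ) - y.2)]) (eDist_nonneg x y)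
  · exact abs_le_of_sq_le_sq (by nlinarith [sq_nonneg ((x.1 : ℝ) - y.1)]) (eDist_nonneg x y)

theorem card_clusterPoints_singleton_le (hr : 0 ≤ r) (A : Finset (ℤ × ℤ)) (z : ℤ × ℤ) :
    ((clusterPoints r A {z}).card : ℝ) ≤ 9 * Real.exp (2 * r) := by
  set m := ⌊Real.exp r⌋ with hm
  have hm1 : (1 : ℝ) ≤ Real.exp r := Real.one_le_exp hr
  have hm0 : 0 ≤ m := Int.floor_nonneg.2 (by linarith)
  have hmr : (m : ℝ) ≤ Real.exp r := Int.floor_le _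
  have hsub : clusterPoints r A {z} ⊆
      Finset.Icc (z.1 - m) (z.1 + m) ×ˢ Finset.Icc (z.2 - m) (z.2 + m) := by
    intro x hx
    have h1 : eDist z x ≤ m := (mem_clusterPoints_singleton.1 hx).2
    have h2 := abs_sub_le_eDist z x
    have h3 : |z.1 - x.1| ≤ m := by exact_mod_cast h2.1.trans h1
    have h4 : |z.2 - x.2| ≤ m := by exact_mod_cast h2.2.trans h1
    rw [abs_le] at h3 h4
    simp only [Finset.mem_product, Finset.mem_Icc]
    omega
  have h1 := Finset.card_le_card hsub
  rw [Finset.card_product, Int.card_Icc, Int.card_Icc] at h1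
  have h2 : ((z.1 + m + 1 - (z.1 - m)).toNat : ℝ) = 2 * m + 1 := by
    have : ((z.1 + m + 1 - (z.1 - m)).toNat : ℤ) = 2 * m + 1 := by omega
    exact_mod_cast this
  have h3 : ((z.2 + m + 1 - (z.2 - m)).toNat : ℝ) = 2 * m + 1 := by
    have : ((z.2 + m + 1 - (z.2 - m)).toNat : ℤ) = 2 * m + 1 := by omega
    exact_mod_cast this
  have h4 : ((clusterPoints r A {z}).card : ℝ) ≤ (2 * m + 1) * (2 * m + 1) := by
    calc _ ≤ (((z.1 + m + 1 - (z.1 - m)).toNat * (z.2 + m + 1 - (z.2 - m)).toNat : ℕ) : ℝ) :=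
          Nat.cast_le.2 h1
      _ = _ := by rw [Nat.cast_mul, h2, h3]
  rw [two_mul, Real.exp_add]
  have hm0' : (0 : ℝ) ≤ m := by exact_mod_cast hm0
  nlinarith

/-- A finite set of diameter at most `exp r` fits in a ball of radius `⌊exp r⌋`, by centring the
ball at the middle of the bounding box. -/
theorem exists_subset_ball (hr : 3 ≤ Real.exp r) {S : Finset (ℤ × ℤ)}
    (hS : ∀ x ∈ S, ∀ y ∈ S, eDist x y ≤ Real.exp r) : ∃ z, ∀ x ∈ S, x ∈ ball z r := by
  rcases S.eq_empty_or_nonempty with rfl | hne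
  · exact ⟨0, by simp⟩
  set m := ⌊Real.exp r⌋ with hm
  have hm3 : 3 ≤ m := Int.le_floor.2 (by exact_mod_cast hr)
  obtain ⟨a, ha, hamin⟩ := S.exists_min_image Prod.fst hne
  obtain ⟨b, hb, hbmin⟩ := S.exists_min_image Prod.snd hne
  have hdiff : ∀ x ∈ S, ∀ y ∈ S, x.1 - y.1 ≤ m ∧ x.2 - y.2 ≤ m := by
    intro x hx y hy
    have h1 := abs_sub_le_eDist x y
    have h2 := hS x hx y hy
    constructor
    · refine Int.le_floor.2 ?_
      push_cast
      exact (le_abs_self _).trans (h1.1.trans h2)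
    · refine Int.le_floor.2 ?_
      push_cast
      exact (le_abs_self _).trans (h1.2.trans h2)
  refine ⟨(a.1 + m / 2, b.2 + m / 2), fun x hx => ?_⟩
  have h1 := hamin x hx
  have h2 := hbmin x hx
  have h3 := (hdiff x hx a ha).1
  have h4 := (hdiff x hx b hb).2
  have h5 : |2 * (a.1 + m / 2 - x.1)| ≤ m + 1 := by rw [abs_le]; omega
  have h6 : |2 * (b.2 + m / 2 - x.2)| ≤ m + 1 := by rw [abs_le]; omega
  have h7 : (a.1 + m / 2 - x.1) ^ 2 + (b.2 + m / 2 - x.2) ^ 2 ≤ m ^ 2 := by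
    have e1 := sq_le_sq' (abs_le.1 h5).1 (abs_le.1 h5).2
    have e2 := sq_le_sq' (abs_le.1 h6).1 (abs_le.1 h6).2
    nlinarith
  change eDist _ x ≤ (m : ℝ)
  have hm0 : (0 : ℝ) ≤ m := by exact_mod_cast (by omega : 0 ≤ m)
  refine le_of_abs_le (abs_le_of_sq_le_sq ?_ hm0)
  rw [eDist_sq]
  exact_mod_cast h7

theorem IsMinimalCover.exists_mem (h : IsMinimalCover r A C) (hz : z ∈ C) :
    ∃ x ∈ A, x ∈ ball z r := by
  classical
  by_contra! hcon
  have h1 : IsCover r A (C.erase z) := fun x hx => by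
    obtain ⟨w, hw, hxw⟩ := h.1 x hx
    exact ⟨w, Finset.mem_erase.2 ⟨fun e => hcon x hx (e ▸ hxw), hw⟩, hxw⟩
  have h2 := h.2 _ h1
  rw [Finset.card_erase_of_mem hz] at h2
  have := Finset.card_pos.2 ⟨z, hz⟩
  omega

theorem eDist_le_of_mem_ball (hx : x ∈ ball z r) (hy : y ∈ ball z r) :
    eDist x y ≤ 2 * Real.exp r := by
  have h1 : eDist z x ≤ _ := hx
  have h2 : eDist z y ≤ _ := hy
  have h3 := Int.floor_le (Real.exp r)
  have h4 := eDist_triangle x z y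
  rw [eDist_comm x z] at h4
  linarith

theorem IsClustered.eDist_le (hA : IsClustered r R A) (hx : x ∈ A) (hy : y ∈ A)
    (h : eDist x y < Real.exp R) : eDist x y ≤ Real.exp r := by
  by_contra! h'
  exact hA x hx y hy ⟨h', h⟩

theorem IsClustered.eDist_le_of_mem_ball (hA : IsClustered r R A)
    (hrR : 5 * Real.exp r < Real.exp R) (hx : x ∈ A) (hy : y ∈ A) (hxz : x ∈ ball z r)
    (hyz : y ∈ ball z r) : eDist x y ≤ Real.exp r :=
  hA.eDist_le hx hy (by linarith [PhaseB.eDist_le_of_mem_ball hxz hyz, Real.exp_pos r])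

/-- Two clusters of a minimal cover are far apart: otherwise a single ball would cover both. -/
theorem IsMinimalCover.le_eDist (h : IsMinimalCover r A C) (hA : IsClustered r R A)
    (hr : 3 ≤ Real.exp r) (hrR : 5 * Real.exp r < Real.exp R) {z w : ℤ × ℤ} (hz : z ∈ C)
    (hw : w ∈ C) (hzw : z ≠ w) (hx : x ∈ A) (hxz : x ∈ ball z r) (hy : y ∈ A)
    (hyw : y ∈ ball w r) : Real.exp R ≤ eDist x y := by
  classical
  by_contra! hlt
  have hxy := hA.eDist_le hx hy hlt
  set S := clusterPoints r A {z} ∪ clusterPoints r A {w} with hS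
  have hdist : ∀ u ∈ S, ∀ v ∈ S, eDist u v ≤ Real.exp r := by
    have cross : ∀ u ∈ clusterPoints r A {z}, ∀ v ∈ clusterPoints r A {w},
        eDist u v ≤ Real.exp r := by
      intro u hu v hv
      rw [mem_clusterPoints_singleton] at hu hv
      refine hA.eDist_le hu.1 hv.1 ?_
      have e1 := eDist_triangle u x v
      have e2 := eDist_triangle x y v
      have e3 := PhaseB.eDist_le_of_mem_ball hu.2 hxz
      have e4 := PhaseB.eDist_le_of_mem_ball hyw hv.2
      linarith
    have same : ∀ q, ∀ u ∈ clusterPoints r A {q}, ∀ v ∈ clusterPoints r A {q},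
        eDist u v ≤ Real.exp r := by
      intro q u hu v hv
      rw [mem_clusterPoints_singleton] at hu hv
      exact hA.eDist_le_of_mem_ball hrR hu.1 hv.1 hu.2 hv.2
    intro u hu v hv
    rcases Finset.mem_union.1 hu with hu | hu <;> rcases Finset.mem_union.1 hv with hv | hv
    · exact same z u hu v hv
    · exact cross u hu v hv
    · rw [eDist_comm]; exact cross v hv u hu
    · exact same w u hu v hv
  obtain ⟨q, hq⟩ := exists_subset_ball hr hdist
  have hcov : IsCover r A (insert q ((C.erase z).erase w)) := by
    intro u hu
    obtain ⟨v, hv, huv⟩ := h.1 u hu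
    by_cases huS : u ∈ S
    · exact ⟨q, Finset.mem_insert_self _ _, hq u huS⟩
    · refine ⟨v, Finset.mem_insert_of_mem (Finset.mem_erase.2 ⟨?_, Finset.mem_erase.2 ⟨?_, hv⟩⟩),
        huv⟩
      · rintro rfl
        exact huS (Finset.mem_union_right _ (mem_clusterPoints_singleton.2 ⟨hu, huv⟩))
      · rintro rfl
        exact huS (Finset.mem_union_left _ (mem_clusterPoints_singleton.2 ⟨hu, huv⟩))
  have h1 := h.2 _ hcov
  have h2 := Finset.card_insert_le q ((C.erase z).erase w)
  have hwz : w ∈ C.erase z := Finset.mem_erase.2 ⟨hzw.symm, hw⟩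
  rw [Finset.card_erase_of_mem hwz, Finset.card_erase_of_mem hz] at h2
  have h3 : 1 < C.card := Finset.one_lt_card.2 ⟨z, hz, w, hw, hzw⟩
  omega

end Clusters

/-! ### Asymptotics of the scales -/

theorem clusterScale_sq {η₀ : ℝ} (hn : 0 < n) : clusterScale η₀ n ^ 2 = n ^ (1 - 2 * η₀) := by
  rw [clusterScale, ← Real.rpow_natCast, ← Real.rpow_mul hn.le]
  congr 1; push_cast; ring

theorem tendsto_clusterScale {η₀ : ℝ} (hη₀ : η₀ < 1 / 2) :
    Tendsto (clusterScale η₀) atTop atTop := tendsto_rpow_atTop (by linarith)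

theorem tendsto_log_mul_clusterScale_sq {η₀ : ℝ} (hη₀ : 0 < η₀) :
    Tendsto (fun n => Real.log n * (clusterScale η₀ n ^ 2 / n)) atTop (𝓝 0) := by
  have h := (isLittleO_log_rpow_atTop (r := 2 * η₀) (by linarith)).tendsto_div_nhds_zero
  refine h.congr' ?_
  filter_upwards [eventually_gt_atTop 0] with n hn
  rw [clusterScale_sq hn, ← Real.rpow_sub_one hn.ne', div_eq_mul_inv, ← Real.rpow_neg hn.le]
  congr 2; ring

theorem tendsto_log_clusterScale {η₀ : ℝ} (hη₀ : η₀ < 1 / 2) :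
    Tendsto (fun n => Real.log n / clusterScale η₀ n) atTop (𝓝 0) :=
  (isLittleO_log_rpow_atTop (by linarith)).tendsto_div_nhds_zero

/-- The error made by replacing a Green function `n + h` by `n`. -/
theorem exp_neg_div_add_le {a h x : ℝ} (hn : 0 < n) (hh : 0 ≤ h) (ha : 0 ≤ a)
    (hx : a * h ≤ x * n ^ 2) : Real.exp (-(a / (n + h))) ≤ Real.exp x * Real.exp (-(a / n)) := by
  rw [← Real.exp_add, Real.exp_le_exp]
  have h1 : a / n - a / (n + h) ≤ a * h / n ^ 2 := by
    have : a / n - a / (n + h) = a * h / (n * (n + h)) := by field_simp; ring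
    rw [this]
    refine div_le_div_of_nonneg_left (by positivity) (by positivity) ?_
    nlinarith
  have h2 : a * h / n ^ 2 ≤ x := by rwa [div_le_iff₀ (by positivity)]
  linarith

/-- The error made by replacing a Green function `n - h` by `n`. -/
theorem le_exp_neg_div_sub {a h x : ℝ} (hn : 0 < n) (hh : 0 ≤ h) (hhn : h ≤ n / 2) (ha : 0 ≤ a)
    (hx : 2 * (a * h) ≤ x * n ^ 2) :
    Real.exp (-x) * Real.exp (-(a / n)) ≤ Real.exp (-(a / (n - h))) := by
  rw [← Real.exp_add, Real.exp_le_exp]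
  have h0 : 0 < n - h := by linarith
  have h1 : a / (n - h) - a / n ≤ 2 * (a * h) / n ^ 2 := by
    have : a / (n - h) - a / n = 2 * (a * h) / (n * (2 * (n - h))) := by field_simp; ring
    rw [this]
    refine div_le_div_of_nonneg_left (by positivity) (by positivity) ?_
    nlinarith
  have h2 : 2 * (a * h) / n ^ 2 ≤ x := by rwa [div_le_iff₀ (by positivity)]
  linarith

theorem phaseTime_add (hn : 0 < n) (s : ℝ) :
    (phaseTime n + s * n) / n = Real.log n / 2 + s := by
  rw [phaseTime]; field_simp

/-- At the time `t_n^B + s n` a vertex of the bulk is missed with probability about `e⁻ˢ / √n`. -/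
theorem exp_neg_phaseTime (hn : 0 < n) (s : ℝ) :
    Real.exp (-((phaseTime n + s * n) / n)) = Real.exp (-s) / Real.sqrt n := by
  rw [phaseTime_add hn, Real.sqrt_eq_rpow, Real.rpow_def_of_pos hn,
    eq_div_iff (Real.exp_pos _).ne', ← Real.exp_add]
  congr 1; ring

/-- The deviations of the Green function from `n` are negligible on the time scale of Phase B, and
so is the probability of a miss in a cluster. -/
theorem eventually_scales {η₀ : ℝ} (hη₀ : η₀ ∈ Set.Ioo (0 : ℝ) (1 / 2)) {c : ℝ} (hc : 0 ≤ c)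
    (s₁ : ℝ) (m : ℕ) {x : ℝ} (hx : 0 < x) : ∀ᶠ n in atTop, 32 ≤ n ∧ 1 ≤ Real.log n ∧
      2 ≤ clusterScale η₀ n ∧ 2 * Real.log n + 2 * c ≤ clusterScale η₀ n ∧
      5 * Real.exp (clusterScale η₀ n) < Real.exp (n - clusterScale η₀ n) ∧
      phaseTime n + s₁ * n ≤ n * Real.log n ∧
      16 * clusterScale η₀ n ^ 2 + m * clusterScale η₀ n + (m + 1) * c + 2 * Real.log n ≤ n / 2 ∧
      2 * ((m + 1) * (n * Real.log n) *
        (16 * clusterScale η₀ n ^ 2 + m * clusterScale η₀ n + (m + 1) * c + 2 * Real.log n)) ≤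
          x * n ^ 2 ∧
      9 * Real.exp (-(2 * clusterScale η₀ n)) ≤
        x * Real.exp (-((phaseTime n + s₁ * n) / n)) := by
  have hr := tendsto_clusterScale hη₀.2
  -- All terms in the brackets are at most a multiple of the square of the cluster scale, which is
  -- `o(n / log n)` as the exponent of the scale is less than `1 / 2`.
  set H : ℝ := 16 + m + (m + 1) * c + 2 with hH
  have hH16 : 18 ≤ H := by
    have : 0 ≤ (m : ℝ) + (m + 1) * c := by positivity
    linarith
  have e1 : ∀ᶠ n in atTop, 2 * Real.log n / clusterScale η₀ n + 2 * c / clusterScale η₀ n < 1 := by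
    have h1 := (tendsto_log_clusterScale hη₀.2).const_mul 2
    have h2 := hr.const_div_atTop (2 * c)
    have h3 := h1.add h2
    rw [mul_zero, add_zero] at h3
    filter_upwards [h3.eventually_lt_const one_pos] with n hn
    rwa [← mul_div_assoc] at hn
  have e2 : ∀ᶠ n in atTop, 2 * (m + 1) * H * (Real.log n * (clusterScale η₀ n ^ 2 / n)) <
      min x 1 := by
    have h1 := (tendsto_log_mul_clusterScale_sq hη₀.1).const_mul (2 * (m + 1) * H)
    rw [mul_zero] at h1
    exact h1.eventually_lt_const (by positivity)
  have e3 : ∀ᶠ n in atTop, 9 * Real.exp (s₁ - clusterScale η₀ n) < x := by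
    have h1 : Tendsto (fun n => 9 * Real.exp (s₁ - clusterScale η₀ n)) atTop (𝓝 (9 * 0)) := by
      refine (Real.tendsto_exp_atBot.comp ?_).const_mul 9
      exact tendsto_atBot_add_const_left _ s₁ (tendsto_neg_atTop_atBot.comp hr)
    rw [mul_zero] at h1
    exact h1.eventually_lt_const hx
  filter_upwards [e1, e2, e3, eventually_ge_atTop 32, hr.eventually_ge_atTop 2,
    Real.tendsto_log_atTop.eventually_ge_atTop (max 1 (2 * s₁))] with n h1 h2 h3 hn hr2 hL
  set r := clusterScale η₀ n
  set L := Real.log n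
  have hL1 : 1 ≤ L := (le_max_left _ _).trans hL
  have hL2 : 2 * s₁ ≤ L := (le_max_right _ _).trans hL
  have hn0 : 0 < n := by linarith
  have hLr : 2 * L + 2 * c ≤ r := by
    rw [← add_div, div_lt_one (by linarith)] at h1
    exact h1.le
  have hrr : r ≤ r ^ 2 := by nlinarith
  have hm0 : (0 : ℝ) ≤ m := Nat.cast_nonneg m
  have hh : 16 * r ^ 2 + m * r + (m + 1) * c + 2 * L ≤ H * r ^ 2 := by
    have a1 : m * r ≤ m * r ^ 2 := mul_le_mul_of_nonneg_left hrr hm0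
    have a2 : (m + 1) * c * 1 ≤ (m + 1) * c * r ^ 2 :=
      mul_le_mul_of_nonneg_left (by linarith) (by positivity)
    have a3 : 2 * L ≤ 2 * r ^ 2 := by linarith
    rw [hH]; linarith
  have hmain : 2 * ((m + 1) * (n * L) * (H * r ^ 2)) ≤ min x 1 * n ^ 2 := by
    have a1 : 2 * ((m + 1) * (n * L) * (H * r ^ 2)) =
        2 * (m + 1) * H * (L * (r ^ 2 / n)) * n ^ 2 := by field_simp
    rw [a1]
    exact mul_le_mul_of_nonneg_right h2.le (by positivity)
  have hHr0 : 0 ≤ H * r ^ 2 := by positivity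
  have hHr : H * r ^ 2 ≤ n / 2 := by
    have a1 : 2 * (n * (H * r ^ 2)) ≤ 2 * ((m + 1) * (n * L) * (H * r ^ 2)) := by
      have : n * 1 ≤ (m + 1) * (n * L) := by
        have b1 : n * 1 ≤ n * L := mul_le_mul_of_nonneg_left hL1 hn0.le
        have b2 : 0 ≤ m * (n * L) := by positivity
        linarith
      have := mul_le_mul_of_nonneg_right this hHr0
      linarith
    have a2 : min x 1 * n ^ 2 ≤ 1 * n ^ 2 :=
      mul_le_mul_of_nonneg_right (min_le_right _ _) (by positivity)
    have a3 : n * (2 * (H * r ^ 2)) ≤ n * n := by linarith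
    have := le_of_mul_le_mul_left a3 hn0
    linarith
  refine ⟨hn, hL1, hr2, hLr, ?_, ?_, hh.trans hHr, ?_, ?_⟩
  · have a1 : (5 : ℝ) < Real.exp 2 := by
      have b := Real.exp_one_gt_d9
      have : Real.exp 2 = Real.exp 1 * Real.exp 1 := by rw [← Real.exp_add]; norm_num
      rw [this]; nlinarith
    calc 5 * Real.exp r < Real.exp 2 * Real.exp r := mul_lt_mul_of_pos_right a1 (Real.exp_pos _)
      _ = Real.exp (2 + r) := (Real.exp_add _ _).symm
      _ ≤ Real.exp (n - r) := by
        refine Real.exp_le_exp.2 ?_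
        have : 18 * r ^ 2 ≤ H * r ^ 2 := mul_le_mul_of_nonneg_right hH16 (by positivity)
        linarith
  · rw [phaseTime]
    have : n * (L / 2 + s₁) ≤ n * L := mul_le_mul_of_nonneg_left (by linarith) hn0.le
    calc 1 / 2 * n * L + s₁ * n = n * (L / 2 + s₁) := by ring
      _ ≤ _ := this
  · have a1 : 2 * ((m + 1) * (n * L) * (16 * r ^ 2 + m * r + (m + 1) * c + 2 * L)) ≤
        2 * ((m + 1) * (n * L) * (H * r ^ 2)) := by
      have : 0 ≤ (m + 1) * (n * L) := by positivity
      have := mul_le_mul_of_nonneg_left hh this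
      linarith
    exact a1.trans (hmain.trans (mul_le_mul_of_nonneg_right (min_le_left _ _) (by positivity)))
  · rw [phaseTime_add hn0]
    have a1 : -(2 * r) ≤ (s₁ - r) + -(L / 2 + s₁) := by linarith
    calc 9 * Real.exp (-(2 * r)) ≤ 9 * (Real.exp (s₁ - r) * Real.exp (-(L / 2 + s₁))) := by
          rw [← Real.exp_add]; gcongr
      _ = 9 * Real.exp (s₁ - r) * Real.exp (-(L / 2 + s₁)) := by ring
      _ ≤ _ := mul_le_mul_of_nonneg_right h3.le (Real.exp_pos _).le

/-! ### Joint law of the visits to well separated vertices -/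

/-- The visits to well separated vertices are asymptotically independent: `g` bounds the Green
function on the diagonal from below, and `R` bounds the row sums over at most `m` vertices. -/
theorem abs_measure_visited_sub_le (hV : (latticeDomain D n).Nonempty) {ι : Type*}
    [DecidableEq ι] {s₁ s₂ : Finset ι} (hs : Disjoint s₁ s₂) {x : ι → ℤ × ℤ}
    (hx : ∀ i ∈ s₁ ∪ s₂, x i ∈ latticeDomain D n) (hinj : Set.InjOn x (s₁ ∪ s₂ : Finset ι))
    {t₁ t₂ : ℝ} (ht₁ : 0 ≤ t₁) (ht : t₁ ≤ t₂) (hn : 0 < n) {g R₀ R₁ δ : ℝ} {m : ℕ} (hg : 0 < g)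
    (hdiag : ∀ i ∈ s₁ ∪ s₂, g ≤ green (latticeDomain D n) (x i) (x i) ∧
      green (latticeDomain D n) (x i) (x i) ≤ R₀)
    (hoff : ∀ i ∈ s₁ ∪ s₂, ∀ j ∈ s₁ ∪ s₂, i ≠ j → green (latticeDomain D n) (x i) (x j) ≤ R₁)
    (hR₀ : 0 < R₀) (hR₁ : 0 ≤ R₁)
    (hup : ∀ a : ℝ, 0 ≤ a → a ≤ m * t₂ →
      Real.exp (-(a / (R₀ + m * R₁))) ≤ (1 + δ) * Real.exp (-(a / n)))
    (hlow : ∀ a : ℝ, 0 ≤ a → a ≤ m * t₂ →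
      (1 - δ) * Real.exp (-(a / n)) ≤ Real.exp (-(a / g))) :
    |(walkLaw D n).real {ω | (∀ i ∈ s₁, ¬IsAvoided ω t₁ {x i}) ∧
        ∀ i ∈ s₂, ¬IsAvoided ω t₂ {x i}} -
      (1 - Real.exp (-(t₁ / n))) ^ s₁.card * (1 - Real.exp (-(t₂ / n))) ^ s₂.card| ≤
      δ * Real.exp (s₁.card * Real.exp (-(t₁ / n)) + s₂.card * Real.exp (-(t₂ / n))) +
        (2 + δ) * ((s₁.card * Real.exp (-(t₁ / n)) + s₂.card * Real.exp (-(t₂ / n))) ^ m /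
          m.factorial) := by
  set τ : ι → ℝ := fun i => if i ∈ s₁ then t₁ else t₂ with hτ
  have hτ1 : ∀ i ∈ s₁, τ i = t₁ := fun i hi => if_pos hi
  have hτ2 : ∀ i ∈ s₂, τ i = t₂ := fun i hi => if_neg (Finset.disjoint_right.1 hs hi)
  have hτ0 : ∀ i, 0 ≤ τ i ∧ τ i ≤ t₂ := fun i => by
    simp only [hτ]; split_ifs
    · exact ⟨ht₁, ht⟩
    · exact ⟨ht₁.trans ht, le_rfl⟩
  set B : ι → Set (Sample D n) := fun i => {ω | IsAvoided ω (τ i) {x i}} with hB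
  set p : ι → ℝ := fun i => Real.exp (-(τ i / n)) with hp
  have hprod : ∀ f : ℝ → ℝ, ∏ i ∈ s₁ ∪ s₂, f (τ i) = f t₁ ^ s₁.card * f t₂ ^ s₂.card := by
    intro f
    rw [Finset.prod_union hs, Finset.prod_congr rfl fun i hi => by rw [hτ1 i hi],
      Finset.prod_const, Finset.prod_congr rfl fun i hi => by rw [hτ2 i hi], Finset.prod_const]
  have hsum : ∑ i ∈ s₁ ∪ s₂, p i =
      s₁.card * Real.exp (-(t₁ / n)) + s₂.card * Real.exp (-(t₂ / n)) := by
    simp only [hp]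
    rw [Finset.sum_union hs, Finset.sum_congr rfl fun i hi => by rw [hτ1 i hi], Finset.sum_const,
      Finset.sum_congr rfl fun i hi => by rw [hτ2 i hi], Finset.sum_const, nsmul_eq_mul,
      nsmul_eq_mul]
  have hset : {ω : Sample D n | (∀ i ∈ s₁, ¬IsAvoided ω t₁ {x i}) ∧
      ∀ i ∈ s₂, ¬IsAvoided ω t₂ {x i}} = ⋂ i ∈ s₁ ∪ s₂, (B i)ᶜ := by
    ext ω
    simp only [Set.mem_ofPred_eq, Set.mem_iInter, Set.mem_compl_iff, hB, Finset.mem_union]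
    constructor
    · rintro ⟨h1, h2⟩ i (hi | hi)
      · rw [hτ1 i hi]; exact h1 i hi
      · rw [hτ2 i hi]; exact h2 i hi
    · intro h
      refine ⟨fun i hi => ?_, fun i hi => ?_⟩
      · have := h i (Or.inl hi); rwa [hτ1 i hi] at this
      · have := h i (Or.inr hi); rwa [hτ2 i hi] at this
  rw [hset, ← hprod fun t => 1 - Real.exp (-(t / n)), ← hsum]
  refine abs_measure_iInter_compl_sub_prod_le (walkLaw D n)
    (fun i => measurableSet_isAvoided _ _) (fun i _ => ⟨(Real.exp_pos _).le, ?_⟩) m ?_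
  · rw [Real.exp_le_one_iff, neg_nonpos]
    exact div_nonneg (hτ0 i).1 hn.le
  intro T hT hTm
  set F₁ := (T ∩ s₁).image x
  set F₂ := (T ∩ s₂).image x
  have hTx : ∀ T' ⊆ T, Set.InjOn x T' := fun T' hT' => hinj.mono fun i hi => hT (hT' hi)
  have hc1 : F₁.card = (T ∩ s₁).card :=
    Finset.card_image_of_injOn (hTx _ Finset.inter_subset_left)
  have hc2 : F₂.card = (T ∩ s₂).card :=
    Finset.card_image_of_injOn (hTx _ Finset.inter_subset_left)
  have hTs : T ∩ s₁ ∪ T ∩ s₂ = T := by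
    rw [← Finset.inter_union_distrib_left]; exact Finset.inter_eq_left.2 hT
  have hFT : F₁ ∪ F₂ = T.image x := by rw [← Finset.image_union, hTs]
  have hdT : Disjoint (T ∩ s₁) (T ∩ s₂) :=
    hs.mono Finset.inter_subset_right Finset.inter_subset_right
  have hFd : Disjoint F₁ F₂ := by
    rw [Finset.disjoint_left]
    intro y hy1 hy2
    obtain ⟨i, hi, rfl⟩ := Finset.mem_image.1 hy1
    obtain ⟨j, hj, hij⟩ := Finset.mem_image.1 hy2
    have : j = i := hTx T subset_rfl (Finset.mem_inter.1 hj).1 (Finset.mem_inter.1 hi).1 hij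
    subst this
    exact Finset.disjoint_left.1 hdT hi hj
  have hFV : F₁ ∪ F₂ ⊆ latticeDomain D n := by
    rw [hFT]
    intro y hy
    obtain ⟨i, hi, rfl⟩ := Finset.mem_image.1 hy
    exact hx i (hT hi)
  have hcard : (F₁.card : ℝ) + F₂.card = T.card := by
    rw [hc1, hc2, ← Nat.cast_add, ← Finset.card_union_of_disjoint hdT, hTs]
  have hTm' : (T.card : ℝ) ≤ m := Nat.cast_le.2 hTm
  set a := (F₁.card : ℝ) * t₁ + F₂.card * t₂ with ha
  have ha0 : 0 ≤ a := by
    have := ht₁.trans ht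
    positivity
  have ham : a ≤ m * t₂ := by
    have e1 : (F₁.card : ℝ) * t₁ ≤ F₁.card * t₂ := mul_le_mul_of_nonneg_left ht (Nat.cast_nonneg _)
    have e2 := mul_le_mul_of_nonneg_right hTm' (ht₁.trans ht)
    rw [← hcard] at e2
    linarith
  have hprodT : ∏ i ∈ T, p i = Real.exp (-(a / n)) := by
    simp only [hp]
    rw [← Real.exp_sum]
    congr 1
    rw [Finset.sum_neg_distrib, ← Finset.sum_div, ← hTs, Finset.sum_union hdT,
      Finset.sum_congr rfl fun i hi => hτ1 i (Finset.mem_inter.1 hi).2, Finset.sum_const,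
      Finset.sum_congr rfl fun i hi => hτ2 i (Finset.mem_inter.1 hi).2, Finset.sum_const,
      nsmul_eq_mul, nsmul_eq_mul, ← hc1, ← hc2]
  have hBT : (⋂ i ∈ T, B i) = {ω | IsAvoided ω t₁ F₁ ∧ IsAvoided ω t₂ F₂} := by
    ext ω
    simp only [Set.mem_iInter, Set.mem_ofPred_eq, hB, IsAvoided, Finset.mem_singleton, F₁, F₂,
      Finset.mem_image, Finset.mem_inter]
    constructor
    · intro h
      refine ⟨?_, ?_⟩
      · rintro v ⟨i, ⟨hiT, hi⟩, hv⟩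
        have := h i hiT v hv.symm
        rwa [hτ1 i hi] at this
      · rintro v ⟨i, ⟨hiT, hi⟩, hv⟩
        have := h i hiT v hv.symm
        rwa [hτ2 i hi] at this
    · rintro ⟨h1, h2⟩ i hiT v hv
      rcases Finset.mem_union.1 (hT hiT) with hi | hi
      · rw [hτ1 i hi]; exact h1 v ⟨i, ⟨hiT, hi⟩, hv.symm⟩
      · rw [hτ2 i hi]; exact h2 v ⟨i, ⟨hiT, hi⟩, hv.symm⟩
  have hrow : ∀ y ∈ F₁ ∪ F₂, ∑ z ∈ F₁ ∪ F₂, green (latticeDomain D n) z y ≤ R₀ + m * R₁ := by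
    intro y hy
    rw [hFT] at hy ⊢
    obtain ⟨j, hj, rfl⟩ := Finset.mem_image.1 hy
    rw [Finset.sum_image (hTx T subset_rfl), ← Finset.add_sum_erase T _ hj]
    refine add_le_add (hdiag j (hT hj)).2 ?_
    have e1 : ∑ i ∈ T.erase j, green (latticeDomain D n) (x i) (x j) ≤ (T.erase j).card • R₁ :=
      Finset.sum_le_card_nsmul _ _ _ fun i hi =>
        hoff i (hT (Finset.mem_of_mem_erase hi)) j (hT hj) (Finset.ne_of_mem_erase hi)
    rw [nsmul_eq_mul] at e1
    refine e1.trans (mul_le_mul_of_nonneg_right ?_ hR₁)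
    exact (Nat.cast_le.2 (Finset.card_le_card (Finset.erase_subset _ _))).trans hTm'
  have hdiagF : ∀ y ∈ F₁ ∪ F₂, g ≤ green (latticeDomain D n) y y := by
    intro y hy
    rw [hFT] at hy
    obtain ⟨j, hj, rfl⟩ := Finset.mem_image.1 hy
    exact (hdiag j (hT hj)).1
  have hF1V := Finset.subset_union_left.trans hFV
  have hF2V := Finset.subset_union_right.trans hFV
  have hu := measure_avoid_le hV ht₁ ht hF1V hF2V hFd (R := R₀ + m * R₁) (by positivity) hrow
  have hl := le_measure_avoid hV ht₁ ht hF1V hF2V hFd hg hdiagF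
  rw [hBT, hprodT, abs_le]
  have hu' := ENNReal.toReal_le_of_le_ofReal (Real.exp_pos _).le hu
  have hl' := (ENNReal.ofReal_le_iff_le_toReal (measure_ne_top _ _)).1 hl
  have h1 := hup a ha0 ham
  have h2 := hlow a ha0 ham
  rw [measureReal_def]
  constructor <;> linarith

/-- The probability that a cluster is visited but not covered is small compared with the probability
`exp (-t / n)` that it is missed altogether. A local time `16 r²` at one of its vertices is enough:
it is small compared with `n / log n`, and as the resistances in the cluster are of order `r`, each
of the at most `9 exp (2 r)` other vertices is then missed with probability at most `exp (-4 r)`. -/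
theorem miss_bound_le {c r t x G l k : ℝ} (hn : 0 < n) (hx : 0 ≤ x) (hx1 : x ≤ 1) (hc : 0 ≤ c)
    (hr : 0 < r) (ht : 0 ≤ t) (hl : 0 ≤ l) (hG0 : n - l - c ≤ G) (hG1 : G ≤ n + c)
    (hln : l + c ≤ n / 2) (hl1 : 2 * (t * (l + c)) ≤ x * n ^ 2)
    (hr1 : t * (16 * r ^ 2 + c) ≤ x * n ^ 2)
    (hmiss : 9 * Real.exp (-(2 * r)) ≤ x * Real.exp (-(t / n))) (hk : k ≤ 9 * Real.exp (2 * r)) :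
    Real.exp 1 * (Real.exp (-(t / (16 * r ^ 2 + G))) - Real.exp (-(t / G))) +
      k * Real.exp (-(16 * r ^ 2 / (2 * (2 * r)))) ≤ 10 * x * Real.exp (-(t / n)) := by
  have hG : 0 < G := by linarith
  set E := Real.exp (-(t / n)) with hE
  have hE0 : 0 < E := Real.exp_pos _
  have h1 : Real.exp (-(t / (16 * r ^ 2 + G))) ≤ Real.exp x * E := by
    refine le_trans ?_ (exp_neg_div_add_le hn (by positivity) ht hr1)
    refine Real.exp_le_exp.2 (neg_le_neg ?_)
    refine div_le_div_of_nonneg_left ht (by positivity) (by linarith)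
  have h2 : Real.exp (-x) * E ≤ Real.exp (-(t / G)) := by
    refine (le_exp_neg_div_sub hn (by linarith) hln ht hl1).trans ?_
    refine Real.exp_le_exp.2 (neg_le_neg ?_)
    exact div_le_div_of_nonneg_left ht (by linarith) (by linarith)
  have h3 : Real.exp x ≤ 1 + 2 * x := by
    have := Real.abs_exp_sub_one_le (x := x) (by rwa [abs_of_nonneg hx])
    rw [abs_of_nonneg hx] at this
    linarith [(abs_le.1 this).2]
  have h4 := Real.one_sub_le_exp_neg x
  have h5 : Real.exp (-(t / (16 * r ^ 2 + G))) - Real.exp (-(t / G)) ≤ 3 * x * E := by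
    have e1 := mul_le_mul_of_nonneg_right h3 hE0.le
    have e2 := mul_le_mul_of_nonneg_right h4 hE0.le
    linarith
  have h6 : k * Real.exp (-(16 * r ^ 2 / (2 * (2 * r)))) ≤ x * E := by
    refine le_trans (mul_le_mul_of_nonneg_right hk (Real.exp_pos _).le)
      (le_trans (le_of_eq ?_) hmiss)
    rw [mul_assoc, ← Real.exp_add]
    congr 2; field_simp; ring
  have h7 : Real.exp 1 * (Real.exp (-(t / (16 * r ^ 2 + G))) - Real.exp (-(t / G))) ≤
      Real.exp 1 * (3 * x * E) := mul_le_mul_of_nonneg_left h5 (Real.exp_pos _).le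
  have h8 : Real.exp 1 * (3 * x * E) ≤ 3 * (3 * x * E) := by
    have := Real.exp_one_lt_d9
    exact mul_le_mul_of_nonneg_right (by linarith) (by positivity)
  linarith

/-! ### The cover times of the clusters -/

/-- The clusters around two families of centres are covered at two times asymptotically as if the
clusters were single vertices, each missed independently with probability `exp (-t / n)`. -/
theorem eventually_abs_measure_covered_sub_le (D : PlanarDomain) {η₀ : ℝ}
    (hη₀ : η₀ ∈ Set.Ioo (0 : ℝ) (1 / 2)) (s₁ : ℝ) {M ε : ℝ} (hM : 0 ≤ M) (hε : 0 < ε) :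
    ∀ᶠ n in atTop, ∀ A C : Finset (ℤ × ℤ), (A : Set (ℤ × ℤ)) ⊆ bulk D n →
      IsClustered (clusterScale η₀ n) (n - clusterScale η₀ n) A →
      IsMinimalCover (clusterScale η₀ n) A C → ∀ C₁ ⊆ C, ∀ C₂ ⊆ C, Disjoint C₁ C₂ →
      ∀ t₁ t₂ : ℝ, 0 ≤ t₁ → t₁ ≤ t₂ → t₂ ≤ phaseTime n + s₁ * n →
      C₁.card * Real.exp (-(t₁ / n)) + C₂.card * Real.exp (-(t₂ / n)) ≤ M →
      |(walkLaw D n).real {ω | IsCovered ω t₁ (clusterPoints (clusterScale η₀ n) A C₁) ∧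
          IsCovered ω t₂ (clusterPoints (clusterScale η₀ n) A C₂)} -
        (1 - Real.exp (-(t₁ / n))) ^ C₁.card * (1 - Real.exp (-(t₂ / n))) ^ C₂.card| ≤ ε := by
  obtain ⟨c, hc, hgu, hgl⟩ := exists_green_latticeDomain_bounds D
  -- The order `m` at which the Bonferroni inequalities are truncated does not depend on `n`.
  obtain ⟨m, hm⟩ : ∃ m : ℕ, M ^ m / m.factorial ≤ ε / 12 :=
    ((FloorSemiring.tendsto_pow_div_factorial_atTop M).eventually_le_const
      (by positivity : (0 : ℝ) < ε / 12)).exists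
  set δ : ℝ := min 1 (ε / (4 * (Real.exp M + M))) with hδ
  have hEM : 0 < Real.exp M + M := by positivity
  have hδ0 : 0 < δ := by positivity
  have hδ1 : δ ≤ 1 := min_le_left _ _
  have hδM : δ * (Real.exp M + M) ≤ ε / 4 := by
    have : δ ≤ ε / (4 * (Real.exp M + M)) := min_le_right _ _
    rw [le_div_iff₀ (by positivity)] at this
    linarith
  filter_upwards [eventually_scales hη₀ hc s₁ m (x := δ / 40) (by positivity),
    eventually_latticeDomain_nonempty D] with n hsc hV
  obtain ⟨hn32, hL1, hr2, hLr, h5, hT, hh, hhx, hmiss⟩ := hsc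
  intro A C hA hcl hmin C₁ hC₁ C₂ hC₂ hdisj t₁ t₂ ht₁ ht ht₂ hMn
  set r := clusterScale η₀ n with hr
  set L := Real.log n with hL
  have hn0 : 0 < n := by linarith
  have hr0 : 0 < r := by linarith
  have hm0 : (0 : ℝ) ≤ m := Nat.cast_nonneg m
  have ht₂0 : 0 ≤ t₂ := ht₁.trans ht
  have h3r : 3 ≤ Real.exp r := by linarith [Real.add_one_le_exp r]
  have hbig : 0 ≤ 16 * r ^ 2 + m * r + (m + 1) * c + 2 * L := by positivity
  -- every small error term is dominated by the same quantity
  have hdom : ∀ a h : ℝ, a ≤ (m + 1) * t₂ → 0 ≤ h →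
      h ≤ 16 * r ^ 2 + m * r + (m + 1) * c + 2 * L → 2 * (a * h) ≤ δ / 40 * n ^ 2 := by
    intro a h ha hh0 hh1
    have e1 : a ≤ (m + 1) * (n * L) :=
      ha.trans (mul_le_mul_of_nonneg_left (ht₂.trans hT) (by positivity))
    have e2 : a * h ≤ (m + 1) * (n * L) * (16 * r ^ 2 + m * r + (m + 1) * c + 2 * L) :=
      mul_le_mul e1 hh1 hh0 (by positivity)
    linarith
  have hmc : 0 ≤ m * c := by positivity
  have hmr : 0 ≤ m * r := by positivity
  have hr20 : 0 ≤ r ^ 2 := by positivity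
  -- a representative `x z ∈ A` of the cluster around `z`
  choose! x hxA hxb using fun z (hz : z ∈ C) => hmin.exists_mem hz
  have hbulk : ∀ z ∈ C, x z ∈ bulk D n := fun z hz => hA (hxA z hz)
  have hxV : ∀ z ∈ C, x z ∈ latticeDomain D n := fun z hz => mem_of_mem_bulk (hbulk z hz)
  have hsep : ∀ z ∈ C, ∀ w ∈ C, z ≠ w → Real.exp (n - r) ≤ eDist (x z) (x w) :=
    fun z hz w hw hzw => hmin.le_eDist hcl h3r h5 hz hw hzw (hxA z hz) (hxb z hz) (hxA w hw)
      (hxb w hw)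
  have hsub : C₁ ∪ C₂ ⊆ C := Finset.union_subset hC₁ hC₂
  have hinj : Set.InjOn x (C₁ ∪ C₂ : Finset (ℤ × ℤ)) := by
    intro z hz w hw hzw
    by_contra hne
    have := hsep z (hsub hz) w (hsub hw) hne
    rw [hzw, eDist_self] at this
    exact absurd this (not_le.2 (Real.exp_pos _))
  have hdiag : ∀ y ∈ A, n - (2 * L + c) ≤ green (latticeDomain D n) y y ∧
      green (latticeDomain D n) y y ≤ n + c := by
    intro y hy
    have hyV := mem_of_mem_bulk (hA hy)
    have e1 := hgu n hn0.le y hyV y hyV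
    have e2 := hgl n y (hA hy) y hyV
    rw [eDist_self, Real.log_zero] at e1 e2
    constructor <;> linarith
  have hg0 : 0 < n - (2 * L + c) := by linarith
  have hvis := abs_measure_visited_sub_le hV hdisj (x := x) (fun z hz => hxV z (hsub hz)) hinj
    ht₁ ht hn0 (g := n - (2 * L + c)) (R₀ := n + c) (R₁ := r + c) (δ := δ) (m := m) hg0
    (fun z hz => hdiag _ (hxA z (hsub hz))) (fun z hz w hw hzw => by
      have e1 := hgu n hn0.le _ (hxV z (hsub hz)) _ (hxV w (hsub hw))
      have e2 := hsep z (hsub hz) w (hsub hw) hzw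
      have e3 := (Real.le_log_iff_exp_le ((Real.exp_pos _).trans_le e2)).2 e2
      linarith) (by positivity) (by positivity) (fun a ha0 ha => by
      have e0 : a * (c + m * (r + c)) ≤ δ / 40 * n ^ 2 := by
        have := hdom a (c + m * (r + c)) (by linarith) (by positivity) (by linarith)
        have : 0 ≤ a * (c + m * (r + c)) := by positivity
        linarith
      have e1 := exp_neg_div_add_le hn0 (h := c + m * (r + c)) (by positivity) ha0 e0
      have e2 : Real.exp (δ / 40) ≤ 1 + δ := by
        have := Real.abs_exp_sub_one_le (x := δ / 40) (by rw [abs_of_pos] <;> linarith)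
        rw [abs_of_pos (by linarith : 0 < δ / 40)] at this
        linarith [(abs_le.1 this).2]
      rw [add_assoc]
      exact e1.trans (mul_le_mul_of_nonneg_right e2 (Real.exp_pos _).le))
    (fun a ha0 ha => by
      have e1 := le_exp_neg_div_sub hn0 (h := 2 * L + c) (by positivity) (by linarith) ha0
        (hdom a (2 * L + c) (by linarith) (by positivity) (by linarith))
      refine le_trans (mul_le_mul_of_nonneg_right ?_ (Real.exp_pos _).le) e1
      linarith [Real.one_sub_le_exp_neg (δ / 40)])
  set M' := C₁.card * Real.exp (-(t₁ / n)) + C₂.card * Real.exp (-(t₂ / n)) with hM'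
  have hM'0 : 0 ≤ M' := by positivity
  have hδ2 : δ * Real.exp M' ≤ δ * Real.exp M :=
    mul_le_mul_of_nonneg_left (Real.exp_le_exp.2 hMn) hδ0.le
  have hfac : (2 + δ) * (M' ^ m / m.factorial) ≤ 3 * (ε / 12) := by
    refine mul_le_mul (by linarith) (le_trans ?_ hm) (by positivity) (by norm_num)
    gcongr
  -- a cluster whose representative is visited is covered
  have hmissz : ∀ z ∈ C, ∀ t, 0 ≤ t → t ≤ t₂ →
      (walkLaw D n).real {ω | ¬IsAvoided ω t {x z} ∧ ¬IsCovered ω t (clusterPoints r A {z})} ≤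
        δ * Real.exp (-(t / n)) := by
    intro z hz t ht0 htt
    have e1 := measure_visited_not_covered_le hV ht0 ⟨x z, hxV z hz⟩
      (B := clusterPoints r A {z}) (Δ := 2 * r) (l := 16 * r ^ 2) (by linarith) (by positivity)
      (fun y hy hyV => by
        obtain ⟨hyA, hyb⟩ := mem_clusterPoints_singleton.1 hy
        have d1 := hcl.eDist_le_of_mem_ball h5 hyA (hxA z hz) hyb (hxb z hz)
        have d2 : Real.log (eDist y (x z)) ≤ r := by
          rcases (eDist_nonneg y (x z)).eq_or_lt with h0 | h0
          · rw [← h0, Real.log_zero]; exact hr0.le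
          · exact (Real.log_le_iff_le_exp h0).2 d1
        have g1 := hgl n y (hA hyA) _ (hxV z hz)
        have g2 := hgl n _ (hbulk z hz) y hyV
        rw [eDist_comm] at g2
        have g3 := (hdiag y hyA).2
        have g4 := (hdiag _ (hxA z hz)).2
        constructor <;> simp only <;> linarith)
    have htm : ∀ h : ℝ, 0 ≤ h → h ≤ 16 * r ^ 2 + m * r + (m + 1) * c + 2 * L →
        2 * (t * h) ≤ δ / 40 * n ^ 2 := fun h h0 h1 => by
      refine hdom t h ?_ h0 h1
      have : 0 ≤ m * t₂ := by positivity
      linarith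
    have e2 := miss_bound_le (c := c) (r := r) (t := t) (x := δ / 40)
      (G := green (latticeDomain D n) (x z) (x z)) (l := 2 * L)
      (k := ((clusterPoints r A {z}).card : ℝ)) hn0 (by positivity) (by linarith) hc hr0 ht0
      (by positivity) (by linarith [(hdiag _ (hxA z hz)).1]) (hdiag _ (hxA z hz)).2 (by linarith)
      (htm _ (by positivity) (by linarith)) (by
        have := htm (16 * r ^ 2 + c) (by positivity) (by linarith)
        have : 0 ≤ t * (16 * r ^ 2 + c) := by positivity
        linarith) (hmiss.trans (by
        gcongr
        exact htt.trans ht₂)) (card_clusterPoints_singleton_le hr0.le A z)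
    refine le_trans (measureReal_mono ?_) (e1.trans (e2.trans ?_))
    · rintro ω ⟨h1, h2⟩
      refine ⟨?_, h2⟩
      rw [isAvoided_singleton (hxV z hz), not_not] at h1
      exact h1
    · exact mul_le_mul_of_nonneg_right (by linarith) (Real.exp_pos _).le
  set U := {ω : Sample D n | (∀ z ∈ C₁, ¬IsAvoided ω t₁ {x z}) ∧
    ∀ z ∈ C₂, ¬IsAvoided ω t₂ {x z}} with hU
  set K := {ω : Sample D n | IsCovered ω t₁ (clusterPoints r A C₁) ∧
    IsCovered ω t₂ (clusterPoints r A C₂)} with hK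
  have hvisit : ∀ (ω : Sample D n) t, ∀ C' ⊆ C, IsCovered ω t (clusterPoints r A C') →
      ∀ z ∈ C', ¬IsAvoided ω t {x z} := by
    intro ω t C' hC' h z hz hav
    rw [isAvoided_singleton (hxV z (hC' hz))] at hav
    exact hav (h _ (mem_clusterPoints.2 ⟨hxA z (hC' hz), z, hz, hxb z (hC' hz)⟩))
  have hKU : K ⊆ U := fun ω h => ⟨hvisit ω t₁ C₁ hC₁ h.1, hvisit ω t₂ C₂ hC₂ h.2⟩
  have hmissing : ∀ (ω : Sample D n) t C', ¬IsCovered ω t (clusterPoints r A C') →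
      ∃ z ∈ C', ¬IsCovered ω t (clusterPoints r A {z}) := by
    intro ω t C' h
    simp only [IsCovered, not_forall] at h
    obtain ⟨v, hv, hvis⟩ := h
    obtain ⟨hvA, z, hz, hvz⟩ := mem_clusterPoints.1 hv
    exact ⟨z, hz, fun h => hvis (h v (mem_clusterPoints_singleton.2 ⟨hvA, hvz⟩))⟩
  have hUK : U ⊆ K ∪ ((⋃ z ∈ C₁, {ω | ¬IsAvoided ω t₁ {x z} ∧
        ¬IsCovered ω t₁ (clusterPoints r A {z})}) ∪
      ⋃ z ∈ C₂, {ω | ¬IsAvoided ω t₂ {x z} ∧ ¬IsCovered ω t₂ (clusterPoints r A {z})}) := by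
    intro ω h
    by_cases hk : ω ∈ K
    · exact Or.inl hk
    · right
      rw [hK, Set.mem_ofPred_eq, not_and_or] at hk
      rcases hk with hk | hk
      · obtain ⟨z, hz, h1⟩ := hmissing ω t₁ C₁ hk
        exact Or.inl (Set.mem_biUnion hz ⟨h.1 z hz, h1⟩)
      · obtain ⟨z, hz, h1⟩ := hmissing ω t₂ C₂ hk
        exact Or.inr (Set.mem_biUnion hz ⟨h.2 z hz, h1⟩)
  have hUK' : (walkLaw D n).real U ≤ (walkLaw D n).real K + δ * M' := by
    refine (measureReal_mono hUK).trans ((measureReal_union_le _ _).trans ?_)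
    gcongr
    refine (measureReal_union_le _ _).trans ?_
    rw [hM', mul_add]
    refine add_le_add ?_ ?_
    · refine (measureReal_biUnion_finset_le _ _).trans ?_
      refine (Finset.sum_le_card_nsmul _ _ _ fun z hz =>
        hmissz z (hC₁ hz) t₁ ht₁ ht).trans (le_of_eq ?_)
      rw [nsmul_eq_mul]; ring
    · refine (measureReal_biUnion_finset_le _ _).trans ?_
      refine (Finset.sum_le_card_nsmul _ _ _ fun z hz =>
        hmissz z (hC₂ hz) t₂ ht₂0 le_rfl).trans (le_of_eq ?_)
      rw [nsmul_eq_mul]; ring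
  have hKU' : (walkLaw D n).real K ≤ (walkLaw D n).real U := measureReal_mono hKU
  have hδM' : δ * M' ≤ δ * M := mul_le_mul_of_nonneg_left hMn hδ0.le
  have hδe : 0 < δ * Real.exp M := by positivity
  have hδm : 0 ≤ δ * M := by positivity
  rw [abs_le] at hvis ⊢
  rw [mul_add] at hδM
  constructor <;> linarith [hvis.1, hvis.2]

theorem eventually_phaseTime_nonneg (s : ℝ) : ∀ᶠ n in atTop, 0 ≤ phaseTime n + s * n := by
  filter_upwards [eventually_gt_atTop 0, Real.tendsto_log_atTop.eventually_ge_atTop (-2 * s)]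
    with n hn hL
  have h : phaseTime n + s * n = n * (Real.log n / 2 + s) := by rw [phaseTime]; ring
  rw [h]
  exact mul_nonneg hn.le (by linarith)

theorem ae_coverTime_le_iff (hV : (latticeDomain D n).Nonempty) {t : ℝ} (ht : 0 ≤ t)
    (A : Finset (ℤ × ℤ)) : ∀ᵐ ω ∂walkLaw D n, coverTime A ω ≤ t ↔ IsCovered ω t A := by
  filter_upwards [ae_isRegular hV, ae_exists_skeleton_eq hV] with ω hω hrec
  exact hω.coverTime_le_iff hV hrec ht A

/-! ### The tail of the cover time -/

/-- The union bound over the vertices of `A`. -/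
theorem measure_lt_coverTime_le (hV : (latticeDomain D n).Nonempty) {t R : ℝ} (ht : 0 ≤ t)
    {A : Finset (ℤ × ℤ)} (hA : A ⊆ latticeDomain D n)
    (hR : ∀ x ∈ A, green (latticeDomain D n) x x ≤ R) :
    (walkLaw D n).real {ω | t < coverTime A ω} ≤ A.card * Real.exp (-(t / R)) := by
  have h1 : walkLaw D n {ω | t < coverTime A ω} ≤
      walkLaw D n (⋃ x ∈ A, {ω | IsAvoided ω t {x}}) := by
    refine measure_mono_ae ?_
    filter_upwards [ae_coverTime_le_iff hV ht A] with ω hω hmem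
    have h2 : ¬IsCovered ω t A := fun h => absurd (hω.2 h) (not_le.2 hmem)
    simp only [IsCovered, not_forall] at h2
    obtain ⟨v, hv, hvis⟩ := h2
    exact Set.mem_biUnion hv ((isAvoided_singleton v.2).2 hvis)
  refine (ENNReal.toReal_mono (measure_ne_top _ _) h1).trans ?_
  refine (measureReal_biUnion_finset_le A fun x => {ω : Sample D n | IsAvoided ω t {x}}).trans ?_
  rw [← nsmul_eq_mul]
  refine Finset.sum_le_card_nsmul _ _ _ fun x hx => ?_
  simp only [isAvoided_singleton (hA hx)]
  exact ENNReal.toReal_le_of_le_ofReal (Real.exp_pos _).le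
    (measure_not_isVisited_le hV ht (hA hx) (hR x hx))

/-- The factor `2` absorbs the bounded amount by which the Green function may exceed `n`. -/
theorem eventually_measure_lt_coverTime_le (D : PlanarDomain) (s : ℝ) : ∀ᶠ n in atTop,
    ∀ A : Finset (ℤ × ℤ), A ⊆ latticeDomain D n →
      (walkLaw D n).real {ω | phaseTime n + s * n < coverTime A ω} ≤
        2 * Real.exp (-s) * ((A.card : ℝ) / Real.sqrt n) := by
  obtain ⟨c, hc, hgu, -⟩ := exists_green_latticeDomain_bounds D
  filter_upwards [eventually_scales (η₀ := 1 / 4) ⟨by norm_num, by norm_num⟩ hc s 0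
    (Real.log_pos one_lt_two), eventually_latticeDomain_nonempty D, eventually_phaseTime_nonneg s]
    with n hsc hV ht A hA
  obtain ⟨hn32, hL1, hr2, -, -, hT, -, hh, -⟩ := hsc
  have hn0 : 0 < n := by linarith
  have h1 := measure_lt_coverTime_le hV ht hA (R := n + c) fun x hx => by
    have := hgu n hn0.le x (hA hx) x (hA hx)
    rwa [eDist_self, Real.log_zero, sub_zero] at this
  refine h1.trans ?_
  have h2 := exp_neg_div_add_le (x := Real.log 2) hn0 hc ht (by
    have e1 : (phaseTime n + s * n) * c ≤ n * Real.log n *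
        (16 * clusterScale (1 / 4) n ^ 2 + c + 2 * Real.log n) :=
      mul_le_mul hT (by linarith [sq_nonneg (clusterScale (1 / 4) n)]) hc (by positivity)
    have e2 : 0 ≤ (phaseTime n + s * n) * c := mul_nonneg ht hc
    simp only [Nat.cast_zero, zero_mul, zero_add, add_zero, one_mul] at hh
    linarith)
  rw [Real.exp_log two_pos, exp_neg_phaseTime hn0] at h2
  refine (mul_le_mul_of_nonneg_left h2 (Nat.cast_nonneg _)).trans (le_of_eq ?_)
  ring

/-! ### Concentration of the real time -/

theorem tendsto_div_log : Tendsto (fun n : ℝ => n / Real.log n) atTop atTop := by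
  refine tendsto_atTop_mono' _ ?_ (tendsto_rpow_atTop (by norm_num : (0 : ℝ) < 1 / 2))
  filter_upwards [(isLittleO_log_rpow_atTop (by norm_num : (0 : ℝ) < 1 / 2)).bound one_pos,
    eventually_gt_atTop 1] with n h hn
  have hn0 : 0 < n := by linarith
  have hL := Real.log_pos hn
  rw [one_mul, Real.norm_of_nonneg hL.le, Real.norm_of_nonneg (by positivity)] at h
  rw [le_div_iff₀ hL]
  calc n ^ (1 / 2 : ℝ) * Real.log n ≤ n ^ (1 / 2 : ℝ) * n ^ (1 / 2 : ℝ) := by gcongr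
    _ = n := by rw [← Real.rpow_add hn0]; norm_num

/-- Chernoff bounds at the optimal parameter: the expected exit times are of order `|D_n|`, so the
real time deviates from its mean `|D_n| t` by `|D_n| ε n` with a probability that is exponentially
small in `ε² n / log n`. -/
theorem tendsto_measure_realTime (D : PlanarDomain) (s : ℝ) {ε : ℝ} (hε : 0 < ε) :
    Tendsto (fun n : ℝ => (walkLaw D n).real {ω | ε < |(realTime ω (phaseTime n + s * n) /
      ((latticeDomain D n).card : ℝ) - (phaseTime n + s * n)) / n|}) atTop (𝓝 0) := by
  obtain ⟨R, hR0, hR⟩ := exists_sq_le D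
  obtain ⟨c, hc, hcard⟩ := exists_le_card D
  set κ : ℝ := Real.pi * R / c with hκ
  have hp := Real.pi_pos
  have hκ0 : 0 < κ := by positivity
  have hlim : Tendsto (fun n : ℝ => 2 * Real.exp (1 - ε ^ 2 / (4 * κ) * (n / Real.log n))) atTop
      (𝓝 0) := by
    have h1 : Tendsto (fun n : ℝ => ε ^ 2 / (4 * κ) * (n / Real.log n)) atTop atTop :=
      tendsto_div_log.const_mul_atTop (by positivity)
    have h2 : Tendsto (fun n : ℝ => 1 - ε ^ 2 / (4 * κ) * (n / Real.log n)) atTop atBot :=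
      tendsto_atBot_add_const_left _ 1 (tendsto_neg_atTop_atBot.comp h1)
    simpa using (Real.tendsto_exp_atBot.comp h2).const_mul 2
  have hcn : ∀ᶠ n : ℝ in atTop, n * Real.log n ≤ c * Real.exp (2 * n) := by
    filter_upwards [Real.tendsto_exp_atTop.eventually_ge_atTop (1 / c), eventually_gt_atTop 1]
      with n hn hn1
    have e1 : 1 ≤ c * Real.exp n := by rwa [div_le_iff₀' hc] at hn
    have e2 : n ^ 2 / 2 ≤ Real.exp n := by
      have := Real.quadratic_le_exp_of_nonneg (by linarith : 0 ≤ n)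
      linarith
    have e3 : n * Real.log n ≤ Real.exp n := by
      have e4 : Real.log n ≤ n / 2 := by
        have := Real.log_le_sub_one_of_pos (by linarith : 0 < n / 2)
        rw [Real.log_div (by linarith) two_ne_zero] at this
        have := Real.log_two_lt_d9
        linarith
      nlinarith
    rw [two_mul, Real.exp_add]
    nlinarith [Real.exp_pos n]
  refine squeeze_zero' (Eventually.of_forall fun n => measureReal_nonneg) ?_ hlim
  filter_upwards [eventually_scales (η₀ := 1 / 4) ⟨by norm_num, by norm_num⟩ le_rfl s 0 one_pos,
    eventually_latticeDomain_nonempty D, eventually_phaseTime_nonneg s, hcard, hcn,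
    Real.tendsto_log_atTop.eventually_ge_atTop (ε + ε / κ)]
    with n hsc hV ht hcard hcn hLε
  obtain ⟨hn32, hL1, -, -, -, hT, -, -, -⟩ := hsc
  set t := phaseTime n + s * n with htdef
  set v : ℝ := ((latticeDomain D n).card : ℝ) with hv
  set L := Real.log n
  have hn0 : 0 < n := by linarith
  have hL0 : 0 < L := by linarith
  have hvn : n * L ≤ v := hcn.trans hcard
  have hv32 : 32 ≤ v := by nlinarith
  have hv0 : 0 < v := by linarith
  -- the minimizer of `-α ε n + κ α² n log n`
  set α : ℝ := ε / (2 * κ * L) with hα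
  have hα0 : 0 < α := by positivity
  have hα1 : α ≤ 1 := by
    rw [hα, div_le_one (by positivity)]
    have : ε / κ ≤ L := by linarith
    rw [div_le_iff₀ hκ0] at this
    nlinarith
  have hκα : κ * α ≤ 1 := by
    have : κ * α = ε / (2 * L) := by rw [hα]; field_simp
    rw [this, div_le_one (by positivity)]
    have : 0 < ε / κ := by positivity
    linarith
  set R' := R * Real.exp (2 * n) with hR'
  have hR'v : Real.pi * R' ≤ κ * v := by
    have : Real.pi * R' = κ * (c * Real.exp (2 * n)) := by rw [hκ, hR']; field_simp
    rw [this]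
    exact mul_le_mul_of_nonneg_left hcard hκ0.le
  have hθ : Real.pi * R' * (α / v) ≤ κ * α := by
    rw [← mul_div_assoc, div_le_iff₀ hv0]
    nlinarith
  have hθ1 : α / v < innerRate := by
    have e1 : α / v ≤ 1 / 32 := div_le_div₀ zero_le_one hα1 (by norm_num) hv32
    have e2 : (1 : ℝ) / 2 < innerRate := by
      unfold innerRate
      rw [div_lt_div_iff₀ (by norm_num) two_pi_pos]
      linarith [Real.pi_lt_four]
    linarith
  have hmain : -(α * ε * n) + κ * α * α * t ≤ -(ε ^ 2 / (4 * κ) * (n / L)) := by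
    have e1 : κ * α * α * t ≤ κ * α * α * (n * L) :=
      mul_le_mul_of_nonneg_left hT (by positivity)
    have e2 : -(α * ε * n) + κ * α * α * (n * L) = -(ε ^ 2 / (4 * κ) * (n / L)) := by
      rw [hα]; field_simp; ring
    linarith
  have hup := measure_le_realTime hV ht (hR n hn0.le) (by positivity) (θ := α / v) (by positivity)
    hθ1 (hθ.trans hκα) (v * (t + ε * n) - t)
  have hlow := measure_realTime_le hV ht (hR n hn0.le) (by positivity) (θ := α / v) (by positivity)
    (hθ.trans hκα) (v * (t - ε * n))
  have hsub : {ω : Sample D n | ε < |(realTime ω t / v - t) / n|} ⊆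
      {ω | v * (t + ε * n) - t ≤ realTime ω t - t} ∪ {ω | realTime ω t - t ≤ v * (t - ε * n)} := by
    intro ω hω
    rw [Set.mem_ofPred_eq, lt_abs, lt_div_iff₀ hn0, ← neg_div, lt_div_iff₀ hn0] at hω
    rcases hω with h | h
    · left
      have : t + ε * n ≤ realTime ω t / v := by linarith
      rw [le_div_iff₀ hv0] at this
      change v * (t + ε * n) - t ≤ realTime ω t - t
      linarith
    · right
      have : realTime ω t / v ≤ t - ε * n := by linarith
      rw [div_le_iff₀ hv0] at this
      change realTime ω t - t ≤ v * (t - ε * n)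
      linarith
  refine (measureReal_mono hsub).trans ((measureReal_union_le _ _).trans ?_)
  rw [two_mul]
  refine add_le_add (hup.trans (Real.exp_le_exp.2 ?_)) (hlow.trans (Real.exp_le_exp.2 ?_))
  · have e1 : -(α / v * (v * (t + ε * n) - t)) + α / v * (1 + Real.pi * R' * (α / v)) * (v * t) =
        -(α * ε * n) + α * (t / v) + Real.pi * R' * (α / v) * (α * t) := by
      field_simp; ring
    have e2 : α * (t / v) ≤ 1 := by
      have : t / v ≤ 1 := (div_le_one hv0).2 (hT.trans hvn)
      exact mul_le_one₀ hα1 (by positivity) this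
    have e3 : Real.pi * R' * (α / v) * (α * t) ≤ κ * α * (α * t) :=
      mul_le_mul_of_nonneg_right hθ (by positivity)
    rw [e1]
    linarith
  · have e1 : α / v * (v * (t - ε * n)) - α / v * (1 - Real.pi * R' * (α / v)) * (v * t) =
        -(α * ε * n) + Real.pi * R' * (α / v) * (α * t) := by
      field_simp; ring
    have e3 : Real.pi * R' * (α / v) * (α * t) ≤ κ * α * (α * t) :=
      mul_le_mul_of_nonneg_right hθ (by positivity)
    rw [e1]
    linarith

/-! ### The position of the last visited vertex -/

theorem measurableSet_covered_pair (t₁ t₂ : ℝ) (A₁ A₂ : Finset (ℤ × ℤ)) :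
    MeasurableSet {ω : Sample D n | IsCovered ω t₁ A₁ ∧ IsCovered ω t₂ A₂} :=
  (measurableSet_isCovered t₁ A₁).inter (measurableSet_isCovered t₂ A₂)

/-- One cell of the grid. With `u_j = q exp (-l j / N)`, raising `b` of the `N` factors from
`u_{j+1}` to `u_j` increases the product by at least the share `b / N` of `u_jᴺ - u_{j+1}ᴺ`, up to
the factor `exp (-l)`. -/
theorem grid_step {q l : ℝ} (hq : 0 ≤ q) {a b N : ℕ} (hab : a + b = N) (hN : 0 < (N : ℝ))
    (j : ℕ) :
    q ^ N * (b / N) * (Real.exp (-(l * j)) - Real.exp (-(l * (j + 1 : ℕ)))) * Real.exp (-l) ≤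
      (q * Real.exp (-(l * (j + 1 : ℕ) / N))) ^ a * (q * Real.exp (-(l * j / N))) ^ b -
        (q * Real.exp (-(l * (j + 1 : ℕ) / N))) ^ N := by
  set v := q * Real.exp (-(l * (j + 1 : ℕ) / N)) with hv
  have hv0 : 0 ≤ v := mul_nonneg hq (Real.exp_pos _).le
  have e1 : q * Real.exp (-(l * j / N)) = v * Real.exp (l / N) := by
    rw [hv, mul_assoc, ← Real.exp_add]
    congr 2; push_cast; ring
  have e2 : v ^ a * (q * Real.exp (-(l * j / N))) ^ b = v ^ N * Real.exp (l * (b / N)) := by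
    rw [e1, mul_pow v, ← mul_assoc, ← pow_add, hab, ← Real.exp_nat_mul]
    congr 2; ring
  have e3 : v ^ N = q ^ N * (Real.exp (-(l * j)) * Real.exp (-l)) := by
    rw [hv, mul_pow, ← Real.exp_nat_mul, ← Real.exp_add]
    congr 2; push_cast; field_simp; ring
  have e4 : v ^ N * (1 + l * (b / N)) ≤ v ^ N * Real.exp (l * (b / N)) := by
    refine mul_le_mul_of_nonneg_left ?_ (pow_nonneg hv0 _)
    linarith [Real.add_one_le_exp (l * (b / N : ℝ))]
  have e6 : Real.exp (-(l * (j + 1 : ℕ))) = Real.exp (-(l * j)) * Real.exp (-l) := by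
    rw [← Real.exp_add]; congr 1; push_cast; ring
  have e7 : 1 - Real.exp (-l) ≤ l := by linarith [Real.one_sub_le_exp_neg l]
  have e5 : q ^ N * (b / N) * (Real.exp (-(l * j)) - Real.exp (-(l * (j + 1 : ℕ)))) *
      Real.exp (-l) ≤ v ^ N * (l * (b / N)) := by
    rw [e3, e6]
    calc _ = q ^ N * (b / N) * (Real.exp (-(l * j)) * Real.exp (-l)) * (1 - Real.exp (-l)) := by
          ring
      _ ≤ q ^ N * (b / N) * (Real.exp (-(l * j)) * Real.exp (-l)) * l :=
        mul_le_mul_of_nonneg_left e7 (by positivity)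
      _ = _ := by ring
  rw [e2]
  linarith

/-- The increments over the cells telescope. The total loss `3 l` comes from the factors `exp (-l)`,
from the part `exp (-l k)` below the grid and from the errors `ε'` of the probabilities. -/
theorem grid_sum {Q l ε' : ℝ} (hl : 0 < l) (hQ0 : 0 ≤ Q) (hQ1 : Q ≤ 1) {k : ℕ}
    (hk : Real.exp (-(l * k)) ≤ l) (hkε : k * (2 * ε') ≤ l) :
    Q - 3 * l ≤ ∑ j ∈ Finset.range k,
      (Q * (Real.exp (-(l * j)) - Real.exp (-(l * (j + 1 : ℕ)))) * Real.exp (-l) - 2 * ε') := by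
  have htel : ∑ j ∈ Finset.range k, (Real.exp (-(l * j)) - Real.exp (-(l * (j + 1 : ℕ)))) =
      1 - Real.exp (-(l * k)) := by
    have h := Finset.sum_range_sub' (fun j : ℕ => Real.exp (-(l * j))) k
    simpa using h
  rw [Finset.sum_sub_distrib, ← Finset.sum_mul, ← Finset.mul_sum, htel, Finset.sum_const,
    Finset.card_range, nsmul_eq_mul]
  have h1 : 1 - l ≤ Real.exp (-l) := Real.one_sub_le_exp_neg l
  have h2 : Real.exp (-l) ≤ 1 := by rw [Real.exp_le_one_iff]; linarith
  have h3 : 1 - 2 * l ≤ (1 - Real.exp (-(l * k))) * Real.exp (-l) := by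
    have : Real.exp (-(l * k)) * Real.exp (-l) ≤ Real.exp (-(l * k)) :=
      mul_le_of_le_one_right (Real.exp_pos _).le h2
    linarith
  have h6 := mul_le_mul_of_nonneg_left h3 hQ0
  have h7 : Q * (2 * l) ≤ 2 * l := mul_le_of_le_one_left (by positivity) hQ1
  linarith

/-- The last visited vertex lies in the clusters around `C'` with a probability of at least the
proportion of `C'` among all centres. Along a grid of times at which the probability `u ^ N` of a
complete cover grows geometrically, the cover is completed between two successive times by the
clusters around `C'` alone with a probability of at least the corresponding fraction of the
increment of `u ^ N`. -/
theorem eventually_exists_lastVertex_event (D : PlanarDomain) {η₀ : ℝ}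
    (hη₀ : η₀ ∈ Set.Ioo (0 : ℝ) (1 / 2)) (s₁ : ℝ) {M ε : ℝ} (hM : 0 ≤ M) (hε : 0 < ε) :
    ∀ᶠ n in atTop, ∀ A C : Finset (ℤ × ℤ), (A : Set (ℤ × ℤ)) ⊆ bulk D n →
      IsClustered (clusterScale η₀ n) (n - clusterScale η₀ n) A →
      IsMinimalCover (clusterScale η₀ n) A C → C.Nonempty → ∀ C' ⊆ C,
      ∀ t : ℝ, 0 ≤ t → t ≤ phaseTime n + s₁ * n → C.card * Real.exp (-(t / n)) ≤ M →
      ∃ E : Set (Sample D n), MeasurableSet E ∧ E ⊆ {ω | IsCovered ω t A} ∧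
        (∀ᵐ ω ∂walkLaw D n, ω ∈ E → ∃ v : {x // x ∈ latticeDomain D n},
          lastVertex A ω = some v ∧ v.1 ∈ clusterPoints (clusterScale η₀ n) A C') ∧
        (1 - Real.exp (-(t / n))) ^ C.card * (C'.card / C.card) - ε ≤ (walkLaw D n).real E := by
  set l : ℝ := ε / 3 with hl
  have hl0 : 0 < l := by positivity
  obtain ⟨k, hk⟩ : ∃ k : ℕ, Real.exp (-(l * k)) ≤ ε / 3 := by
    have h : Tendsto (fun k : ℕ => Real.exp (-(l * k))) atTop (𝓝 0) :=
      Real.tendsto_exp_neg_atTop_nhds_zero.comp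
        (tendsto_natCast_atTop_atTop.const_mul_atTop hl0)
    exact (h.eventually_le_const (by positivity : 0 < ε / 3)).exists
  set ε' : ℝ := ε / (6 * (k + 1)) with hε'
  have hkε : k * (2 * ε') ≤ ε / 3 := by
    have : k * (2 * ε') = ε / 3 * (k / (k + 1)) := by rw [hε']; field_simp; ring
    rw [this]
    have : (k : ℝ) / (k + 1) ≤ 1 := by rw [div_le_one (by positivity)]; linarith
    exact mul_le_of_le_one_right (by positivity) this
  filter_upwards [eventually_abs_measure_covered_sub_le D hη₀ s₁ (M := M + l * k) (ε := ε')
    (by positivity) (by positivity), eventually_latticeDomain_nonempty D, eventually_gt_atTop 0]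
    with n hcov hV hn A C hA hcl hmin hCne C' hC' t ht htT hMt
  have hcov := hcov A C hA hcl hmin
  set r := clusterScale η₀ n
  set C'' := C \ C' with hC''
  have hC''C : C'' ⊆ C := Finset.sdiff_subset
  have hdisj : Disjoint C'' C' := Finset.sdiff_disjoint
  set N := C.card with hN
  have hN0 : (0 : ℝ) < N := by exact_mod_cast Finset.card_pos.2 hCne
  have hcard : C''.card + C'.card = N := Finset.card_sdiff_add_card_eq_card hC'
  have hcardR : (C''.card : ℝ) + C'.card = N := by exact_mod_cast hcard
  set q := 1 - Real.exp (-(t / n)) with hq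
  have hq0 : 0 ≤ q := by
    rw [hq, sub_nonneg, Real.exp_le_one_iff, neg_nonpos]; exact div_nonneg ht hn.le
  have hq1 : q < 1 := by rw [hq]; linarith [Real.exp_pos (-(t / n))]
  -- the times `τ j`, in decreasing order, at which one cluster is covered with probability `u j`
  set u : ℕ → ℝ := fun j => q * Real.exp (-(l * j / N)) with hu
  set τ : ℕ → ℝ := fun j => -(n * Real.log (1 - u j)) with hτ
  have hu0 : ∀ j, 0 ≤ u j := fun j => mul_nonneg hq0 (Real.exp_pos _).le
  have huanti : Antitone u := fun i j hij => by
    have : (i : ℝ) ≤ j := Nat.cast_le.2 hij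
    simp only [hu]
    gcongr
  have huz : u 0 = q := by simp [hu]
  have hu1 : ∀ j, u j < 1 := fun j => ((huanti (Nat.zero_le j)).trans_eq huz).trans_lt hq1
  have hexp : ∀ j, Real.exp (-(τ j / n)) = 1 - u j := fun j => by
    have : -(τ j / n) = Real.log (1 - u j) := by simp only [hτ]; field_simp
    rw [this, Real.exp_log (by linarith [hu1 j])]
  have hτz : τ 0 = t := by
    simp only [hτ, huz, hq, sub_sub_cancel, Real.log_exp]; field_simp
  have hτanti : Antitone τ := fun i j hij => by
    have h1 : 1 - u i ≤ 1 - u j := by linarith [huanti hij]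
    have h2 := Real.log_le_log (by linarith [hu1 i]) h1
    simp only [hτ]
    exact neg_le_neg (mul_le_mul_of_nonneg_left h2 hn.le)
  have hτ0 : ∀ j, 0 ≤ τ j := fun j => by
    have : Real.log (1 - u j) ≤ 0 := Real.log_nonpos (by linarith [hu1 j]) (by linarith [hu0 j])
    simp only [hτ]; nlinarith
  have hτT : ∀ j, τ j ≤ phaseTime n + s₁ * n := fun j =>
    ((hτanti (Nat.zero_le j)).trans_eq hτz).trans htT
  have hsum : ∀ j ≤ k, N * (1 - u j) ≤ M + l * k := by
    intro j hj
    have h1 : 1 - l * j / N ≤ Real.exp (-(l * j / N)) := Real.one_sub_le_exp_neg _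
    have h2 : q * (1 - l * j / N) ≤ u j := mul_le_mul_of_nonneg_left h1 hq0
    have h3 : q * (l * j / N) ≤ l * j / N := mul_le_of_le_one_left (by positivity) hq1.le
    have h4 : 1 - u j ≤ Real.exp (-(t / n)) + l * j / N := by
      have : 1 - q = Real.exp (-(t / n)) := by rw [hq]; ring
      linarith
    have h5 := mul_le_mul_of_nonneg_left h4 hN0.le
    have h6 : N * (Real.exp (-(t / n)) + l * j / N) = N * Real.exp (-(t / n)) + l * j := by
      field_simp
    have h7 : l * j ≤ l * k := mul_le_mul_of_nonneg_left (Nat.cast_le.2 hj) hl0.le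
    linarith
  set X : ℕ → Set (Sample D n) := fun j => {ω | IsCovered ω (τ (j + 1)) (clusterPoints r A C'') ∧
    IsCovered ω (τ j) (clusterPoints r A C')} with hX
  set Y : ℕ → Set (Sample D n) := fun j => {ω | IsCovered ω (τ (j + 1)) (clusterPoints r A C'') ∧
    IsCovered ω (τ (j + 1)) (clusterPoints r A C')} with hY
  have hsplit : ∀ x ∈ A, x ∈ clusterPoints r A C' ∨ x ∈ clusterPoints r A C'' := by
    intro x hx
    obtain ⟨z, hz, hxz⟩ := hmin.1 x hx
    by_cases hz' : z ∈ C'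
    · exact Or.inl (mem_clusterPoints.2 ⟨hx, z, hz', hxz⟩)
    · exact Or.inr (mem_clusterPoints.2 ⟨hx, z, Finset.mem_sdiff.2 ⟨hz, hz'⟩, hxz⟩)
  have hcovA : ∀ (ω : Sample D n) s, IsCovered ω s (clusterPoints r A C'') →
      IsCovered ω s (clusterPoints r A C') → IsCovered ω s A := fun ω s h1 h2 v hv =>
    (hsplit v.1 hv).elim (h2 v) (h1 v)
  have hcovsub : ∀ (ω : Sample D n) s C₀, IsCovered ω s A → IsCovered ω s (clusterPoints r A C₀) :=
    fun ω s C₀ h v hv => h v (mem_clusterPoints.1 hv).1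
  have hXm : ∀ j, MeasurableSet (X j \ Y j) := fun j =>
    (measurableSet_covered_pair _ _ _ _).diff (measurableSet_covered_pair _ _ _ _)
  have hXcov : ∀ j, ∀ ω ∈ X j, IsCovered ω (τ j) A := fun j ω h =>
    hcovA ω _ (h.1.mono (hτanti (Nat.le_succ j))) h.2
  have hYcov : ∀ j, ∀ ω ∈ X j \ Y j, ¬IsCovered ω (τ (j + 1)) A := fun j ω h hc =>
    h.2 ⟨hcovsub ω _ _ hc, hcovsub ω _ _ hc⟩
  have hpd : Set.PairwiseDisjoint (Finset.range k : Set ℕ) fun j => X j \ Y j := by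
    have h1 : ∀ i j, i < j → Disjoint (X i \ Y i) (X j \ Y j) := by
      intro i j hij
      rw [Set.disjoint_left]
      intro ω hi hj
      exact hYcov i ω hi ((hXcov j ω hj.1).mono (hτanti (Nat.succ_le_of_lt hij)))
    intro i _ j _ hij
    rcases lt_or_gt_of_ne hij with h | h
    · exact h1 i j h
    · exact (h1 j i h).symm
  refine ⟨⋃ j ∈ Finset.range k, X j \ Y j, Finset.measurableSet_biUnion _ fun j _ => hXm j,
    ?_, ?_, ?_⟩
  · refine Set.iUnion₂_subset fun j _ ω hω => ?_
    exact (hXcov j ω hω.1).mono ((hτanti (Nat.zero_le j)).trans_eq hτz)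
  · filter_upwards [ae_isRegular hV, ae_exists_skeleton_eq hV] with ω hω hrec hmem
    obtain ⟨j, -, hj⟩ := Set.mem_iUnion₂.1 hmem
    obtain ⟨v, hv1, -, hv2⟩ := hω.exists_lastVertex_eq hV hrec (hτ0 (j + 1)) hsplit hj.1.1
      (hYcov j ω hj)
    exact ⟨v, hv1, hv2⟩
  rw [measureReal_biUnion_finset hpd fun j _ => hXm j]
  set α : ℝ := C'.card / N with hα
  have hα0 : 0 ≤ α := by positivity
  have hα1 : α ≤ 1 := (div_le_one hN0).2 (by exact_mod_cast Finset.card_le_card hC')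
  have hQ0 : 0 ≤ q ^ N := pow_nonneg hq0 N
  have hQ1 : q ^ N ≤ 1 := pow_le_one₀ hq0 hq1.le
  have hstep : ∀ j ∈ Finset.range k, q ^ N * α * (Real.exp (-(l * j)) -
      Real.exp (-(l * (j + 1 : ℕ)))) * Real.exp (-l) - 2 * ε' ≤ (walkLaw D n).real (X j \ Y j) := by
    intro j hj
    have hjk : j + 1 ≤ k := Finset.mem_range.1 hj
    have h0 : C''.card * (1 - u (j + 1)) + C'.card * (1 - u j) ≤ M + l * k := by
      have h1 := hsum (j + 1) hjk
      have h2 : C'.card * (1 - u j) ≤ C'.card * (1 - u (j + 1)) :=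
        mul_le_mul_of_nonneg_left (by linarith [huanti (Nat.le_succ j)]) (Nat.cast_nonneg _)
      rw [← hcardR] at h1
      linarith
    have hx := hcov C'' hC''C C' hC' hdisj (τ (j + 1)) (τ j) (hτ0 _) (hτanti (Nat.le_succ j))
      (hτT j) (by rw [hexp, hexp]; exact h0)
    have hy := hcov C'' hC''C C' hC' hdisj (τ (j + 1)) (τ (j + 1)) (hτ0 _) le_rfl
      (hτT _) (by
        rw [hexp, ← add_mul, hcardR]; exact hsum (j + 1) hjk)
    rw [hexp, hexp, sub_sub_cancel, sub_sub_cancel, abs_le] at hx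
    rw [hexp, sub_sub_cancel, ← pow_add, hcard, abs_le] at hy
    have hd : (walkLaw D n).real (X j) - (walkLaw D n).real (Y j) ≤
        (walkLaw D n).real (X j \ Y j) := le_measureReal_sdiff
    have hg := grid_step (l := l) hq0 hcard hN0 j
    linarith [hx.1, hy.2]
  have h := grid_sum (ε' := ε') hl0 (mul_nonneg hQ0 hα0) (mul_le_one₀ hQ1 hα0 hα1) hk hkε
  have h3 : 3 * l = ε := by rw [hl]; ring
  rw [h3] at h
  exact h.trans (Finset.sum_le_sum hstep)

/-! ### The cluster process -/

section ClusterProcess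
variable {C : Finset (ℤ × ℤ)}

open Classical in
theorem clusterProcess_apply (C : Finset (ℤ × ℤ)) (W : Set Plane) : clusterProcess n C W =
    ((C.filter fun z => Real.exp (-n) • toPlane z ∈ W).card : ENNReal) := by
  rw [clusterProcess, Measure.finsetSum_apply, Finset.card_filter, Nat.cast_sum]
  refine Finset.sum_congr rfl fun z _ => ?_
  rw [Measure.dirac_apply, Set.indicator]
  split_ifs <;> simp

theorem totalMass_clusterProcess : totalMass (clusterProcess n C) = C.card := by
  classical
  rw [totalMass, measureReal_def, clusterProcess_apply]; simp

open Classical in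
theorem normalized_clusterProcess (W : Set Plane) :
    (normalized (clusterProcess n C)).real W =
      (C.filter fun z => Real.exp (-n) • toPlane z ∈ W).card / (C.card : ℝ) := by
  rw [normalized, measureReal_ennreal_smul_apply, measureReal_def, clusterProcess_apply,
    clusterProcess_apply, ENNReal.toReal_inv, ENNReal.toReal_natCast, ENNReal.toReal_natCast]
  simp [div_eq_inv_mul]

theorem gumbelWeight_clusterProcess (hn : 0 < n) (s : ℝ) (hC : C.Nonempty) :
    gumbelWeight n s (clusterProcess n C) =
      Real.exp (-(C.card * (Real.exp (-s) / Real.sqrt n))) := by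
  have hN : (0 : ℝ) < C.card := by exact_mod_cast Finset.card_pos.2 hC
  have hs : 0 < Real.sqrt n := Real.sqrt_pos.2 hn
  rw [gumbelWeight, totalMass_clusterProcess, neg_sub, sub_eq_add_neg, Real.exp_add,
    Real.exp_log (by positivity)]
  congr 2; ring

end ClusterProcess

/-! ### The limit of the cover time and of the last visited vertex -/

/-- Together with `one_sub_pow_le_exp_neg`, the Poisson approximation with error `N p²`. -/
theorem exp_neg_sub_le_one_sub_pow {p : ℝ} (hp0 : 0 ≤ p) (hp1 : p ≤ 1) (N : ℕ) :
    Real.exp (-(N * p)) - N * p ^ 2 ≤ (1 - p) ^ N := by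
  have h1 : Real.exp (-p) - p ^ 2 ≤ 1 - p := by
    have := Real.abs_exp_sub_one_sub_id_le (x := -p) (by rwa [abs_neg, abs_of_nonneg hp0])
    rw [neg_sq] at this
    linarith [(abs_le.1 this).2]
  have h2 : Real.exp (-p) ≤ 1 := by rw [Real.exp_le_one_iff]; linarith
  have h3 : 1 - p ≤ Real.exp (-p) := Real.one_sub_le_exp_neg p
  have hsq := sq_nonneg p
  induction N with
  | zero => simp
  | succ N ih =>
    have e1 : Real.exp (-((N + 1 : ℕ) * p)) = Real.exp (-(N * p)) * Real.exp (-p) := by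
      rw [← Real.exp_add]; congr 1; push_cast; ring
    have e2 : (1 - p) ^ N ≤ 1 := pow_le_one₀ (by linarith) (by linarith)
    have e3 : 0 ≤ (1 - p) ^ N := pow_nonneg (by linarith) N
    have e4 : Real.exp (-(N * p)) ≤ 1 := by
      rw [Real.exp_le_one_iff, neg_nonpos]; positivity
    have e5 : 0 ≤ N * p ^ 2 := by positivity
    have e6 := mul_le_mul_of_nonneg_right ih (by linarith : 0 ≤ 1 - p)
    have e7 : Real.exp (-(N * p)) * (Real.exp (-p) - p ^ 2) ≤ Real.exp (-(N * p)) * (1 - p) :=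
      mul_le_mul_of_nonneg_left h1 (Real.exp_pos _).le
    have e8 : Real.exp (-(N * p)) * p ^ 2 ≤ p ^ 2 := mul_le_of_le_one_left hsq e4
    have e9 : N * p ^ 2 * (1 - p) ≤ N * p ^ 2 := mul_le_of_le_one_right e5 (by linarith)
    rw [e1, pow_succ (1 - p) N]
    push_cast
    linarith

theorem one_sub_pow_le_exp_neg {p : ℝ} (hp1 : p ≤ 1) (N : ℕ) :
    (1 - p) ^ N ≤ Real.exp (-(N * p)) := by
  have h := pow_le_pow_left₀ (by linarith) (Real.one_sub_le_exp_neg p) N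
  rw [← Real.exp_nat_mul] at h
  rwa [← mul_neg]

/-- The case of a single family of centres in `eventually_abs_measure_covered_sub_le`. -/
theorem eventually_abs_measure_isCovered_sub_le (D : PlanarDomain) {η₀ : ℝ}
    (hη₀ : η₀ ∈ Set.Ioo (0 : ℝ) (1 / 2)) (s₁ : ℝ) {M ε : ℝ} (hM : 0 ≤ M) (hε : 0 < ε) :
    ∀ᶠ n in atTop, ∀ A C : Finset (ℤ × ℤ), (A : Set (ℤ × ℤ)) ⊆ bulk D n →
      IsClustered (clusterScale η₀ n) (n - clusterScale η₀ n) A →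
      IsMinimalCover (clusterScale η₀ n) A C → ∀ C' ⊆ C,
      ∀ t : ℝ, 0 ≤ t → t ≤ phaseTime n + s₁ * n → C'.card * Real.exp (-(t / n)) ≤ M →
      |(walkLaw D n).real {ω | IsCovered ω t (clusterPoints (clusterScale η₀ n) A C')} -
        (1 - Real.exp (-(t / n))) ^ C'.card| ≤ ε := by
  filter_upwards [eventually_abs_measure_covered_sub_le D hη₀ s₁ hM hε]
    with n h A C hA hcl hmin C' hC' t ht htT hM'
  have h1 := h A C hA hcl hmin ∅ (Finset.empty_subset C) C' hC' (Finset.disjoint_empty_left _) t t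
    ht le_rfl htT (by simpa using hM')
  have h2 : ∀ ω : Sample D n, IsCovered ω t (clusterPoints (clusterScale η₀ n) A ∅) :=
    fun ω v hv => by
      obtain ⟨-, z, hz, -⟩ := mem_clusterPoints.1 hv
      exact absurd hz (Finset.notMem_empty z)
  simpa [h2] using h1

/-- The event that `A` is covered by boundary time `t` and its last visited vertex is in `eⁿ W`. -/
def lastVertexEvent (D : PlanarDomain) (n t : ℝ) (A : Finset (ℤ × ℤ)) (W : Set Plane) :
    Set (Sample D n) :=
  {ω | IsCovered ω t A ∧ ∃ x : {x // x ∈ latticeDomain D n}, lastVertex A ω = some x ∧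
    Real.exp (-n) • toPlane x.1 ∈ W}

theorem coverProb_eq (hV : (latticeDomain D n).Nonempty) {t : ℝ} (ht : 0 ≤ t)
    (A : Finset (ℤ × ℤ)) (W : Set Plane) :
    coverProb D n t A W = (walkLaw D n).real (lastVertexEvent D n t A W) := by
  rw [coverProb, measureReal_def, measureReal_def]
  congr 1
  refine measure_congr ?_
  filter_upwards [ae_coverTime_le_iff hV ht A] with ω hω
  exact propext (and_congr_left' hω)

theorem measureReal_mono_ae {Ω : Type*} [MeasurableSpace Ω] {μ : Measure Ω} [IsFiniteMeasure μ]
    {s t : Set Ω} (h : ∀ᵐ ω ∂μ, ω ∈ s → ω ∈ t) : μ.real s ≤ μ.real t :=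
  ENNReal.toReal_mono (measure_ne_top _ _) (measure_mono_ae h)

section Split
variable {r : ℝ} {A C : Finset (ℤ × ℤ)} {W : Set Plane}

theorem mem_iff_of_notMem_splitCenters {z x : ℤ × ℤ} (hz : z ∈ C)
    (hzS : Real.exp (-n) • toPlane z ∉ splitCenters n r A C W) (hx : x ∈ A) (hxz : x ∈ ball z r) :
    Real.exp (-n) • toPlane x ∈ W ↔ Real.exp (-n) • toPlane z ∈ W := by
  by_contra h
  exact hzS ⟨z, hz, rfl, x, hx, hxz, h⟩

end Split

/-- The bounds on the joint law for a bounded ratio `|C| / √n`, stated with the cover probability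
`(1 - p) ^ |C|` of independent clusters in place of the Gumbel weight. -/
theorem eventually_coverProb_bounds (D : PlanarDomain) {η₀ : ℝ}
    (hη₀ : η₀ ∈ Set.Ioo (0 : ℝ) (1 / 2)) (s₁ : ℝ) {M ε : ℝ} (hM : 0 ≤ M) (hε : 0 < ε) :
    ∀ᶠ n in atTop, ∀ A C : Finset (ℤ × ℤ), (A : Set (ℤ × ℤ)) ⊆ bulk D n →
      IsClustered (clusterScale η₀ n) (n - clusterScale η₀ n) A →
      IsMinimalCover (clusterScale η₀ n) A C → C.Nonempty →
      ∀ t : ℝ, 0 ≤ t → t ≤ phaseTime n + s₁ * n → C.card * Real.exp (-(t / n)) ≤ M →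
      ∀ W : Set Plane,
      |coverProb D n t A W - (1 - Real.exp (-(t / n))) ^ C.card *
        (normalized (clusterProcess n C)).real W| ≤
      (1 - Real.exp (-(t / n))) ^ C.card * (normalized (clusterProcess n C)).real
        (splitCenters n (clusterScale η₀ n) A C W) + ε := by
  classical
  filter_upwards [eventually_exists_lastVertex_event D hη₀ s₁ hM (half_pos hε),
    eventually_abs_measure_isCovered_sub_le D hη₀ s₁ hM (half_pos hε),
    eventually_latticeDomain_nonempty D, eventually_gt_atTop 0]
    with n hlast hcov hV hn A C hA hcl hmin hC t ht htT hMt W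
  have hlast := hlast A C hA hcl hmin hC
  have hcov := hcov A C hA hcl hmin C subset_rfl t ht htT hMt
  rw [hmin.clusterPoints_eq] at hcov
  set r := clusterScale η₀ n
  set S := splitCenters n r A C W with hS
  set y := (1 - Real.exp (-(t / n))) ^ C.card with hy
  have hy0 : 0 ≤ y := by
    refine pow_nonneg ?_ _
    rw [sub_nonneg, Real.exp_le_one_iff, neg_nonpos]; exact div_nonneg ht hn.le
  have hN : (0 : ℝ) < C.card := by exact_mod_cast Finset.card_pos.2 hC
  rw [coverProb_eq hV ht, normalized_clusterProcess, normalized_clusterProcess]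
  set Z := lastVertexEvent D n t A W with hZ
  set CW := C.filter fun z => Real.exp (-n) • toPlane z ∈ W with hCW
  set CS := C.filter fun z => Real.exp (-n) • toPlane z ∈ S with hCS
  set C₁ := CW \ CS with hC₁
  set C₂ := (C \ CW) \ CS with hC₂
  have hCWC : CW ⊆ C := Finset.filter_subset _ _
  have hC₁C : C₁ ⊆ C := Finset.sdiff_subset.trans hCWC
  have hC₂C : C₂ ⊆ C := Finset.sdiff_subset.trans Finset.sdiff_subset
  have hcard₁ : (CW.card : ℝ) - CS.card ≤ C₁.card := by
    have : CW.card ≤ C₁.card + CS.card := by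
      have := Finset.le_card_sdiff CS CW
      rw [← hC₁] at this
      omega
    have : (CW.card : ℝ) ≤ C₁.card + CS.card := by exact_mod_cast this
    linarith
  have hcard₂ : (C.card : ℝ) - CW.card - CS.card ≤ C₂.card := by
    have : C.card ≤ C₂.card + CS.card + CW.card := by
      have h1 := Finset.le_card_sdiff CS (C \ CW)
      rw [← hC₂] at h1
      have h2 := Finset.le_card_sdiff CW C
      omega
    have : (C.card : ℝ) ≤ C₂.card + CS.card + CW.card := by exact_mod_cast this
    linarith
  have hnot : ∀ z ∈ C, z ∉ CS → Real.exp (-n) • toPlane z ∉ S := fun z hz h h' =>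
    h (Finset.mem_filter.2 ⟨hz, h'⟩)
  -- lower bound: the last visited vertex is in a cluster contained in `eⁿ W`
  have hlow : y * (C₁.card / C.card) - ε / 2 ≤ (walkLaw D n).real Z := by
    obtain ⟨E, -, hEc, hEl, hEp⟩ := hlast C₁ hC₁C t ht htT hMt
    refine hEp.trans (measureReal_mono_ae ?_)
    filter_upwards [hEl] with ω hω hmem
    obtain ⟨v, hv, hvC⟩ := hω hmem
    obtain ⟨hvA, z, hz, hvz⟩ := mem_clusterPoints.1 hvC
    obtain ⟨hzW, hzS⟩ := Finset.mem_sdiff.1 hz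
    exact ⟨hEc hmem, v, hv, (mem_iff_of_notMem_splitCenters (hCWC hzW)
      (hnot z (hCWC hzW) hzS) hvA hvz).2 (Finset.mem_filter.1 hzW).2⟩
  -- upper bound: the last visited vertex is not in a cluster disjoint from `eⁿ W`
  have hup : (walkLaw D n).real Z ≤
      (walkLaw D n).real {ω | IsCovered ω t A} - (y * (C₂.card / C.card) - ε / 2) := by
    obtain ⟨E, hEm, hEc, hEl, hEp⟩ := hlast C₂ hC₂C t ht htT hMt
    have h1 : (walkLaw D n).real Z ≤ (walkLaw D n).real ({ω | IsCovered ω t A} \ E) := by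
      refine measureReal_mono_ae ?_
      filter_upwards [hEl] with ω hω hmem
      refine ⟨hmem.1, fun hE => ?_⟩
      obtain ⟨v, hv, hvC⟩ := hω hE
      obtain ⟨hvA, z, hz, hvz⟩ := mem_clusterPoints.1 hvC
      obtain ⟨hzW, hzS⟩ := Finset.mem_sdiff.1 hz
      obtain ⟨hzC, hzW⟩ := Finset.mem_sdiff.1 hzW
      obtain ⟨w, hw, hwW⟩ := hmem.2
      rw [hv, Option.some.injEq] at hw
      subst hw
      exact hzW (Finset.mem_filter.2 ⟨hzC, (mem_iff_of_notMem_splitCenters hzC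
        (hnot z hzC hzS) hvA hvz).1 hwW⟩)
    rw [measureReal_sdiff hEc hEm] at h1
    linarith
  have e1 : y * ((CW.card - CS.card) / C.card) ≤ y * (C₁.card / C.card) := by gcongr
  have e2 : y * ((C.card - CW.card - CS.card) / C.card) ≤ y * (C₂.card / C.card) := by gcongr
  have e3 : y * ((C.card - CW.card - CS.card) / C.card) =
      y - y * (CW.card / C.card) - y * (CS.card / C.card) := by field_simp
  have e4 : y * ((CW.card - CS.card) / C.card) =
      y * (CW.card / C.card) - y * (CS.card / C.card) := by ring
  rw [abs_le] at hcov ⊢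
  constructor <;> linarith [hcov.1, hcov.2]

theorem normalized_clusterProcess_nonneg_le_one (C : Finset (ℤ × ℤ)) (W : Set Plane) :
    0 ≤ (normalized (clusterProcess n C)).real W ∧
      (normalized (clusterProcess n C)).real W ≤ 1 := by
  classical
  refine ⟨measureReal_nonneg, ?_⟩
  rw [normalized_clusterProcess]
  exact div_le_one_of_le₀ (Nat.cast_le.2 (Finset.card_filter_le _ _)) (Nat.cast_nonneg _)

/-- The limit of the joint law, uniformly in all clustered sets. If the number of clusters exceeds
`M √n`, then both the cover probability and the Gumbel weight are small. -/
theorem eventually_abs_coverProb_sub_le (D : PlanarDomain) {η₀ : ℝ}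
    (hη₀ : η₀ ∈ Set.Ioo (0 : ℝ) (1 / 2)) {S ε : ℝ} (hε : 0 < ε) :
    ∀ᶠ n in atTop, ∀ s : ℝ, |s| ≤ S → ∀ A : Finset (ℤ × ℤ), A.Nonempty →
      (A : Set (ℤ × ℤ)) ⊆ bulk D n →
      IsClustered (clusterScale η₀ n) (n - clusterScale η₀ n) A →
      ∀ C : Finset (ℤ × ℤ), IsMinimalCover (clusterScale η₀ n) A C → ∀ W : Set Plane,
      |coverProb D n (phaseTime n + s * n) A W - gumbelWeight n s (clusterProcess n C) *
          (normalized (clusterProcess n C)).real W| ≤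
        ε + gumbelWeight n s (clusterProcess n C) * (normalized (clusterProcess n C)).real
          (splitCenters n (clusterScale η₀ n) A C W) := by
  set e₁ : ℝ := ε / 4 with he₁
  have he₁0 : 0 < e₁ := by positivity
  -- With this `M`, more than `(M - 1) √n` clusters that are missed with probability at least
  -- `exp (-S) / √n` each are all covered with probability at most `e₁`.
  set M : ℝ := 1 + Real.exp S * |Real.log e₁| with hM
  have hM1 : 1 ≤ M := le_add_of_nonneg_right (by positivity)
  set P : ℝ := M * Real.exp S with hP
  have hP0 : 0 ≤ P := by positivity
  have hsmall : ∀ᶠ n : ℝ in atTop, Real.exp S / Real.sqrt n ≤ min 1 (e₁ / (P + 1)) := by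
    have : Tendsto (fun n : ℝ => Real.exp S / Real.sqrt n) atTop (𝓝 0) :=
      Real.tendsto_sqrt_atTop.const_div_atTop _
    exact this.eventually_le_const (by positivity)
  filter_upwards [eventually_coverProb_bounds D hη₀ S hP0 he₁0,
    eventually_abs_measure_isCovered_sub_le D hη₀ S hP0 he₁0, hsmall,
    eventually_latticeDomain_nonempty D, eventually_ge_atTop 1, eventually_phaseTime_nonneg (-S)]
    with n hbd hcov hsmall hV hn1 htS s hs A hAne hA hcl C hmin W
  have hn : 0 < n := by linarith
  have hbd := hbd A C hA hcl hmin
  have hcov := hcov A C hA hcl hmin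
  obtain ⟨hs1, hs2⟩ := abs_le.1 hs
  set t := phaseTime n + s * n with ht
  have ht0 : 0 ≤ t := htS.trans (by rw [ht]; gcongr)
  have htT : t ≤ phaseTime n + S * n := by rw [ht]; gcongr
  have hC : C.Nonempty := by
    obtain ⟨x, hx⟩ := hAne
    obtain ⟨z, hz, -⟩ := hmin.1 x hx
    exact ⟨z, hz⟩
  rw [gumbelWeight_clusterProcess hn s hC, ← exp_neg_phaseTime hn s, ← ht]
  set p := Real.exp (-(t / n)) with hp
  have hpeq : p = Real.exp (-s) / Real.sqrt n := exp_neg_phaseTime hn s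
  have hp0 : 0 < p := Real.exp_pos _
  have hsq : 0 < Real.sqrt n := Real.sqrt_pos.2 hn
  have hpS : p ≤ Real.exp S / Real.sqrt n := by rw [hpeq]; gcongr; linarith
  have hp1 : p ≤ 1 := hpS.trans (hsmall.trans (min_le_left _ _))
  have hpe : p ≤ e₁ / (P + 1) := hpS.trans (hsmall.trans (min_le_right _ _))
  set a := (normalized (clusterProcess n C)).real W
  set b := (normalized (clusterProcess n C)).real (splitCenters n (clusterScale η₀ n) A C W)
  obtain ⟨ha0, ha1⟩ : 0 ≤ a ∧ a ≤ 1 := normalized_clusterProcess_nonneg_le_one C W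
  obtain ⟨hb0, hb1⟩ : 0 ≤ b ∧ b ≤ 1 := normalized_clusterProcess_nonneg_le_one C _
  have hMp : M * Real.sqrt n * p ≤ P := by
    calc M * Real.sqrt n * p ≤ M * Real.sqrt n * (Real.exp S / Real.sqrt n) := by gcongr
      _ = P := by rw [hP]; field_simp
  rcases le_or_gt (C.card : ℝ) (M * Real.sqrt n) with hle | hgt
  · have hNp : C.card * p ≤ P := (mul_le_mul_of_nonneg_right hle hp0.le).trans hMp
    have h1 := hbd hC t ht0 htT hNp W
    have h2 := exp_neg_sub_le_one_sub_pow hp0.le hp1 C.card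
    have h3 := one_sub_pow_le_exp_neg hp1 C.card
    have h4 : C.card * p ^ 2 ≤ e₁ := by
      calc C.card * p ^ 2 = C.card * p * p := by ring
        _ ≤ P * (e₁ / (P + 1)) := mul_le_mul hNp hpe hp0.le hP0
        _ = e₁ * (P / (P + 1)) := by ring
        _ ≤ e₁ := mul_le_of_le_one_right he₁0.le (by rw [div_le_one (by positivity)]; linarith)
    set y := (1 - p) ^ C.card
    set w := Real.exp (-(C.card * p))
    have h5 : 0 ≤ (w - y) * a ∧ (w - y) * a ≤ e₁ := by
      have : 0 ≤ w - y := by linarith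
      exact ⟨mul_nonneg this ha0, (mul_le_of_le_one_right this ha1).trans (by linarith)⟩
    have h6 : y * b ≤ w * b := mul_le_mul_of_nonneg_right h3 hb0
    rw [abs_le] at h1 ⊢
    constructor <;> linarith [h1.1, h1.2, h5.1, h5.2]
  · -- a subfamily of `⌊M √n⌋` clusters is already unlikely to be covered
    set N₀ := ⌊M * Real.sqrt n⌋₊ with hN₀
    have hN₀le : (N₀ : ℝ) ≤ M * Real.sqrt n := Nat.floor_le (by positivity)
    have hN₀C : N₀ ≤ C.card := Nat.cast_le.1 (hN₀le.trans hgt.le)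
    obtain ⟨C₀, hC₀, hcard⟩ := Finset.exists_subset_card_eq hN₀C
    have hNp : C₀.card * p ≤ P := by
      rw [hcard]; exact (mul_le_mul_of_nonneg_right hN₀le hp0.le).trans hMp
    have h1 := hcov C₀ hC₀ t ht0 htT hNp
    have h2 : Real.exp (-(N₀ * p)) ≤ e₁ := by
      have e1 : M * Real.sqrt n < N₀ + 1 := Nat.lt_floor_add_one _
      have e2 : Real.exp (-S) / Real.sqrt n ≤ p := by rw [hpeq]; gcongr
      have e3 : (M - 1) * Real.sqrt n ≤ N₀ := by
        have : 1 ≤ Real.sqrt n := Real.one_le_sqrt.2 hn1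
        linarith
      have e4 : |Real.log e₁| ≤ N₀ * p := by
        calc |Real.log e₁| = (M - 1) * Real.sqrt n * (Real.exp (-S) / Real.sqrt n) := by
              rw [hM, Real.exp_neg]; field_simp; ring
          _ ≤ N₀ * p := mul_le_mul e3 e2 (by positivity) (Nat.cast_nonneg _)
      rw [← Real.le_log_iff_exp_le he₁0]
      linarith [neg_abs_le (Real.log e₁)]
    have h3 := one_sub_pow_le_exp_neg hp1 N₀
    rw [hcard, abs_le] at h1
    have h4 : Real.exp (-(C.card * p)) ≤ e₁ := by
      refine le_trans (Real.exp_le_exp.2 (neg_le_neg ?_)) h2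
      exact mul_le_mul_of_nonneg_right (Nat.cast_le.2 hN₀C) hp0.le
    have h5 : coverProb D n t A W ≤ 2 * e₁ := by
      rw [coverProb_eq hV ht0]
      refine (measureReal_mono (s₂ := {ω | IsCovered ω t
        (clusterPoints (clusterScale η₀ n) A C₀)}) ?_).trans (by linarith [h1.2])
      rintro ω ⟨h, -⟩ v hv
      exact h v (mem_clusterPoints.1 hv).1
    have h6 : 0 ≤ coverProb D n t A W := measureReal_nonneg
    set w := Real.exp (-(C.card * p))
    have hw0 : 0 ≤ w := (Real.exp_pos _).le
    have h7 : 0 ≤ w * a := mul_nonneg hw0 ha0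
    have h8 : w * a ≤ w := mul_le_of_le_one_right hw0 ha1
    have h9 : 0 ≤ w * b := mul_nonneg hw0 hb0
    rw [abs_le]
    constructor <;> linarith

theorem exists_pos_forall_ge {p : ℝ → Prop} (h : ∀ᶠ n in atTop, p n) :
    ∃ n₀ : ℝ, 0 < n₀ ∧ ∀ n, n₀ ≤ n → p n := by
  obtain ⟨a, ha⟩ := eventually_atTop.1 h
  exact ⟨max a 1, by positivity, fun n hn => ha n ((le_max_left _ _).trans hn)⟩

end PhaseB

end

theorem mainTheorem6 (D : PhaseB.PlanarDomain) (η₀ : ℝ) (hη₀ : η₀ ∈ Set.Ioo (0 : ℝ) (1 / 2)) :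
    (∀ K : Set ℝ, IsCompact K → ∀ ε : ℝ, 0 < ε → ∃ n₀ : ℝ, 0 < n₀ ∧ ∀ n : ℝ, n₀ ≤ n →
      ∀ s ∈ K, ∀ A : Finset (ℤ × ℤ), A.Nonempty → (A : Set (ℤ × ℤ)) ⊆ PhaseB.bulk D n →
        PhaseB.IsClustered (PhaseB.clusterScale η₀ n) (n - PhaseB.clusterScale η₀ n) A →
        ∀ C : Finset (ℤ × ℤ), PhaseB.IsMinimalCover (PhaseB.clusterScale η₀ n) A C →
        ∀ W : Set PhaseB.Plane, W ⊆ D.carrier →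
          |PhaseB.coverProb D n (PhaseB.phaseTime n + s * n) A W
              - PhaseB.gumbelWeight n s (PhaseB.clusterProcess n C)
                * (PhaseB.normalized (PhaseB.clusterProcess n C)).real W|
            ≤ ε + PhaseB.gumbelWeight n s (PhaseB.clusterProcess n C)
                * (PhaseB.normalized (PhaseB.clusterProcess n C)).real
                    (PhaseB.splitCenters n (PhaseB.clusterScale η₀ n) A C W)) ∧
    (∀ s : ℝ, ∃ n₀ : ℝ, 0 < n₀ ∧ ∀ n : ℝ, n₀ ≤ n →
      ∀ A : Finset (ℤ × ℤ), A ⊆ PhaseB.latticeDomain D n →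
        (PhaseB.walkLaw D n).real
            {ω | PhaseB.phaseTime n + s * n < PhaseB.coverTime A ω}
          ≤ 2 * Real.exp (-s) * ((A.card : ℝ) / Real.sqrt n)) ∧
    (∀ s : ℝ, ∀ ε : ℝ, 0 < ε →
      Filter.Tendsto (fun n : ℝ => (PhaseB.walkLaw D n).real
          {ω | ε < |(PhaseB.realTime ω (PhaseB.phaseTime n + s * n)
                      / ((PhaseB.latticeDomain D n).card : ℝ)
                    - (PhaseB.phaseTime n + s * n)) / n|})
        Filter.atTop (nhds 0)) := by
  refine ⟨fun K hK ε hε => ?_, fun s => ?_, fun s ε hε => ?_⟩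
  · obtain ⟨S, hS⟩ := hK.isBounded.exists_norm_le
    obtain ⟨n₀, h0, h⟩ := PhaseB.exists_pos_forall_ge
      (PhaseB.eventually_abs_coverProb_sub_le D hη₀ (S := S) hε)
    exact ⟨n₀, h0, fun n hn s hs A hAne hA hcl C hC W _ =>
      h n hn s (hS s hs) A hAne hA hcl C hC W⟩
  · exact PhaseB.exists_pos_forall_ge (PhaseB.eventually_measure_lt_coverTime_le D s)
  · exact PhaseB.tendsto_measure_realTime D s hε
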